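/- **Symmetric Picard categories.** A *symmetric Picard category* is a symmetric monoidal category $(\mathcal A,\otimes,I)$ in which every arrow is invertible, together with a chosen object $a^\bullet$ and a chosen arrow $j_a:I\to a^\bullet\otimes a$ for every object $a$. They are the objects of a 2-category $SPC$ whose 1-cells are the symmetric monoidal functors and whose 2-cells are the monoidal natural transformations. The functor $a\mapsto a^\bullet$ extends uniquely to a 1-cell $inv:\mathcal A\to\mathcal A$ for which $j$ is a monoidal natural transformation. A 1-cell is *strict* if it preserves the monoidal structure, the objects $a^\bullet$ and the arrows $j_a$ strictly. The internal hom $[\mathcal A,\mathcal B]$ is the category of 1-cells $\mathcal A\to\mathcal B$ with the pointwise symmetric monoidal structure, $F^\bullet=inv\circ F$, and $j$ pointwise. It has the usual 1-cells $[1,G]:[\mathcal A,\mathcal B]\to[\mathcal A,\mathcal C]$, $[F,1]:[\mathcal B,\mathcal C]\to[\mathcal A,\mathcal C]$, $[\mathcal A,-]:[\mathcal B,\mathcal C]\to[[\mathcal A,\mathcal B],[\mathcal A,\mathcal C]]$ and $ev_a:[\mathcal A,\mathcal B]\to\mathcal B$, and every 1-cell $F:\mathcal A\to[\mathcal B,\mathcal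 C]$ has a dual $F^*:\mathcal B\to[\mathcal A,\mathcal C]$, $F^*(b)(a)=F(a)(b)$. **Unit and tensor product.** The unit $\mathbf I$ of $SPC$ is the symmetric Picard category freely presented by one generating object $\star$. For every $\mathcal A$, $v_{\mathcal A}:\mathbf I\to[\mathcal A,\mathcal A]$ is the strict 1-cell with $v_{\mathcal A}(\star)=1_{\mathcal A}$. The tensor product $\mathcal A\otimes\mathcal B$ is the symmetric Picard category presented by generating objects $a\otimes b$ ($a\in\mathcal A$, $b\in\mathcal B$); generating arrows $f\otimes b$, $a\otimes g$, $\gamma_{a,a',b}:(a\otimes b)\otimes(a'\otimes b)\to(a\otimes a')\otimes b$ and $\delta_{a,b,b'}:(a\otimes b)\otimes(a\otimes b')\to a\otimes(b\otimes b')$; and the relations that $a\otimes-$ and $-\otimes b$ are functorial and commute with each other, that $\gamma,\delta$ are natural in each variable and compatible with associativity and symmetry, and that $\gamma$ and $\delta$ are compatible with each other (so that $\eta_{\mathcal A,\mathcal B}:\mathcal A\to[\mathcal B,\mathcal A\otimes\mathcal B]$, $\eta(a)(b)=a\otimes b$, is a 1-cell). Each 1-cell $F:\mathcal A\to[\mathcal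 B,\mathcal C]$ induces the strict 1-cell $En(F):\mathcal A\otimes\mathcal B\to\mathcal C$ given on generators by $F$. Put $Rn=[\eta,1]\circ[\mathcal B,-]:[\mathcal A\otimes\mathcal B,\mathcal C]\to[\mathcal A,[\mathcal B,\mathcal C]]$, so $Rn(G)=[1,G]\circ\eta$. Define $F\otimes G=En([G,1]\circ\eta\circ F)$; $A'=En(En(Rn\circ\eta)):(\mathcal A\otimes\mathcal B)\otimes\mathcal C\to\mathcal A\otimes(\mathcal B\otimes\mathcal C)$; $R'=ev_\star\circ\eta_{\mathcal A,\mathbf I}:\mathcal A\to\mathcal A\otimes\mathbf I$; $L'=ev_\star\circ\eta_{\mathbf I,\mathcal A}^*:\mathcal A\to\mathbf I\otimes\mathcal A$; and $L_{\mathcal A}=En(v_{\mathcal A}):\mathbf I\otimes\mathcal A\to\mathcal A$. **2-rings.** (a) *Hom form.* A 2-ring on $\mathcal A$ consists of a 1-cell $\varphi:\mathcal A\to[\mathcal A,\mathcal A]$ (write $gf=\varphi(g)(f)$), a strict 1-cell $u:\mathbf I\to\mathcal A$ (write $1=u(\star)$), and 2-cells $$\alpha':[\varphi,1]\circ[\mathcal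 A,-]\circ\varphi\Rightarrow[1,\varphi]\circ\varphi,\qquad \rho':1_{\mathcal A}\Rightarrow ev_\star\circ[u,1]\circ\varphi,\qquad \lambda':1_{\mathcal A}\Rightarrow ev_\star\circ[u,1]\circ\varphi^*,$$ with components $\alpha_{h,g,f}:h(gf)\to(hg)f$, $\rho_f:f\to f1$, $\lambda_f:f\to1f$, such that for all objects $$\alpha_{kh,g,f}\circ\alpha_{k,h,gf}=(\alpha_{k,h,g}f)\circ\alpha_{k,hg,f}\circ(k\,\alpha_{h,g,f}),\qquad \alpha_{g,1,f}\circ(g\lambda_f)=\rho_gf .$$ It is *strict* if $\varphi$ is a strict 1-cell and $\alpha',\rho',\lambda'$ are identity 2-cells (in particular the 1-cells between which they go are equal). (b) *Tensor form.* A 2-ring on $\mathcal A$ consists of strict 1-cells $c:\mathcal A\otimes\mathcal A\to\mathcal A$ and $u:\mathbf I\to\mathcal A$ and 2-cells $$\alpha:c\circ(1\otimes c)\circ A'\Rightarrow c\circ(c\otimes1),\qquad \rho:1_{\mathcal A}\Rightarrow c\circ(1\otimes u)\circ R',\qquad \lambda:1_{\mathcal A}\Rightarrow c\circ(u\otimes1)\circ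 L'$$ satisfying the pentagon and triangle above, with $gf=c(g\otimes f)$ and with the components of $\alpha$ taken at the objects $(h\otimes g)\otimes f$. It is *strict* if $Rn(c)$ is a strict 1-cell and $\alpha,\rho,\lambda$ are identity 2-cells. **Proposition.** The unit $\mathbf I$ of $SPC$ carries a strict 2-ring structure in the hom form with multiplication $v_{\mathbf I}:\mathbf I\to[\mathbf I,\mathbf I]$ and unit $1_{\mathbf I}:\mathbf I\to\mathbf I$, and a strict 2-ring structure in the tensor form with multiplication $L_{\mathbf I}:\mathbf I\otimes\mathbf I\to\mathbf I$ and unit $1_{\mathbf I}$. The two multiplications correspond to each other: $Rn(L_{\mathbf I})=v_{\mathbf I}$. -/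

import Mathlib

open CategoryTheory MonoidalCategory
open CategoryTheory.Functor.LaxMonoidal (ε μ)
universe u
noncomputable section

/-- A symmetric Picard category: a symmetric monoidal groupoid with, for every object `a`, a chosen
object `dual a` and a chosen arrow `j a : I ⟶ dual a ⊗ a`. -/
structure SPC : Type (u + 1) where
  carrier : Type u
  [category : Category.{u} carrier]
  [monoidal : MonoidalCategory carrier]
  [symmetric : SymmetricCategory carrier]
  [groupoid : IsGroupoid carrier]
  dual : carrier → carrier
  j : ∀ a : carrier, 𝟙_ carrier ⟶ dual a ⊗ a

namespace SPC

instance : CoeSort SPC.{u} (Type u) := ⟨carrier⟩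
attribute [instance] category monoidal symmetric groupoid

theorem laxBraidedFunctor_ext {A B : SPC.{u}} {F G : LaxBraidedFunctor A B}
    (h : F.toFunctor = G.toFunctor) (hε : HEq (ε F.toFunctor) (ε G.toFunctor))
    (hμ : HEq (μ F.toFunctor) (μ G.toFunctor)) : F = G := by
  obtain ⟨F, iF⟩ := F
  obtain ⟨G, iG⟩ := G
  dsimp only at h
  subst h
  have h1 : iF.toLaxMonoidal = iG.toLaxMonoidal :=
    Functor.LaxMonoidal.ext (eq_of_heq hε) (eq_of_heq hμ)
  obtain @⟨iF, bF⟩ := iF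
  obtain @⟨iG, bG⟩ := iG
  dsimp only at h1
  subst h1
  rfl

/-- The 1-cells are the symmetric monoidal functors (the structure arrows `F(a) ⊗ F(b) ⟶ F(a ⊗ b)`
and `I ⟶ F(I)` are invertible since all arrows are). -/
instance : Category SPC.{u} where
  Hom A B := LaxBraidedFunctor A B
  id A := ⟨𝟭 A, inferInstance⟩
  comp F G := ⟨F.toFunctor ⋙ G.toFunctor, inferInstance⟩
  id_comp F := laxBraidedFunctor_ext rfl
    (heq_of_eq ((congrArg (fun t => ε F.toFunctor ≫ t) (F.map_id _)).trans (Category.comp_id _)))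
    (heq_of_eq (by
      funext x y
      exact (congrArg (fun t => μ F.toFunctor x y ≫ t) (F.map_id _)).trans (Category.comp_id _)))
  comp_id F := laxBraidedFunctor_ext rfl
    (heq_of_eq (Category.id_comp (ε F.toFunctor)))
    (heq_of_eq (by funext x y; exact Category.id_comp (μ F.toFunctor x y)))
  assoc F G H := laxBraidedFunctor_ext rfl
    (heq_of_eq (by
      change _ ≫ H.map (_ ≫ G.map _) = (_ ≫ H.map _) ≫ H.map (G.map _)
      rw [H.map_comp, Category.assoc]))
    (heq_of_eq (by
      funext x y
      change _ ≫ H.map (_ ≫ G.map _) = (_ ≫ H.map _) ≫ H.map (G.map _)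
      rw [H.map_comp, Category.assoc]
      rfl))

/-- The 2-cells are the monoidal natural transformations. -/
instance (A B : SPC.{u}) : Category (A ⟶ B) := inferInstanceAs (Category (LaxBraidedFunctor A B))

section Cancel
variable {C : SPC.{u}}

/-- Tensoring with an object is an equivalence. -/
def rightEquiv (a : C) : C ≌ C :=
  CategoryTheory.Equivalence.mk (tensorRight a) (tensorRight (C.dual a))
    (NatIso.ofComponents (fun x =>
      (ρ_ x).symm ≪≫ whiskerLeftIso x (asIso (C.j a) ≪≫ β_ _ _) ≪≫ (α_ _ _ _).symm)
      (fun {x y} f => by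
        change f ≫ (ρ_ y).inv ≫ y ◁ (C.j a ≫ (β_ _ _).hom) ≫ (α_ _ _ _).inv =
          ((ρ_ x).inv ≫ x ◁ (C.j a ≫ (β_ _ _).hom) ≫ (α_ _ _ _).inv) ≫ f ▷ a ▷ C.dual a
        rw [rightUnitor_inv_naturality_assoc, ← whisker_exchange_assoc]
        simp only [Category.assoc, associator_inv_naturality_left]))
    (NatIso.ofComponents (fun x =>
      α_ _ _ _ ≪≫ whiskerLeftIso x (asIso (C.j a)).symm ≪≫ ρ_ x)
      (fun {x y} f => by
        change f ▷ C.dual a ▷ a ≫ (α_ _ _ _).hom ≫ y ◁ inv (C.j a) ≫ (ρ_ y).hom =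
          ((α_ _ _ _).hom ≫ x ◁ inv (C.j a) ≫ (ρ_ x).hom) ≫ f
        simp only [Category.assoc]
        rw [← rightUnitor_naturality, whisker_exchange_assoc, associator_naturality_left_assoc]))

theorem whiskerRight_cancel {x y : C} {f g : x ⟶ y} (a : C) (h : f ▷ a = g ▷ a) : f = g :=
  (rightEquiv a).functor.map_injective h

/-- The unique arrow `f` with `f ⊗ a = g`. -/
def unwhisker {x y : C} (a : C) (g : x ⊗ a ⟶ y ⊗ a) : x ⟶ y :=
  (rightEquiv a).functor.preimage g

@[simp] theorem unwhisker_whiskerRight {x y : C} (a : C) (g : x ⊗ a ⟶ y ⊗ a) :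
    unwhisker a g ▷ a = g :=
  (rightEquiv a).functor.map_preimage g
end Cancel

section Mk
variable {A B : SPC.{u}}

/-- The unit constraint of a functor is determined by its tensor constraint. -/
theorem exists_counit (F : A ⥤ B) (m : ∀ x y : A, F.obj x ⊗ F.obj y ⟶ F.obj (x ⊗ y))
    (nat_left : ∀ {x y : A} (f : x ⟶ y) (z : A), F.map f ▷ F.obj z ≫ m y z = m x z ≫ F.map (f ▷ z))
    (nat_right : ∀ {x y : A} (z : A) (f : x ⟶ y), F.obj z ◁ F.map f ≫ m z y = m z x ≫ F.map (z ◁ f))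
    (assoc : ∀ x y z : A, m x y ▷ F.obj z ≫ m (x ⊗ y) z ≫ F.map (α_ x y z).hom =
        (α_ (F.obj x) (F.obj y) (F.obj z)).hom ≫ F.obj x ◁ m y z ≫ m x (y ⊗ z))
    (e : 𝟙_ B ⟶ F.obj (𝟙_ A))
    (he : e ▷ F.obj (𝟙_ A) = (λ_ (F.obj (𝟙_ A))).hom ≫ inv (m (𝟙_ A) (𝟙_ A) ≫ F.map (λ_ (𝟙_ A)).hom))
    (x : A) : (λ_ (F.obj x)).hom = e ▷ F.obj x ≫ m (𝟙_ A) x ≫ F.map (λ_ x).hom := by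
  have key : ∀ x y : A, (m (𝟙_ A) x ≫ F.map (λ_ x).hom) ▷ F.obj y ≫ m x y =
      (α_ _ _ _).hom ≫ F.obj (𝟙_ A) ◁ m x y ≫ m (𝟙_ A) (x ⊗ y) ≫ F.map (λ_ (x ⊗ y)).hom := by
    intro x y
    have := assoc (𝟙_ A) x y
    rw [← reassoc_of% this, comp_whiskerRight, Category.assoc, nat_left, ← F.map_comp]
    simp
  have h1 : (λ_ (F.obj (𝟙_ A))).hom =
      e ▷ F.obj (𝟙_ A) ≫ m (𝟙_ A) (𝟙_ A) ≫ F.map (λ_ (𝟙_ A)).hom := by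
    rw [he]; simp
  have h2 : ∀ y, (λ_ (F.obj (𝟙_ A ⊗ y))).hom =
      e ▷ F.obj (𝟙_ A ⊗ y) ≫ m (𝟙_ A) (𝟙_ A ⊗ y) ≫ F.map (λ_ (𝟙_ A ⊗ y)).hom := by
    intro y
    have h3 := congrArg (fun t => t ▷ F.obj y ≫ m (𝟙_ A) y) h1
    rw [comp_whiskerRight, Category.assoc, key] at h3
    have h4 : e ▷ F.obj (𝟙_ A) ▷ F.obj y ≫ (α_ _ _ _).hom ≫ F.obj (𝟙_ A) ◁ m (𝟙_ A) y =
      (α_ _ _ _).hom ≫ 𝟙_ B ◁ m (𝟙_ A) y ≫ e ▷ _ := by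
      rw [whisker_exchange]; simp
    rw [reassoc_of% h4] at h3
    rw [← cancel_epi (𝟙_ B ◁ m (𝟙_ A) y), ← cancel_epi (α_ _ _ _).hom, ← h3]
    simp
  have h3 := h2 x
  rw [← cancel_epi (𝟙_ B ◁ F.map (λ_ x).hom), whisker_exchange_assoc, reassoc_of% (nat_right (𝟙_ A) (λ_ x).hom), ← F.map_comp]
  rw [leftUnitor_naturality, h3]
  simp only [Category.assoc, ← F.map_comp, leftUnitor_naturality]

/-- A 1-cell from its functor and its tensor constraint, which determine the unit constraint. -/
def mkHom (F : A ⥤ B) (m : ∀ x y : A, F.obj x ⊗ F.obj y ⟶ F.obj (x ⊗ y))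
    (nat_left : ∀ {x y : A} (f : x ⟶ y) (z : A), F.map f ▷ F.obj z ≫ m y z = m x z ≫ F.map (f ▷ z))
    (nat_right : ∀ {x y : A} (z : A) (f : x ⟶ y), F.obj z ◁ F.map f ≫ m z y = m z x ≫ F.map (z ◁ f))
    (assoc : ∀ x y z : A, m x y ▷ F.obj z ≫ m (x ⊗ y) z ≫ F.map (α_ x y z).hom =
        (α_ (F.obj x) (F.obj y) (F.obj z)).hom ≫ F.obj x ◁ m y z ≫ m x (y ⊗ z))
    (braid : ∀ x y : A, m x y ≫ F.map (β_ x y).hom = (β_ (F.obj x) (F.obj y)).hom ≫ m y x) :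
    A ⟶ B :=
  let e : 𝟙_ B ⟶ F.obj (𝟙_ A) := unwhisker (F.obj (𝟙_ A))
    ((λ_ (F.obj (𝟙_ A))).hom ≫ inv (m (𝟙_ A) (𝟙_ A) ≫ F.map (λ_ (𝟙_ A)).hom))
  have hl := exists_counit F m nat_left nat_right assoc e (unwhisker_whiskerRight _ _)
  { toFunctor := F
    laxBraided :=
    { ε := e
      μ := m
      μ_natural_left := nat_left
      μ_natural_right := nat_right
      associativity := assoc
      left_unitality := hl
      right_unitality := fun x => by
        have h := hl x
        rw [← cancel_epi (β_ _ _).hom, braiding_rightUnitor, h]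
        rw [← BraidedCategory.braiding_naturality_left_assoc, ← reassoc_of% braid,
          ← F.map_comp, braiding_rightUnitor]
      braided := braid } }

theorem unit_of_tensor {F G : A ⟶ B} (t : F.toFunctor ⟶ G.toFunctor)
    (tensor : ∀ x y : A, μ F.toFunctor x y ≫ t.app (x ⊗ y) =
      (t.app x ⊗ₘ t.app y) ≫ μ G.toFunctor x y) :
    ε F.toFunctor ≫ t.app (𝟙_ A) = ε G.toFunctor := by
  apply whiskerRight_cancel (G.obj (𝟙_ A))
  have h1 := Functor.LaxMonoidal.left_unitality F.toFunctor (𝟙_ A)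
  have h2 := Functor.LaxMonoidal.left_unitality G.toFunctor (𝟙_ A)
  rw [← cancel_mono (μ G.toFunctor _ _ ≫ G.map (λ_ (𝟙_ A)).hom), ← h2,
    ← cancel_epi (𝟙_ B ◁ t.app (𝟙_ A)), leftUnitor_naturality, h1]
  simp only [Category.assoc, t.naturality, reassoc_of% tensor]
  rw [MonoidalCategory.tensorHom_def', comp_whiskerRight]
  simp only [Category.assoc]
  rw [whisker_exchange_assoc]

/-- A 2-cell; compatibility with the units follows from compatibility with tensor products. -/
def mk₂ {F G : A ⟶ B} (t : F.toFunctor ⟶ G.toFunctor)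
    (tensor : ∀ x y : A, μ F.toFunctor x y ≫ t.app (x ⊗ y) =
      (t.app x ⊗ₘ t.app y) ≫ μ G.toFunctor x y) : F ⟶ G :=
  ⟨⟨t, ⟨unit_of_tensor t tensor, tensor⟩⟩⟩

end Mk

section Dual
variable {A : SPC.{u}}

theorem tensor_cancel {x y a b : A} {g h : x ⟶ y} (k : 𝟙_ A ⟶ x ⊗ a) (f : a ⟶ b)
    (e : k ≫ (g ⊗ₘ f) = k ≫ (h ⊗ₘ f)) : g = h := by
  rw [cancel_epi, MonoidalCategory.tensorHom_def, MonoidalCategory.tensorHom_def, cancel_mono] at e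
  exact whiskerRight_cancel a e

/-- The image of `f : a ⟶ b` under `inv`: the unique arrow making `j` natural. -/
def dualMap {a b : A} (f : a ⟶ b) : A.dual a ⟶ A.dual b :=
  unwhisker a (inv (A.j a) ≫ A.j b ≫ A.dual b ◁ inv f)

theorem j_dualMap {a b : A} (f : a ⟶ b) : A.j a ≫ (dualMap f ⊗ₘ f) = A.j b := by
  rw [MonoidalCategory.tensorHom_def, dualMap, unwhisker_whiskerRight]
  simp [← MonoidalCategory.whiskerLeft_comp]

theorem j_dualMap_assoc {a b c : A} (f : a ⟶ b) (h : A.dual b ⊗ b ⟶ c) :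
    A.j a ≫ (dualMap f ⊗ₘ f) ≫ h = A.j b ≫ h := by
  rw [← Category.assoc, j_dualMap]

theorem dualMap_unique {a b : A} (f : a ⟶ b) (g : A.dual a ⟶ A.dual b)
    (h : A.j a ≫ (g ⊗ₘ f) = A.j b) : g = dualMap f :=
  tensor_cancel (A.j a) f (h.trans (j_dualMap f).symm)

@[simp] theorem dualMap_id (a : A) : dualMap (𝟙 a) = 𝟙 (A.dual a) :=
  (dualMap_unique _ _ (by simp)).symm

@[simp] theorem dualMap_comp {a b c : A} (f : a ⟶ b) (g : b ⟶ c) :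
    dualMap (f ≫ g) = dualMap f ≫ dualMap g :=
  (dualMap_unique _ _ (by
    rw [← tensorHom_comp_tensorHom, j_dualMap_assoc, j_dualMap])).symm

/-- `I ⟶ (a• ⊗ b•) ⊗ (a ⊗ b)` -/
def jj (a b : A) : 𝟙_ A ⟶ (A.dual a ⊗ A.dual b) ⊗ (a ⊗ b) :=
  (λ_ (𝟙_ A)).inv ≫ (A.j a ⊗ₘ A.j b) ≫ tensorμ _ _ _ _

instance (a b c d : A) : IsIso (tensorμ a b c d) := ⟨tensorδ a b c d, by simp, by simp⟩

/-- The structure arrow `a• ⊗ b• ⟶ (a ⊗ b)•` of `inv`. -/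
def dualμ (a b : A) : A.dual a ⊗ A.dual b ⟶ A.dual (a ⊗ b) :=
  unwhisker (a ⊗ b) (inv (jj a b) ≫ A.j (a ⊗ b))

theorem jj_dualμ (a b : A) : jj a b ≫ dualμ a b ▷ (a ⊗ b) = A.j (a ⊗ b) := by
  rw [dualμ, unwhisker_whiskerRight, IsIso.hom_inv_id_assoc]

theorem jj_dualμ_assoc (a b : A) {c : A} (h : A.dual (a ⊗ b) ⊗ (a ⊗ b) ⟶ c) :
    jj a b ≫ dualμ a b ▷ (a ⊗ b) ≫ h = A.j (a ⊗ b) ≫ h := by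
  rw [← Category.assoc, jj_dualμ]

theorem jj_naturality {a b a' b' : A} (f : a ⟶ a') (g : b ⟶ b') :
    jj a b ≫ ((dualMap f ⊗ₘ dualMap g) ⊗ₘ (f ⊗ₘ g)) = jj a' b' := by
  simp only [jj, Category.assoc, ← tensorμ_natural]
  rw [tensorHom_comp_tensorHom_assoc, j_dualMap, j_dualMap]

theorem jj_naturality_assoc {a b a' b' c : A} (f : a ⟶ a') (g : b ⟶ b')
    (h : (A.dual a' ⊗ A.dual b') ⊗ (a' ⊗ b') ⟶ c) :
    jj a b ≫ ((dualMap f ⊗ₘ dualMap g) ⊗ₘ (f ⊗ₘ g)) ≫ h = jj a' b' ≫ h := by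
  rw [← Category.assoc, jj_naturality]

theorem dualμ_natural {a b a' b' : A} (f : a ⟶ a') (g : b ⟶ b') :
    (dualMap f ⊗ₘ dualMap g) ≫ dualμ a' b' = dualμ a b ≫ dualMap (f ⊗ₘ g) := by
  apply tensor_cancel (jj a b) (f ⊗ₘ g)
  have h1 : (((dualMap f ⊗ₘ dualMap g) ≫ dualμ a' b') ⊗ₘ (f ⊗ₘ g)) =
      ((dualMap f ⊗ₘ dualMap g) ⊗ₘ (f ⊗ₘ g)) ≫ dualμ a' b' ▷ (a' ⊗ b') := by
    rw [← tensorHom_id, tensorHom_comp_tensorHom, Category.comp_id]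
  have h2 : ((dualμ a b ≫ dualMap (f ⊗ₘ g)) ⊗ₘ (f ⊗ₘ g)) =
      dualμ a b ▷ (a ⊗ b) ≫ (dualMap (f ⊗ₘ g) ⊗ₘ (f ⊗ₘ g)) := by
    rw [← tensorHom_id, tensorHom_comp_tensorHom, Category.id_comp]
  rw [h1, h2, jj_naturality_assoc, jj_dualμ, jj_dualμ_assoc, j_dualMap]

theorem dualμ_assoc (a b c : A) :
    dualμ a b ▷ A.dual c ≫ dualμ (a ⊗ b) c ≫ dualMap (α_ a b c).hom =
      (α_ (A.dual a) (A.dual b) (A.dual c)).hom ≫ A.dual a ◁ dualμ b c ≫ dualμ a (b ⊗ c) := by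
  apply tensor_cancel ((λ_ (𝟙_ A)).inv ≫ (jj a b ⊗ₘ A.j c) ≫ tensorμ _ _ _ _) (α_ a b c).hom
  have h1 : ((dualμ a b ▷ A.dual c ≫ dualμ (a ⊗ b) c ≫ dualMap (α_ a b c).hom) ⊗ₘ
        (α_ a b c).hom) =
      ((dualμ a b ⊗ₘ 𝟙 (A.dual c)) ⊗ₘ (𝟙 (a ⊗ b) ⊗ₘ 𝟙 c)) ≫
        dualμ (a ⊗ b) c ▷ ((a ⊗ b) ⊗ c) ≫ (dualMap (α_ a b c).hom ⊗ₘ (α_ a b c).hom) := by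
    simp only [← tensorHom_id, tensorHom_comp_tensorHom, Category.id_comp, id_tensorHom_id]
  have h2 : (((α_ (A.dual a) (A.dual b) (A.dual c)).hom ≫ A.dual a ◁ dualμ b c ≫
        dualμ a (b ⊗ c)) ⊗ₘ (α_ a b c).hom) =
      ((α_ (A.dual a) (A.dual b) (A.dual c)).hom ⊗ₘ (α_ a b c).hom) ≫
        ((𝟙 (A.dual a) ⊗ₘ dualμ b c) ⊗ₘ (𝟙 a ⊗ₘ 𝟙 (b ⊗ c))) ≫
          dualμ a (b ⊗ c) ▷ (a ⊗ (b ⊗ c)) := by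
    simp only [← tensorHom_id, ← id_tensorHom, tensorHom_comp_tensorHom, Category.comp_id,
      id_tensorHom_id]
  have h3 : ((λ_ (𝟙_ A)).inv ≫ (jj a b ⊗ₘ A.j c) ≫ tensorμ _ _ _ _) ≫
      ((dualμ a b ⊗ₘ 𝟙 (A.dual c)) ⊗ₘ (𝟙 (a ⊗ b) ⊗ₘ 𝟙 c)) = jj (a ⊗ b) c := by
    simp only [Category.assoc, ← tensorμ_natural]
    rw [tensorHom_comp_tensorHom_assoc, tensorHom_id, jj_dualμ, jj]
    simp
  have h4 : ((λ_ (𝟙_ A)).inv ≫ (jj a b ⊗ₘ A.j c) ≫ tensorμ _ _ _ _) ≫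
      ((α_ (A.dual a) (A.dual b) (A.dual c)).hom ⊗ₘ (α_ a b c).hom) =
      (λ_ (𝟙_ A)).inv ≫ (A.j a ⊗ₘ jj b c) ≫ tensorμ _ _ _ _ := by
    have e1 : (jj a b ⊗ₘ A.j c) = (λ_ (𝟙_ A)).inv ▷ 𝟙_ A ≫ ((A.j a ⊗ₘ A.j b) ⊗ₘ A.j c) ≫
        tensorμ _ _ _ _ ▷ _ := by
      simp only [← tensorHom_id, tensorHom_comp_tensorHom, Category.id_comp, Category.comp_id, jj]
    have e2 : (A.j a ⊗ₘ jj b c) = 𝟙_ A ◁ (λ_ (𝟙_ A)).inv ≫ (A.j a ⊗ₘ (A.j b ⊗ₘ A.j c)) ≫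
        _ ◁ tensorμ _ _ _ _ := by
      simp only [← id_tensorHom, tensorHom_comp_tensorHom, Category.id_comp, Category.comp_id, jj]
    rw [e1, e2]
    simp only [Category.assoc]
    rw [tensor_associativity, MonoidalCategory.associator_naturality_assoc]
    simp only [← Category.assoc]
    congr 3
    monoidal
  have h5 : ((λ_ (𝟙_ A)).inv ≫ (A.j a ⊗ₘ jj b c) ≫ tensorμ _ _ _ _) ≫
      ((𝟙 (A.dual a) ⊗ₘ dualμ b c) ⊗ₘ (𝟙 a ⊗ₘ 𝟙 (b ⊗ c))) = jj a (b ⊗ c) := by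
    simp only [Category.assoc, ← tensorμ_natural]
    rw [tensorHom_comp_tensorHom_assoc, id_tensorHom_id, Category.comp_id, tensorHom_id,
      jj_dualμ, jj]
  rw [h1, h2, ← Category.assoc, h3, jj_dualμ_assoc, j_dualMap, ← Category.assoc, h4,
    ← Category.assoc, h5, jj_dualμ]

end Dual

section Braid
variable {A : SPC.{u}}

theorem tensorμ_tensorμ (a b c d : A) : tensorμ a b c d ≫ tensorμ a c b d = 𝟙 _ := by
  have : tensorμ a c b d = tensorδ a b c d := by
    simp [tensorμ, tensorδ, SymmetricCategory.braiding_swap_eq_inv_braiding]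
  rw [this, tensorμ_tensorδ]

theorem tensorμ_braiding (a b c d : A) :
    tensorμ a b c d ≫ (β_ (a ⊗ c) (b ⊗ d)).hom =
      ((β_ a b).hom ⊗ₘ (β_ c d).hom) ≫ tensorμ b a d c := by
  simp only [tensorμ, Category.assoc,
    BraidedCategory.braiding_tensor_right_hom, BraidedCategory.braiding_tensor_left_hom,
    comp_whiskerRight, whisker_assoc, MonoidalCategory.whiskerLeft_comp, pentagon_assoc,
    pentagon_inv_hom_hom_hom_inv_assoc, Iso.inv_hom_id_assoc, whiskerLeft_hom_inv_assoc]
  slice_lhs 3 4 =>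
    rw [← MonoidalCategory.whiskerLeft_comp, ← comp_whiskerRight, SymmetricCategory.symmetry]
  simp only [id_whiskerRight, MonoidalCategory.whiskerLeft_id, Category.id_comp, Category.assoc,
    pentagon_inv_assoc, Iso.hom_inv_id_assoc]
  slice_lhs 1 2 =>
    rw [← associator_inv_naturality_left]
  slice_lhs 2 3 =>
    rw [Iso.inv_hom_id]
  rw [Category.id_comp]
  slice_lhs 2 3 =>
    rw [← associator_naturality_right]
  slice_lhs 1 2 =>
    rw [← MonoidalCategory.tensorHom_def]
  simp only [Category.assoc]

theorem tensorμ_braiding' (a b c d : A) :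
    tensorμ a b c d ≫ ((β_ a c).hom ⊗ₘ (β_ b d).hom) =
      (β_ (a ⊗ b) (c ⊗ d)).hom ≫ tensorμ c d a b := by
  have h := tensorμ_braiding a c b d
  rw [← cancel_epi (tensorμ a c b d), reassoc_of% (tensorμ_tensorμ a c b d), reassoc_of% h,
    tensorμ_tensorμ, Category.comp_id]

theorem dualμ_braiding (a b : A) :
    dualμ a b ≫ dualMap (β_ a b).hom = (β_ (A.dual a) (A.dual b)).hom ≫ dualμ b a := by
  apply tensor_cancel (jj a b) (β_ a b).hom
  have h1 : ((dualμ a b ≫ dualMap (β_ a b).hom) ⊗ₘ (β_ a b).hom) =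
      dualμ a b ▷ (a ⊗ b) ≫ (dualMap (β_ a b).hom ⊗ₘ (β_ a b).hom) := by
    rw [← tensorHom_id, tensorHom_comp_tensorHom, Category.id_comp]
  have h2 : (((β_ (A.dual a) (A.dual b)).hom ≫ dualμ b a) ⊗ₘ (β_ a b).hom) =
      ((β_ (A.dual a) (A.dual b)).hom ⊗ₘ (β_ a b).hom) ≫ dualμ b a ▷ (b ⊗ a) := by
    rw [← tensorHom_id, tensorHom_comp_tensorHom, Category.comp_id]
  have h3 : jj a b ≫ ((β_ (A.dual a) (A.dual b)).hom ⊗ₘ (β_ a b).hom) = jj b a := by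
    simp only [jj, Category.assoc, tensorμ_braiding']
    rw [BraidedCategory.braiding_naturality_assoc]
    simp only [← Category.assoc]
    congr 2
    rw [braiding_tensorUnit_left]
    monoidal
  rw [h1, h2, jj_dualμ_assoc, j_dualMap, reassoc_of% h3, jj_dualμ]

/-- The symmetric monoidal functor `inv : A ⟶ A`, `a ↦ dual a`, whose action on arrows and whose
tensor constraint are the unique ones for which `j` is a monoidal natural transformation. -/
def dualHom (A : SPC.{u}) : A ⟶ A :=
  mkHom
    { obj := A.dual
      map := dualMap } dualμ
    (fun f z => by
      have := dualμ_natural f (𝟙 z)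
      simpa using this)
    (fun z f => by
      have := dualμ_natural (𝟙 z) f
      simpa using this)
    dualμ_assoc dualμ_braiding

end Braid

section Plain
variable {A : SPC.{u}}

theorem interchange_natural {a b c a' b' c' p q r p' q' r' : A}
    {m : a ⊗ b ⟶ c} {m' : a' ⊗ b' ⟶ c'} {n : p ⊗ q ⟶ r} {n' : p' ⊗ q' ⟶ r'}
    {s₁ : a ⟶ p} {s₂ : b ⟶ q} {s₃ : c ⟶ r} {t₁ : a' ⟶ p'} {t₂ : b' ⟶ q'} {t₃ : c' ⟶ r'}
    (h : m ≫ s₃ = (s₁ ⊗ₘ s₂) ≫ n) (h' : m' ≫ t₃ = (t₁ ⊗ₘ t₂) ≫ n') :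
    (tensorμ a a' b b' ≫ (m ⊗ₘ m')) ≫ (s₃ ⊗ₘ t₃) =
      ((s₁ ⊗ₘ t₁) ⊗ₘ (s₂ ⊗ₘ t₂)) ≫ tensorμ p p' q q' ≫ (n ⊗ₘ n') := by
  rw [tensorμ_natural_assoc, Category.assoc, tensorHom_comp_tensorHom, tensorHom_comp_tensorHom,
    h, h']

theorem interchange_assoc {a b c a' b' c' a'' b'' c'' : A}
    (m : a ⊗ a' ⟶ a'') (n : b ⊗ b' ⟶ b'') (k : c ⊗ c' ⟶ c'') :
    (tensorμ (a ⊗ b) c (a' ⊗ b') c' ≫ ((tensorμ a b a' b' ≫ (m ⊗ₘ n)) ⊗ₘ k)) ≫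
        (α_ a'' b'' c'').hom =
      ((α_ a b c).hom ⊗ₘ (α_ a' b' c').hom) ≫ tensorμ a (b ⊗ c) a' (b' ⊗ c') ≫
        (m ⊗ₘ (tensorμ b c b' c' ≫ (n ⊗ₘ k))) := by
  have h1 : ((tensorμ a b a' b' ≫ (m ⊗ₘ n)) ⊗ₘ k) =
      tensorμ a b a' b' ▷ (c ⊗ c') ≫ ((m ⊗ₘ n) ⊗ₘ k) := by
    rw [← tensorHom_id, tensorHom_comp_tensorHom, Category.id_comp]
  have h2 : (m ⊗ₘ (tensorμ b c b' c' ≫ (n ⊗ₘ k))) =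
      (a ⊗ a') ◁ tensorμ b c b' c' ≫ (m ⊗ₘ (n ⊗ₘ k)) := by
    rw [← id_tensorHom, tensorHom_comp_tensorHom, Category.id_comp]
  rw [h1, h2, Category.assoc, Category.assoc, MonoidalCategory.associator_naturality,
    reassoc_of% (associator_monoidal a b c a' b' c')]

theorem interchange_leftUnitor {b b' b'' : A} (n : b ⊗ b' ⟶ b'') :
    (tensorμ (𝟙_ A) b (𝟙_ A) b' ≫ ((λ_ (𝟙_ A)).hom ⊗ₘ n)) ≫ (λ_ b'').hom =
      ((λ_ b).hom ⊗ₘ (λ_ b').hom) ≫ n := by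
  rw [leftUnitor_monoidal, MonoidalCategory.tensorHom_def]
  simp

theorem interchange_rightUnitor {b b' b'' : A} (n : b ⊗ b' ⟶ b'') :
    (tensorμ b (𝟙_ A) b' (𝟙_ A) ≫ (n ⊗ₘ (λ_ (𝟙_ A)).hom)) ≫ (ρ_ b'').hom =
      ((ρ_ b).hom ⊗ₘ (ρ_ b').hom) ≫ n := by
  rw [rightUnitor_monoidal, MonoidalCategory.tensorHom_def']
  simp

theorem interchange_braiding {a b a' b' a'' b'' : A}
    (m : a ⊗ a' ⟶ a'') (n : b ⊗ b' ⟶ b'') :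
    (tensorμ a b a' b' ≫ (m ⊗ₘ n)) ≫ (β_ a'' b'').hom =
      ((β_ a b).hom ⊗ₘ (β_ a' b').hom) ≫ tensorμ b a b' a' ≫ (n ⊗ₘ m) := by
  rw [Category.assoc, BraidedCategory.braiding_naturality, reassoc_of% (tensorμ_braiding a b a' b')]

end Plain

section Hom
variable {A B C : SPC.{u}}

/-- The component of a 2-cell. -/
abbrev app {F G : A ⟶ B} (t : F ⟶ G) (x : A) : F.obj x ⟶ G.obj x := t.hom.hom.app x

theorem cell_ext {F G : A ⟶ B} {s t : F ⟶ G} (h : ∀ x, app s x = app t x) : s = t :=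
  LaxBraidedFunctor.hom_ext (NatTrans.ext (funext h))

@[simp] theorem app_id (F : A ⟶ B) (x : A) : app (𝟙 F) x = 𝟙 (F.obj x) := rfl
@[simp] theorem app_comp {F G H : A ⟶ B} (s : F ⟶ G) (t : G ⟶ H) (x : A) :
    app (s ≫ t) x = app s x ≫ app t x := rfl
@[simp] theorem app_mk₂ {F G : A ⟶ B} (t : F.toFunctor ⟶ G.toFunctor) (h) (x : A) :
    app (mk₂ t h) x = t.app x := rfl

theorem app_tensor {F G : A ⟶ B} (t : F ⟶ G) (x y : A) :
    μ F.toFunctor x y ≫ app t (x ⊗ y) = (app t x ⊗ₘ app t y) ≫ μ G.toFunctor x y :=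
  t.hom.isMonoidal.tensor x y

theorem app_naturality {F G : A ⟶ B} (t : F ⟶ G) {x y : A} (f : x ⟶ y) :
    F.map f ≫ app t y = app t x ≫ G.map f :=
  t.hom.hom.naturality f

/-- A 2-cell from its components. -/
def cell {F G : A ⟶ B} (t : ∀ x, F.obj x ⟶ G.obj x)
    (nat : ∀ {x y : A} (f : x ⟶ y), F.map f ≫ t y = t x ≫ G.map f)
    (tensor : ∀ x y : A, μ F.toFunctor x y ≫ t (x ⊗ y) = (t x ⊗ₘ t y) ≫ μ G.toFunctor x y) :
    F ⟶ G :=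
  mk₂ { app := t, naturality := fun _ _ f => nat f } tensor

@[simp] theorem app_cell {F G : A ⟶ B} (t : ∀ x, F.obj x ⟶ G.obj x) (h1) (h2) (x : A) :
    app (cell (F := F) (G := G) t h1 h2) x = t x := rfl

/-- The pointwise tensor product of two 1-cells. -/
def add (F G : A ⟶ B) : A ⟶ B :=
  ⟨{ obj := fun x => F.obj x ⊗ G.obj x
     map := fun f => F.map f ⊗ₘ G.map f },
   { ε := (λ_ (𝟙_ B)).inv ≫ (ε F.toFunctor ⊗ₘ ε G.toFunctor)
     μ := fun x y => tensorμ _ _ _ _ ≫ (μ F.toFunctor x y ⊗ₘ μ G.toFunctor x y)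
     μ_natural_left := fun f z => by
       dsimp only
       rw [reassoc_of% (tensorμ_natural_left (F.map f) (G.map f) (F.obj z) (G.obj z)),
         Category.assoc, tensorHom_comp_tensorHom, tensorHom_comp_tensorHom,
         Functor.LaxMonoidal.μ_natural_left, Functor.LaxMonoidal.μ_natural_left]
     μ_natural_right := fun z f => by
       dsimp only
       rw [reassoc_of% (tensorμ_natural_right (F.obj z) (G.obj z) (F.map f) (G.map f)),
         Category.assoc, tensorHom_comp_tensorHom, tensorHom_comp_tensorHom,
         Functor.LaxMonoidal.μ_natural_right, Functor.LaxMonoidal.μ_natural_right]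
     associativity := fun x y z => by
       dsimp only
       simp only [comp_whiskerRight, MonoidalCategory.whiskerLeft_comp, Category.assoc]
       rw [reassoc_of% (tensorμ_natural_left (μ F.toFunctor x y) (μ G.toFunctor x y)),
         reassoc_of% (tensorμ_natural_right _ _ (μ F.toFunctor y z) (μ G.toFunctor y z)),
         ← reassoc_of% (tensor_associativity (F.obj x) (G.obj x) (F.obj y) (G.obj y)
          (F.obj z) (G.obj z))]
       simp only [tensorHom_comp_tensorHom, Functor.LaxMonoidal.associativity]
     left_unitality := fun x => by
       dsimp only
       simp only [comp_whiskerRight, Category.assoc]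
       rw [reassoc_of% (tensorμ_natural_left (ε F.toFunctor) (ε G.toFunctor))]
       simp only [tensorHom_comp_tensorHom]
       rw [← Functor.LaxMonoidal.left_unitality, ← Functor.LaxMonoidal.left_unitality,
         tensor_left_unitality]
     right_unitality := fun x => by
       dsimp only
       simp only [MonoidalCategory.whiskerLeft_comp, Category.assoc]
       rw [reassoc_of% (tensorμ_natural_right _ _ (ε F.toFunctor) (ε G.toFunctor))]
       simp only [tensorHom_comp_tensorHom]
       rw [← Functor.LaxMonoidal.right_unitality, ← Functor.LaxMonoidal.right_unitality,
         tensor_right_unitality]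
     braided := fun x y => by
      dsimp only
      rw [Category.assoc, tensorHom_comp_tensorHom, Functor.LaxBraided.braided,
        Functor.LaxBraided.braided, ← tensorHom_comp_tensorHom, ← Category.assoc,
        tensorμ_braiding', Category.assoc] }⟩

theorem add_μ (F G : A ⟶ B) (x y : A) :
    μ (add F G).toFunctor x y =
      tensorμ _ _ _ _ ≫ (μ F.toFunctor x y ⊗ₘ μ G.toFunctor x y) := rfl

/-- The constant 1-cell at the unit object. -/
def zero (A B : SPC.{u}) : A ⟶ B :=
  ⟨(Functor.const A).obj (𝟙_ B),
   { ε := 𝟙 _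
     μ := fun _ _ => (λ_ (𝟙_ B)).hom
     associativity := fun _ _ _ => by
       dsimp
       rw [Category.comp_id]
       monoidal
     left_unitality := fun _ => by dsimp; simp
     right_unitality := fun _ => by dsimp; simp [unitors_equal]
     braided := fun _ _ => by
       dsimp
       rw [Category.comp_id, braiding_leftUnitor, unitors_equal] }⟩

theorem zero_μ (x y : A) :
    μ (zero A B).toFunctor x y = (λ_ (𝟙_ B)).hom := rfl

/-- An invertible 2-cell from its components. -/
def cellIso {F G : A ⟶ B} (e : ∀ x, F.obj x ≅ G.obj x)
    (nat : ∀ {x y : A} (f : x ⟶ y), F.map f ≫ (e y).hom = (e x).hom ≫ G.map f)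
    (tensor : ∀ x y : A, μ F.toFunctor x y ≫ (e (x ⊗ y)).hom =
      ((e x).hom ⊗ₘ (e y).hom) ≫ μ G.toFunctor x y) : F ≅ G where
  hom := cell (fun x => (e x).hom) nat tensor
  inv := cell (fun x => (e x).inv)
    (fun {x y} f => by rw [Iso.eq_inv_comp, ← reassoc_of% (nat f), Iso.hom_inv_id, Category.comp_id])
    (fun x y => by
      rw [← cancel_epi ((e x).hom ⊗ₘ (e y).hom), ← reassoc_of% (tensor x y), Iso.hom_inv_id,
        Category.comp_id, tensorHom_comp_tensorHom_assoc]
      simp)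
  hom_inv_id := cell_ext fun x => (e x).hom_inv_id
  inv_hom_id := cell_ext fun x => (e x).inv_hom_id

instance (A B : SPC.{u}) : IsGroupoid (A ⟶ B) where
  all_isIso t :=
    have h : t = (cellIso (fun x => asIso (app t x)) (app_naturality t) (app_tensor t)).hom := rfl
    h ▸ inferInstance

/-- The pointwise tensor product of two 2-cells. -/
def tensorCell {F G F' G' : A ⟶ B} (s : F ⟶ G) (t : F' ⟶ G') : add F F' ⟶ add G G' :=
  cell (fun x => app s x ⊗ₘ app t x)
    (fun f => by
      change (F.map f ⊗ₘ F'.map f) ≫ _ = _ ≫ (G.map f ⊗ₘ G'.map f)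
      rw [tensorHom_comp_tensorHom, tensorHom_comp_tensorHom, app_naturality, app_naturality])
    (fun x y => interchange_natural (app_tensor s x y) (app_tensor t x y))

/-- The pointwise monoidal structure on the category of 1-cells. -/
instance (A B : SPC.{u}) : MonoidalCategoryStruct (A ⟶ B) where
  tensorObj F G := add F G
  tensorUnit := zero A B
  whiskerLeft F {G H} t := tensorCell (𝟙 F) t
  whiskerRight {F G} t H := tensorCell t (𝟙 H)
  tensorHom {F G F' G'} s t := tensorCell s t
  associator F G H :=
    cellIso (F := add (add F G) H) (G := add F (add G H))
      (fun x => α_ (F.obj x) (G.obj x) (H.obj x))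
      (fun f => MonoidalCategory.associator_naturality (F.map f) (G.map f) (H.map f))
      (fun x y => interchange_assoc (μ F.toFunctor x y) (μ G.toFunctor x y) (μ H.toFunctor x y))
  leftUnitor F :=
    cellIso (F := add (zero A B) F) (G := F) (fun x => λ_ (F.obj x))
      (fun f => by
        change (𝟙 (𝟙_ B) ⊗ₘ F.map f) ≫ _ = _
        rw [id_tensorHom, leftUnitor_naturality]
        rfl)
      (fun x y => interchange_leftUnitor (μ F.toFunctor x y))
  rightUnitor F :=
    cellIso (F := add F (zero A B)) (G := F) (fun x => ρ_ (F.obj x))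
      (fun f => by
        change (F.map f ⊗ₘ 𝟙 (𝟙_ B)) ≫ _ = _
        rw [tensorHom_id, rightUnitor_naturality]
        rfl)
      (fun x y => interchange_rightUnitor (μ F.toFunctor x y))

instance (A B : SPC.{u}) : MonoidalCategory (A ⟶ B) where
  tensorHom_def {F G F' G'} s t := cell_ext fun x => by
    change app s x ⊗ₘ app t x = (app s x ⊗ₘ 𝟙 _) ≫ (𝟙 _ ⊗ₘ app t x)
    rw [tensorHom_comp_tensorHom, Category.comp_id, Category.id_comp]
  id_tensorHom_id F G := cell_ext fun x => id_tensorHom_id (F.obj x) (G.obj x)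
  tensorHom_comp_tensorHom s t s' t' := cell_ext fun x =>
    tensorHom_comp_tensorHom (app s x) (app t x) (app s' x) (app t' x)
  whiskerLeft_id F G := cell_ext fun x => id_tensorHom_id (F.obj x) (G.obj x)
  id_whiskerRight F G := cell_ext fun x => id_tensorHom_id (F.obj x) (G.obj x)
  associator_naturality s t r := cell_ext fun x =>
    MonoidalCategory.associator_naturality (app s x) (app t x) (app r x)
  leftUnitor_naturality {F G} s := cell_ext fun x => by
    change (𝟙 (𝟙_ B) ⊗ₘ app s x) ≫ (λ_ (G.obj x)).hom = (λ_ (F.obj x)).hom ≫ app s x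
    rw [id_tensorHom, leftUnitor_naturality]
  rightUnitor_naturality {F G} s := cell_ext fun x => by
    change (app s x ⊗ₘ 𝟙 (𝟙_ B)) ≫ (ρ_ (G.obj x)).hom = (ρ_ (F.obj x)).hom ≫ app s x
    rw [tensorHom_id, rightUnitor_naturality]
  pentagon F G H K := cell_ext fun x => by
    change ((α_ (F.obj x) (G.obj x) (H.obj x)).hom ⊗ₘ 𝟙 (K.obj x)) ≫
        (α_ (F.obj x) (G.obj x ⊗ H.obj x) (K.obj x)).hom ≫
          (𝟙 (F.obj x) ⊗ₘ (α_ (G.obj x) (H.obj x) (K.obj x)).hom) =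
        (α_ (F.obj x ⊗ G.obj x) (H.obj x) (K.obj x)).hom ≫
          (α_ (F.obj x) (G.obj x) (H.obj x ⊗ K.obj x)).hom
    rw [tensorHom_id, id_tensorHom, MonoidalCategory.pentagon]
  triangle F G := cell_ext fun x => by
    change (α_ (F.obj x) (𝟙_ B) (G.obj x)).hom ≫ (𝟙 (F.obj x) ⊗ₘ (λ_ (G.obj x)).hom) =
        ((ρ_ (F.obj x)).hom ⊗ₘ 𝟙 (G.obj x))
    rw [tensorHom_id, id_tensorHom, MonoidalCategory.triangle]

instance (A B : SPC.{u}) : SymmetricCategory (A ⟶ B) where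
  braiding F G :=
    cellIso (F := add F G) (G := add G F) (fun x => β_ (F.obj x) (G.obj x))
      (fun f => BraidedCategory.braiding_naturality (F.map f) (G.map f))
      (fun x y => interchange_braiding (μ F.toFunctor x y) (μ G.toFunctor x y))
  braiding_naturality_right F {G H} t := cell_ext fun x => by
    change (𝟙 (F.obj x) ⊗ₘ app t x) ≫ (β_ (F.obj x) (H.obj x)).hom =
      (β_ (F.obj x) (G.obj x)).hom ≫ (app t x ⊗ₘ 𝟙 (F.obj x))
    rw [BraidedCategory.braiding_naturality]
  braiding_naturality_left {F G} t H := cell_ext fun x => by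
    change (app t x ⊗ₘ 𝟙 (H.obj x)) ≫ (β_ (G.obj x) (H.obj x)).hom =
      (β_ (F.obj x) (H.obj x)).hom ≫ (𝟙 (H.obj x) ⊗ₘ app t x)
    rw [BraidedCategory.braiding_naturality]
  hexagon_forward F G H := cell_ext fun x => by
    change (α_ (F.obj x) (G.obj x) (H.obj x)).hom ≫ (β_ (F.obj x) (G.obj x ⊗ H.obj x)).hom ≫
        (α_ (G.obj x) (H.obj x) (F.obj x)).hom =
      ((β_ (F.obj x) (G.obj x)).hom ⊗ₘ 𝟙 (H.obj x)) ≫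
        (α_ (G.obj x) (F.obj x) (H.obj x)).hom ≫ (𝟙 (G.obj x) ⊗ₘ (β_ (F.obj x) (H.obj x)).hom)
    rw [tensorHom_id, id_tensorHom, BraidedCategory.hexagon_forward]
  hexagon_reverse F G H := cell_ext fun x => by
    change (α_ (F.obj x) (G.obj x) (H.obj x)).inv ≫ (β_ (F.obj x ⊗ G.obj x) (H.obj x)).hom ≫
        (α_ (H.obj x) (F.obj x) (G.obj x)).inv =
      (𝟙 (F.obj x) ⊗ₘ (β_ (G.obj x) (H.obj x)).hom) ≫
        (α_ (F.obj x) (H.obj x) (G.obj x)).inv ≫ ((β_ (F.obj x) (H.obj x)).hom ⊗ₘ 𝟙 (G.obj x))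
    rw [tensorHom_id, id_tensorHom, BraidedCategory.hexagon_reverse]
  symmetry F G := cell_ext fun x => SymmetricCategory.symmetry (F.obj x) (G.obj x)

/-- The internal hom `[A, B]`: the category of 1-cells with the pointwise symmetric monoidal
structure, `dual F = inv ∘ F` and `j` given pointwise. -/
def ihom (A B : SPC.{u}) : SPC.{u} where
  carrier := A ⟶ B
  dual F := F ≫ dualHom B
  j F := cell (F := zero A B) (G := add (F ≫ dualHom B) F) (fun x => B.j (F.obj x))
    (fun {x y} f => by
      change 𝟙 (𝟙_ B) ≫ B.j (F.obj y) = B.j (F.obj x) ≫ (dualMap (F.map f) ⊗ₘ F.map f)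
      rw [j_dualMap, Category.id_comp])
    (fun x y => by
      change (λ_ (𝟙_ B)).hom ≫ B.j (F.obj (x ⊗ y)) = (B.j (F.obj x) ⊗ₘ B.j (F.obj y)) ≫
        tensorμ _ _ _ _ ≫ ((dualμ (F.obj x) (F.obj y) ≫ dualMap (μ F.toFunctor x y)) ⊗ₘ
          μ F.toFunctor x y)
      have h : ((dualμ (F.obj x) (F.obj y) ≫ dualMap (μ F.toFunctor x y)) ⊗ₘ
          μ F.toFunctor x y) = dualμ (F.obj x) (F.obj y) ▷ _ ≫
          (dualMap (μ F.toFunctor x y) ⊗ₘ μ F.toFunctor x y) := by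
        rw [← tensorHom_id, tensorHom_comp_tensorHom, Category.id_comp]
      rw [h, ← j_dualMap (μ F.toFunctor x y), ← jj_dualμ]
      simp [jj])

end Hom

section Strict

/-- A 1-cell is strict if it preserves the monoidal structure, the chosen duals and the chosen
arrows `j` strictly. -/
structure IsStrict {A B : SPC.{u}} (F : A ⟶ B) : Prop where
  obj_unit : F.obj (𝟙_ A) = 𝟙_ B
  obj_tensor : ∀ x y : A, F.obj (x ⊗ y) = F.obj x ⊗ F.obj y
  obj_dual : ∀ x : A, F.obj (A.dual x) = B.dual (F.obj x)
  unit_eq : ε F.toFunctor = eqToHom obj_unit.symm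
  tensor_eq : ∀ x y : A, μ F.toFunctor x y = eqToHom (obj_tensor x y).symm
  map_j : ∀ x : A, F.map (A.j x) = eqToHom obj_unit ≫ B.j (F.obj x) ≫
    eqToHom (by rw [obj_tensor, obj_dual])

end Strict

section Presentation

/-- The free algebra over `V` for the operations unit, dual and tensor. -/
inductive Word (V : Type u) : Type u
  | of (v : V) : Word V
  | unit : Word V
  | dual (X : Word V) : Word V
  | tensor (X Y : Word V) : Word V

/-- Formal arrows between words: composites and inverses of the generating arrows `E`, of the
canonical arrows of a symmetric monoidal structure and of the arrows `j`, closed under tensoring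
with words. -/
inductive Arrow {V : Type u} (E : Word V → Word V → Type u) : Word V → Word V → Type u
  | gen {X Y : Word V} (e : E X Y) : Arrow E X Y
  | id (X : Word V) : Arrow E X X
  | comp {X Y Z : Word V} (f : Arrow E X Y) (g : Arrow E Y Z) : Arrow E X Z
  | inv {X Y : Word V} (f : Arrow E X Y) : Arrow E Y X
  | whiskerLeft (X : Word V) {Y Z : Word V} (f : Arrow E Y Z) : Arrow E (.tensor X Y) (.tensor X Z)
  | whiskerRight {Y Z : Word V} (f : Arrow E Y Z) (X : Word V) : Arrow E (.tensor Y X) (.tensor Z X)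
  | assoc (X Y Z : Word V) : Arrow E (.tensor (.tensor X Y) Z) (.tensor X (.tensor Y Z))
  | left (X : Word V) : Arrow E (.tensor .unit X) X
  | right (X : Word V) : Arrow E (.tensor X .unit) X
  | braid (X Y : Word V) : Arrow E (.tensor X Y) (.tensor Y X)
  | j (X : Word V) : Arrow E .unit (.tensor (.dual X) X)

variable {V : Type u} {E : Word V → Word V → Type u}

/-- The tensor product of two formal arrows. -/
def Arrow.tensor {X Y Z W : Word V} (f : Arrow E X Y) (g : Arrow E Z W) :
    Arrow E (.tensor X Z) (.tensor Y W) :=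
  (f.whiskerRight Z).comp (g.whiskerLeft Y)

/-- The formal interchange `(X ⊗ Y) ⊗ (Z ⊗ W) ⟶ (X ⊗ Z) ⊗ (Y ⊗ W)`. -/
def Arrow.interchange (X Y Z W : Word V) :
    Arrow E (.tensor (.tensor X Y) (.tensor Z W)) (.tensor (.tensor X Z) (.tensor Y W)) :=
  (assoc X Y (.tensor Z W)).comp <|
    ((assoc Y Z W).inv.whiskerLeft X).comp <|
      (((braid Y Z).whiskerRight W).whiskerLeft X).comp <|
        ((assoc Z Y W).whiskerLeft X).comp (assoc X Z (.tensor Y W)).inv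

/-- The congruence on formal arrows generated by `R`, by the axioms of a groupoid, by the
bifunctoriality of the tensor product and by the naturality and coherence axioms of a symmetric
monoidal structure. -/
inductive Rel (R : ∀ {X Y : Word V}, Arrow E X Y → Arrow E X Y → Prop) :
    ∀ {X Y : Word V}, Arrow E X Y → Arrow E X Y → Prop
  | of {X Y} {f g : Arrow E X Y} : R f g → Rel R f g
  | refl {X Y} (f : Arrow E X Y) : Rel R f f
  | symm {X Y} {f g : Arrow E X Y} : Rel R f g → Rel R g f
  | trans {X Y} {f g h : Arrow E X Y} : Rel R f g → Rel R g h → Rel R f h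
  | comp_congr {X Y Z} {f f' : Arrow E X Y} {g g' : Arrow E Y Z} :
      Rel R f f' → Rel R g g' → Rel R (f.comp g) (f'.comp g')
  | inv_congr {X Y} {f f' : Arrow E X Y} : Rel R f f' → Rel R f.inv f'.inv
  | whiskerLeft_congr (X) {Y Z} {f f' : Arrow E Y Z} :
      Rel R f f' → Rel R (f.whiskerLeft X) (f'.whiskerLeft X)
  | whiskerRight_congr {Y Z} {f f' : Arrow E Y Z} (X) :
      Rel R f f' → Rel R (f.whiskerRight X) (f'.whiskerRight X)
  | id_comp {X Y} (f : Arrow E X Y) : Rel R ((Arrow.id X).comp f) f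
  | comp_id {X Y} (f : Arrow E X Y) : Rel R (f.comp (Arrow.id Y)) f
  | comp_assoc {X Y Z W} (f : Arrow E X Y) (g : Arrow E Y Z) (h : Arrow E Z W) :
      Rel R ((f.comp g).comp h) (f.comp (g.comp h))
  | comp_inv {X Y} (f : Arrow E X Y) : Rel R (f.comp f.inv) (Arrow.id X)
  | inv_comp {X Y} (f : Arrow E X Y) : Rel R (f.inv.comp f) (Arrow.id Y)
  | whiskerLeft_id (X Y) : Rel R ((Arrow.id Y).whiskerLeft X) (Arrow.id (.tensor X Y))
  | id_whiskerRight (X Y) : Rel R ((Arrow.id X).whiskerRight Y) (Arrow.id (.tensor X Y))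
  | whiskerLeft_comp (X) {Y Z W} (f : Arrow E Y Z) (g : Arrow E Z W) :
      Rel R ((f.comp g).whiskerLeft X) ((f.whiskerLeft X).comp (g.whiskerLeft X))
  | comp_whiskerRight {Y Z W} (f : Arrow E Y Z) (g : Arrow E Z W) (X) :
      Rel R ((f.comp g).whiskerRight X) ((f.whiskerRight X).comp (g.whiskerRight X))
  | whisker_exchange {X Y Z W} (f : Arrow E X Y) (g : Arrow E Z W) :
      Rel R ((g.whiskerLeft X).comp (f.whiskerRight W)) ((f.whiskerRight Z).comp (g.whiskerLeft Y))
  | pentagon (X Y Z W) : Rel R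
      (((Arrow.assoc X Y Z).whiskerRight W).comp
        ((Arrow.assoc X (.tensor Y Z) W).comp ((Arrow.assoc Y Z W).whiskerLeft X)))
      ((Arrow.assoc (.tensor X Y) Z W).comp (Arrow.assoc X Y (.tensor Z W)))
  | triangle (X Y) : Rel R
      ((Arrow.assoc X .unit Y).comp ((Arrow.left Y).whiskerLeft X)) ((Arrow.right X).whiskerRight Y)
  | braid_left (X) : Rel R ((Arrow.braid X .unit).comp (Arrow.left X)) (Arrow.right X)
  | hexagon (X Y Z) : Rel R
      ((Arrow.assoc X Y Z).comp ((Arrow.braid X (.tensor Y Z)).comp (Arrow.assoc Y Z X)))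
      (((Arrow.braid X Y).whiskerRight Z).comp
        ((Arrow.assoc Y X Z).comp ((Arrow.braid X Z).whiskerLeft Y)))
  | symmetry (X Y) : Rel R ((Arrow.braid X Y).comp (Arrow.braid Y X)) (Arrow.id (.tensor X Y))
  | assoc_natural₁ {X X'} (f : Arrow E X X') (Y Z) : Rel R
      (((f.whiskerRight Y).whiskerRight Z).comp (Arrow.assoc X' Y Z))
      ((Arrow.assoc X Y Z).comp (f.whiskerRight (.tensor Y Z)))
  | assoc_natural₂ (X) {Y Y'} (f : Arrow E Y Y') (Z) : Rel R
      (((f.whiskerLeft X).whiskerRight Z).comp (Arrow.assoc X Y' Z))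
      ((Arrow.assoc X Y Z).comp ((f.whiskerRight Z).whiskerLeft X))
  | assoc_natural₃ (X Y) {Z Z'} (f : Arrow E Z Z') : Rel R
      ((f.whiskerLeft (.tensor X Y)).comp (Arrow.assoc X Y Z'))
      ((Arrow.assoc X Y Z).comp ((f.whiskerLeft Y).whiskerLeft X))
  | left_natural {X Y} (f : Arrow E X Y) : Rel R
      ((f.whiskerLeft .unit).comp (Arrow.left Y)) ((Arrow.left X).comp f)
  | right_natural {X Y} (f : Arrow E X Y) : Rel R
      ((f.whiskerRight .unit).comp (Arrow.right Y)) ((Arrow.right X).comp f)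
  | braid_natural_left {X Y} (f : Arrow E X Y) (Z) : Rel R
      ((f.whiskerRight Z).comp (Arrow.braid Y Z)) ((Arrow.braid X Z).comp (f.whiskerLeft Z))
  | braid_natural_right (X) {Y Z} (f : Arrow E Y Z) : Rel R
      ((f.whiskerLeft X).comp (Arrow.braid X Z)) ((Arrow.braid X Y).comp (f.whiskerRight X))

variable (R : ∀ {X Y : Word V}, Arrow E X Y → Arrow E X Y → Prop)

/-- The congruence as a setoid. -/
def relSetoid (X Y : Word V) : Setoid (Arrow E X Y) where
  r := Rel R
  iseqv := ⟨Rel.refl, Rel.symm, Rel.trans⟩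

/-- The objects of the presented category are the words. -/
structure Presented (R : ∀ {X Y : Word V}, Arrow E X Y → Arrow E X Y → Prop) : Type u where
  word : Word V

namespace Presented
variable {R}

instance : Category.{u} (Presented R) where
  Hom X Y := Quotient (relSetoid R X.word Y.word)
  id X := Quotient.mk _ (Arrow.id X.word)
  comp := Quotient.map₂ Arrow.comp fun _ _ h _ _ h' => Rel.comp_congr h h'
  id_comp := by rintro _ _ ⟨f⟩; exact Quotient.sound (Rel.id_comp f)
  comp_id := by rintro _ _ ⟨f⟩; exact Quotient.sound (Rel.comp_id f)
  assoc := by rintro _ _ _ _ ⟨f⟩ ⟨g⟩ ⟨h⟩; exact Quotient.sound (Rel.comp_assoc f g h)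

/-- The class of a formal arrow. -/
def cls {X Y : Word V} (f : Arrow E X Y) : (⟨X⟩ : Presented R) ⟶ ⟨Y⟩ := Quotient.mk (relSetoid R X Y) f

theorem cls_sound {X Y : Word V} {f g : Arrow E X Y} (h : Rel R f g) :
    (cls f : (⟨X⟩ : Presented R) ⟶ ⟨Y⟩) = cls g := Quotient.sound h

/-- The class of a formal arrow, as an isomorphism. -/
def clsIso {X Y : Word V} (f : Arrow E X Y) : (⟨X⟩ : Presented R) ≅ ⟨Y⟩ where
  hom := cls f
  inv := cls f.inv
  hom_inv_id := cls_sound (Rel.comp_inv f)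
  inv_hom_id := cls_sound (Rel.inv_comp f)

instance : IsGroupoid (Presented R) where
  all_isIso := by
    rintro ⟨X⟩ ⟨Y⟩ ⟨f⟩
    exact (clsIso f).isIso_hom

instance : MonoidalCategoryStruct (Presented R) where
  tensorObj X Y := ⟨.tensor X.word Y.word⟩
  tensorUnit := ⟨.unit⟩
  whiskerLeft X _ _ := Quotient.map (Arrow.whiskerLeft X.word) fun _ _ h => Rel.whiskerLeft_congr _ h
  whiskerRight f X := Quotient.map (fun t => Arrow.whiskerRight t X.word)
    (fun _ _ h => Rel.whiskerRight_congr _ h) f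
  associator X Y Z := clsIso (.assoc X.word Y.word Z.word)
  leftUnitor X := clsIso (.left X.word)
  rightUnitor X := clsIso (.right X.word)
  tensorHom {X Y Z W} := Quotient.map₂ Arrow.tensor fun _ _ h _ _ h' =>
    Rel.comp_congr (Rel.whiskerRight_congr _ h) (Rel.whiskerLeft_congr _ h')

theorem whisker_exchange' {X Y Z W : Presented R} (f : X ⟶ Y) (g : Z ⟶ W) :
    X ◁ g ≫ f ▷ W = f ▷ Z ≫ Y ◁ g := by
  obtain ⟨f⟩ := f
  obtain ⟨g⟩ := g
  exact cls_sound (Rel.whisker_exchange f g)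

theorem tensorHom_def' {X Y Z W : Presented R} (f : X ⟶ Y) (g : Z ⟶ W) :
    f ⊗ₘ g = f ▷ Z ≫ Y ◁ g := by
  obtain ⟨f⟩ := f
  obtain ⟨g⟩ := g
  rfl

theorem whiskerLeft_comp' (X : Presented R) {Y Z W : Presented R} (f : Y ⟶ Z) (g : Z ⟶ W) :
    X ◁ (f ≫ g) = X ◁ f ≫ X ◁ g := by
  obtain ⟨f⟩ := f
  obtain ⟨g⟩ := g
  exact cls_sound (Rel.whiskerLeft_comp _ f g)

theorem comp_whiskerRight' {Y Z W : Presented R} (f : Y ⟶ Z) (g : Z ⟶ W) (X : Presented R) :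
    (f ≫ g) ▷ X = f ▷ X ≫ g ▷ X := by
  obtain ⟨f⟩ := f
  obtain ⟨g⟩ := g
  exact cls_sound (Rel.comp_whiskerRight f g _)

theorem whiskerLeft_id' (X Y : Presented R) : X ◁ 𝟙 Y = 𝟙 (X ⊗ Y) :=
  cls_sound (Rel.whiskerLeft_id _ _)

theorem id_whiskerRight' (X Y : Presented R) : 𝟙 X ▷ Y = 𝟙 (X ⊗ Y) :=
  cls_sound (Rel.id_whiskerRight _ _)

theorem assoc_natural₁ {X X' : Presented R} (f : X ⟶ X') (Y Z : Presented R) :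
    f ▷ Y ▷ Z ≫ (α_ X' Y Z).hom = (α_ X Y Z).hom ≫ f ▷ (Y ⊗ Z) := by
  obtain ⟨f⟩ := f
  exact cls_sound (Rel.assoc_natural₁ f _ _)

theorem assoc_natural₂ (X : Presented R) {Y Y' : Presented R} (f : Y ⟶ Y') (Z : Presented R) :
    (X ◁ f) ▷ Z ≫ (α_ X Y' Z).hom = (α_ X Y Z).hom ≫ X ◁ f ▷ Z := by
  obtain ⟨f⟩ := f
  exact cls_sound (Rel.assoc_natural₂ _ f _)

theorem assoc_natural₃ (X Y : Presented R) {Z Z' : Presented R} (f : Z ⟶ Z') :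
    (X ⊗ Y) ◁ f ≫ (α_ X Y Z').hom = (α_ X Y Z).hom ≫ X ◁ Y ◁ f := by
  obtain ⟨f⟩ := f
  exact cls_sound (Rel.assoc_natural₃ _ _ f)

instance : MonoidalCategory (Presented R) where
  tensorHom_def := tensorHom_def'
  id_tensorHom_id X Y := by
    rw [tensorHom_def', whiskerLeft_id', id_whiskerRight', Category.comp_id]
  tensorHom_comp_tensorHom f₁ f₂ g₁ g₂ := by
    simp only [tensorHom_def', whiskerLeft_comp', comp_whiskerRight', Category.assoc]
    rw [← reassoc_of% (whisker_exchange' g₁ f₂)]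
  whiskerLeft_id := whiskerLeft_id'
  id_whiskerRight := id_whiskerRight'
  associator_naturality f₁ f₂ f₃ := by
    simp only [tensorHom_def', whiskerLeft_comp', comp_whiskerRight', Category.assoc]
    rw [assoc_natural₃, reassoc_of% (assoc_natural₂ _ f₂ _), reassoc_of% (assoc_natural₁ f₁)]
  leftUnitor_naturality := by rintro _ _ ⟨f⟩; exact cls_sound (Rel.left_natural f)
  rightUnitor_naturality := by rintro _ _ ⟨f⟩; exact cls_sound (Rel.right_natural f)
  pentagon X Y Z W := cls_sound (Rel.pentagon _ _ _ _)
  triangle X Y := cls_sound (Rel.triangle _ _)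

/-- The symmetry. -/
def braidIso (X Y : Presented R) : X ⊗ Y ≅ Y ⊗ X where
  hom := cls (.braid X.word Y.word)
  inv := cls (.braid Y.word X.word)
  hom_inv_id := cls_sound (Rel.symmetry _ _)
  inv_hom_id := cls_sound (Rel.symmetry _ _)

theorem hexagon' (X Y Z : Presented R) :
    (α_ X Y Z).hom ≫ (braidIso X (Y ⊗ Z)).hom ≫ (α_ Y Z X).hom =
      (braidIso X Y).hom ▷ Z ≫ (α_ Y X Z).hom ≫ Y ◁ (braidIso X Z).hom :=
  cls_sound (Rel.hexagon _ _ _)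

instance : SymmetricCategory (Presented R) where
  braiding := braidIso
  braiding_naturality_right := by rintro _ _ _ ⟨f⟩; exact cls_sound (Rel.braid_natural_right _ f)
  braiding_naturality_left := by rintro _ _ ⟨f⟩ _; exact cls_sound (Rel.braid_natural_left f _)
  hexagon_forward := hexagon'
  hexagon_reverse X Y Z := by
    change _ ≫ (braidIso Z (X ⊗ Y)).inv ≫ _ =
      X ◁ (braidIso Z Y).inv ≫ _ ≫ (braidIso Z X).inv ▷ Y
    have h := hexagon' Z X Y
    rw [← cancel_epi ((α_ Z X Y).hom ≫ (braidIso Z (X ⊗ Y)).hom ≫ (α_ X Y Z).hom)]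
    conv_rhs => rw [h]
    simp
  symmetry X Y := cls_sound (Rel.symmetry _ _)

end Presented

/-- The symmetric Picard category with generating objects `V`, generating arrows `E` and
relations `R`. -/
def presented (R : ∀ {X Y : Word V}, Arrow E X Y → Arrow E X Y → Prop) : SPC.{u} where
  carrier := Presented R
  dual X := ⟨.dual X.word⟩
  j X := Presented.cls (.j X.word)

section Lift
variable {C : SPC.{u}} (o : V → C)

/-- The interpretation of words in `C`. -/
def wordMap : Word V → C
  | .of v => o v
  | .unit => 𝟙_ C
  | .dual X => C.dual (wordMap X)
  | .tensor X Y => wordMap X ⊗ wordMap Y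

variable (g : ∀ {X Y : Word V}, E X Y → (wordMap o X ⟶ wordMap o Y))

/-- The interpretation of formal arrows in `C`. -/
def arrowMap : ∀ {X Y : Word V}, Arrow E X Y → (wordMap o X ⟶ wordMap o Y)
  | _, _, .gen e => g e
  | _, _, .id _ => 𝟙 _
  | _, _, .comp f h => arrowMap f ≫ arrowMap h
  | _, _, .inv f => CategoryTheory.inv (arrowMap f)
  | _, _, .whiskerLeft X f => wordMap o X ◁ arrowMap f
  | _, _, .whiskerRight f X => arrowMap f ▷ wordMap o X
  | _, _, .assoc _ _ _ => (α_ _ _ _).hom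
  | _, _, .left _ => (λ_ _).hom
  | _, _, .right _ => (ρ_ _).hom
  | _, _, .braid _ _ => (β_ _ _).hom
  | _, _, .j X => C.j (wordMap o X)

theorem arrowMap_rel
    (hR : ∀ {X Y : Word V} {f h : Arrow E X Y}, R f h → arrowMap o g f = arrowMap o g h)
    {X Y : Word V} {f h : Arrow E X Y} (r : Rel R f h) :
    arrowMap o g f = arrowMap o g h := by
  induction r with
  | of r => exact hR r
  | refl => rfl
  | symm _ ih => exact ih.symm
  | trans _ _ ih ih' => exact ih.trans ih'
  | hexagon => exact BraidedCategory.hexagon_forward _ _ _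
  | pentagon => exact MonoidalCategory.pentagon _ _ _ _
  | triangle => exact MonoidalCategory.triangle _ _
  | braid_left => exact braiding_leftUnitor _
  | symmetry => exact SymmetricCategory.symmetry _ _
  | whisker_exchange => exact MonoidalCategory.whisker_exchange _ _
  | _ => simp_all [arrowMap, wordMap]

/-- The strict arrow out of a presented symmetric Picard category with given values on generators. -/
def lift
    (hR : ∀ {X Y : Word V} {f h : Arrow E X Y}, R f h → arrowMap o g f = arrowMap o g h) :
    presented R ⟶ C :=
  ⟨{ obj := fun X => wordMap o X.word
     map := Quotient.lift (arrowMap o g) fun _ _ h => arrowMap_rel R o g hR h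
     map_id := fun _ => rfl
     map_comp := by rintro _ _ _ ⟨f⟩ ⟨h⟩; rfl },
   { ε := 𝟙 _
     μ := fun _ _ => 𝟙 _
     μ_natural_left := by
       rintro _ _ ⟨f⟩ _
       exact (Category.comp_id _).trans (Category.id_comp _).symm
     μ_natural_right := by
       rintro _ _ _ ⟨f⟩
       exact (Category.comp_id _).trans (Category.id_comp _).symm
     associativity := fun X Y Z => by
       change 𝟙 (wordMap o X.word ⊗ wordMap o Y.word) ▷ _ ≫ 𝟙 _ ≫ (α_ _ _ _).hom =
         (α_ _ _ _).hom ≫ _ ◁ 𝟙 (wordMap o Y.word ⊗ wordMap o Z.word) ≫ 𝟙 _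
       simp
     left_unitality := fun X => by
       change (λ_ (wordMap o X.word)).hom = 𝟙 (𝟙_ C) ▷ _ ≫ 𝟙 _ ≫ (λ_ _).hom
       simp
     right_unitality := fun X => by
       change (ρ_ (wordMap o X.word)).hom = _ ◁ 𝟙 (𝟙_ C) ≫ 𝟙 _ ≫ (ρ_ _).hom
       simp
     braided := fun X Y => (Category.id_comp _).trans (Category.comp_id _).symm }⟩

theorem lift_isStrict
    (hR : ∀ {X Y : Word V} {f h : Arrow E X Y}, R f h → arrowMap o g f = arrowMap o g h) :
    IsStrict (lift R o g hR) where
  obj_unit := rfl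
  obj_tensor _ _ := rfl
  obj_dual _ := rfl
  unit_eq := rfl
  tensor_eq _ _ := rfl
  map_j X := by
    change C.j (wordMap o X.word) = 𝟙 _ ≫ C.j (wordMap o X.word) ≫ 𝟙 _
    simp

end Lift
end Presentation

section Unit

/-- No generating arrow. -/
abbrev NoEdge : Word PUnit.{u + 1} → Word PUnit.{u + 1} → Type u := fun _ _ => PEmpty

/-- No relation. -/
abbrev NoRel : ∀ {X Y : Word PUnit.{u + 1}}, Arrow NoEdge X Y → Arrow NoEdge X Y → Prop :=
  fun _ _ => False

/-- The unit: the free symmetric Picard category on one generator. -/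
def I : SPC.{u} := presented NoRel

/-- The generator `⋆`. -/
def star : I.{u} := ⟨.of PUnit.unit⟩

/-- The strict arrow `I ⟶ A` sending `⋆` to `a`. -/
def point {A : SPC.{u}} (a : A) : I ⟶ A :=
  lift NoRel (fun _ => a) (fun e => e.elim) (fun h => h.elim)

/-- The strict arrow `v : I ⟶ [A, A]` sending `⋆` to the identity. -/
def v (A : SPC.{u}) : I ⟶ ihom A A := point (A := ihom A A) (𝟙 A)

end Unit

section HomTwo
variable {A B C D : SPC.{u}}

theorem comp_μ (F : A ⟶ B) (G : B ⟶ C) (x y : A) :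
    μ (F ≫ G).toFunctor x y = μ G.toFunctor (F.obj x) (F.obj y) ≫ G.map (μ F.toFunctor x y) := rfl

/-- The 2-cell `G ∘ t`. -/
def whiskerRight {F F' : A ⟶ B} (t : F ⟶ F') (G : B ⟶ C) : F ≫ G ⟶ F' ≫ G :=
  cell (fun x => G.map (app t x))
    (fun {x y} f => by
      change G.map (F.map f) ≫ G.map (app t y) = G.map (app t x) ≫ G.map (F'.map f)
      rw [← G.map_comp, app_naturality, G.map_comp])
    (fun x y => by
      change (μ G.toFunctor _ _ ≫ G.map (μ F.toFunctor x y)) ≫ G.map (app t (x ⊗ y)) =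
        (G.map (app t x) ⊗ₘ G.map (app t y)) ≫ μ G.toFunctor _ _ ≫ G.map (μ F'.toFunctor x y)
      rw [Category.assoc, ← G.map_comp, app_tensor, G.map_comp,
        Functor.LaxMonoidal.μ_natural_assoc])

/-- The 2-cell `t ∘ F`. -/
def whiskerLeft (F : A ⟶ B) {G G' : B ⟶ C} (t : G ⟶ G') : F ≫ G ⟶ F ≫ G' :=
  cell (fun x => app t (F.obj x))
    (fun {x y} f => app_naturality t (F.map f))
    (fun x y => by
      change (μ G.toFunctor _ _ ≫ G.map (μ F.toFunctor x y)) ≫ app t (F.obj (x ⊗ y)) =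
        (app t (F.obj x) ⊗ₘ app t (F.obj y)) ≫ μ G'.toFunctor _ _ ≫ G'.map (μ F.toFunctor x y)
      rw [Category.assoc, app_naturality, ← Category.assoc, app_tensor, Category.assoc])

theorem app_tensorμ (F G H K : A ⟶ B) (x : A) :
    app (A := A) (B := B) (F := add (add F G) (add H K)) (G := add (add F H) (add G K))
      (tensorμ (C := ihom A B) F G H K) x =
      tensorμ (F.obj x) (G.obj x) (H.obj x) (K.obj x) := by
  change (α_ (F.obj x) (G.obj x) (H.obj x ⊗ K.obj x)).hom ≫
    (𝟙 (F.obj x) ⊗ₘ (α_ (G.obj x) (H.obj x) (K.obj x)).inv) ≫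
      (𝟙 (F.obj x) ⊗ₘ ((β_ (G.obj x) (H.obj x)).hom ⊗ₘ 𝟙 (K.obj x))) ≫
        (𝟙 (F.obj x) ⊗ₘ (α_ (H.obj x) (G.obj x) (K.obj x)).hom) ≫
          (α_ (F.obj x) (H.obj x) (G.obj x ⊗ K.obj x)).inv = _
  simp only [tensorμ, id_tensorHom, tensorHom_id]

theorem functor_interchange (G : B ⟶ C) {a b c a' b' c' : B} (m : a ⊗ b ⟶ c) (n : a' ⊗ b' ⟶ c') :
    (tensorμ _ _ _ _ ≫ ((μ G.toFunctor a b ≫ G.map m) ⊗ₘ (μ G.toFunctor a' b' ≫ G.map n))) ≫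
        μ G.toFunctor c c' =
      (μ G.toFunctor a a' ⊗ₘ μ G.toFunctor b b') ≫ μ G.toFunctor _ _ ≫
        G.map (tensorμ _ _ _ _ ≫ (m ⊗ₘ n)) := by
  rw [← tensorHom_comp_tensorHom, Category.assoc, Category.assoc, Functor.LaxMonoidal.μ_natural,
    G.map_comp, reassoc_of% (tensorμ_comp_μ_tensorHom_μ_comp_μ G.toFunctor a a' b b')]

/-- The 1-cell `[1, G] : [A, B] ⟶ [A, C]`, `F ↦ G ∘ F`. -/
def post (A : SPC.{u}) (G : B ⟶ C) : ihom A B ⟶ ihom A C :=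
  ⟨{ obj := fun F => F ≫ G
     map := fun {F F'} t => whiskerRight t G
     map_id := fun F => cell_ext fun x => G.map_id (F.obj x)
     map_comp := fun s t => cell_ext fun x => G.map_comp (app s x) (app t x) },
   { ε := cell (F := zero A C) (G := zero A B ≫ G) (fun x => ε G.toFunctor)
       (fun _ => by
         change 𝟙 _ ≫ ε G.toFunctor = ε G.toFunctor ≫ G.map (𝟙 _)
         simp)
       (fun _ _ => by
         change (λ_ _).hom ≫ ε G.toFunctor = (ε G.toFunctor ⊗ₘ ε G.toFunctor) ≫
           μ G.toFunctor _ _ ≫ G.map (λ_ (𝟙_ B)).hom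
         rw [MonoidalCategory.tensorHom_def', Category.assoc, ← Functor.LaxMonoidal.left_unitality,
           leftUnitor_naturality])
     μ := fun (F F' : A ⟶ B) => cell (F := add (F ≫ G) (F' ≫ G)) (G := add F F' ≫ G)
       (fun x => μ G.toFunctor (F.obj x) (F'.obj x))
       (fun f => Functor.LaxMonoidal.μ_natural G.toFunctor (F.map f) (F'.map f))
       (fun x y => functor_interchange G (μ F.toFunctor x y) (μ F'.toFunctor x y))
     μ_natural_left := fun {F F'} (t : F ⟶ F') (H : A ⟶ B) => cell_ext fun x => by
       change (G.map (app t x) ⊗ₘ 𝟙 (G.obj (H.obj x))) ≫ μ G.toFunctor _ _ =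
         μ G.toFunctor _ _ ≫ G.map (app t x ⊗ₘ 𝟙 (H.obj x))
       rw [← G.map_id, Functor.LaxMonoidal.μ_natural]
     μ_natural_right := fun {F F'} (H : A ⟶ B) (t : F ⟶ F') => cell_ext fun x => by
       change (𝟙 (G.obj (H.obj x)) ⊗ₘ G.map (app t x)) ≫ μ G.toFunctor _ _ =
         μ G.toFunctor _ _ ≫ G.map (𝟙 (H.obj x) ⊗ₘ app t x)
       rw [← G.map_id, Functor.LaxMonoidal.μ_natural]
     associativity := fun (F F' F'' : A ⟶ B) => cell_ext fun x => by
       change (μ G.toFunctor (F.obj x) (F'.obj x) ⊗ₘ 𝟙 (G.obj (F''.obj x))) ≫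
           μ G.toFunctor (F.obj x ⊗ F'.obj x) (F''.obj x) ≫ G.map (α_ _ _ _).hom =
         (α_ _ _ _).hom ≫ (𝟙 (G.obj (F.obj x)) ⊗ₘ μ G.toFunctor (F'.obj x) (F''.obj x)) ≫
           μ G.toFunctor (F.obj x) (F'.obj x ⊗ F''.obj x)
       rw [tensorHom_id, id_tensorHom, Functor.LaxMonoidal.associativity]
     left_unitality := fun (F : A ⟶ B) => cell_ext fun x => by
       change (λ_ (G.obj (F.obj x))).hom = (ε G.toFunctor ⊗ₘ 𝟙 (G.obj (F.obj x))) ≫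
         μ G.toFunctor _ _ ≫ G.map (λ_ (F.obj x)).hom
       rw [tensorHom_id, ← Functor.LaxMonoidal.left_unitality]
     right_unitality := fun (F : A ⟶ B) => cell_ext fun x => by
       change (ρ_ (G.obj (F.obj x))).hom = (𝟙 (G.obj (F.obj x)) ⊗ₘ ε G.toFunctor) ≫
         μ G.toFunctor _ _ ≫ G.map (ρ_ (F.obj x)).hom
       rw [id_tensorHom, ← Functor.LaxMonoidal.right_unitality]
     braided := fun (F F' : A ⟶ B) => cell_ext fun x =>
       Functor.LaxBraided.braided (F := G.toFunctor) (F.obj x) (F'.obj x) }⟩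

/-- The unit constraint of `[F, 1]`, an identity on components. -/
def preε (F : A ⟶ B) (C : SPC.{u}) : zero A C ⟶ F ≫ zero B C :=
  cell (fun _ => 𝟙 (𝟙_ C)) (fun _ => rfl) (fun _ _ => by
    change (λ_ (𝟙_ C)).hom ≫ 𝟙 _ = (𝟙 _ ⊗ₘ 𝟙 _) ≫ (λ_ (𝟙_ C)).hom ≫ 𝟙 _
    rw [id_tensorHom_id, Category.id_comp])

/-- The tensor constraint of `[F, 1]`, an identity on components. -/
def preμ (F : A ⟶ B) (G G' : B ⟶ C) : add (F ≫ G) (F ≫ G') ⟶ F ≫ add G G' :=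
  cell (fun x => 𝟙 (G.obj (F.obj x) ⊗ G'.obj (F.obj x)))
    (fun _ => (Category.comp_id _).trans (Category.id_comp _).symm) (fun x y => by
    change (tensorμ _ _ _ _ ≫ ((μ G.toFunctor _ _ ≫ G.map (μ F.toFunctor x y)) ⊗ₘ
        (μ G'.toFunctor _ _ ≫ G'.map (μ F.toFunctor x y)))) ≫ 𝟙 _ =
      (𝟙 _ ⊗ₘ 𝟙 _) ≫ (tensorμ _ _ _ _ ≫ (μ G.toFunctor _ _ ⊗ₘ μ G'.toFunctor _ _)) ≫
        (G.map (μ F.toFunctor x y) ⊗ₘ G'.map (μ F.toFunctor x y))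
    rw [id_tensorHom_id, Category.id_comp, Category.comp_id, Category.assoc,
      tensorHom_comp_tensorHom])

/-- The 1-cell `[F, 1] : [B, C] ⟶ [A, C]`, `G ↦ G ∘ F`. -/
def pre (F : A ⟶ B) (C : SPC.{u}) : ihom B C ⟶ ihom A C :=
  ⟨{ obj := fun G => F ≫ G
     map := fun {G G'} t => whiskerLeft F t
     map_id := fun G => rfl
     map_comp := fun s t => rfl },
   { ε := preε F C
     μ := fun G G' => preμ F G G'
     μ_natural_left := fun {G G'} (t : G ⟶ G') (H : B ⟶ C) => cell_ext fun x =>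
       (Category.comp_id _).trans (Category.id_comp _).symm
     μ_natural_right := fun {G G'} (H : B ⟶ C) (t : G ⟶ G') => cell_ext fun x =>
       (Category.comp_id _).trans (Category.id_comp _).symm
     associativity := fun (G G' G'' : B ⟶ C) => cell_ext fun x => by
       change (𝟙 (G.obj (F.obj x) ⊗ G'.obj (F.obj x)) ⊗ₘ 𝟙 (G''.obj (F.obj x))) ≫ 𝟙 _ ≫
           (α_ _ _ _).hom =
         (α_ _ _ _).hom ≫ (𝟙 (G.obj (F.obj x)) ⊗ₘ 𝟙 (G'.obj (F.obj x) ⊗ G''.obj (F.obj x))) ≫ 𝟙 _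
       rw [id_tensorHom_id, id_tensorHom_id, Category.id_comp, Category.id_comp,
         Category.comp_id, Category.comp_id]
     left_unitality := fun (G : B ⟶ C) => cell_ext fun x => by
       change (λ_ (G.obj (F.obj x))).hom = (𝟙 (𝟙_ C) ⊗ₘ 𝟙 (G.obj (F.obj x))) ≫ 𝟙 _ ≫ (λ_ _).hom
       rw [id_tensorHom_id, Category.id_comp, Category.id_comp]
     right_unitality := fun (G : B ⟶ C) => cell_ext fun x => by
       change (ρ_ (G.obj (F.obj x))).hom = (𝟙 (G.obj (F.obj x)) ⊗ₘ 𝟙 (𝟙_ C)) ≫ 𝟙 _ ≫ (ρ_ _).hom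
       rw [id_tensorHom_id, Category.id_comp, Category.id_comp]
     braided := fun (G G' : B ⟶ C) => cell_ext fun x =>
       (Category.id_comp _).trans (Category.comp_id _).symm }⟩

/-- The 1-cell `[A, -] : [B, C] ⟶ [[A, B], [A, C]]`, `G ↦ [1, G]`. -/
def postHom (A B C : SPC.{u}) : ihom B C ⟶ ihom (ihom A B) (ihom A C) :=
  ⟨{ obj := fun G => post A G
     map := fun {G G'} t => cell (F := post A G) (G := post A G')
       (fun F => whiskerLeft F t)
       (fun s => cell_ext fun x => app_naturality t (app s x))
       (fun (F F' : A ⟶ B) => cell_ext fun x => app_tensor t (F.obj x) (F'.obj x))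
     map_id := fun G => rfl
     map_comp := fun s t => rfl },
   { ε := cell (F := zero (ihom A B) (ihom A C)) (G := post A (zero B C))
       (fun F => preε F C)
       (fun _ => rfl)
       (fun F F' => cell_ext fun x => by
         change (λ_ (𝟙_ C)).hom ≫ 𝟙 _ = (𝟙 _ ⊗ₘ 𝟙 _) ≫ (λ_ (𝟙_ C)).hom
         rw [id_tensorHom_id, Category.id_comp, Category.comp_id])
     μ := fun (G G' : B ⟶ C) =>
       cell (F := add (post A G) (post A G')) (G := post A (add G G'))
         (fun F => preμ F G G')
         (fun _ => cell_ext fun x => (Category.comp_id _).trans (Category.id_comp _).symm)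
         (fun (F F' : A ⟶ B) => cell_ext fun x => by
           change (app (F := add (add (F ≫ G) (F ≫ G')) (add (F' ≫ G) (F' ≫ G')))
             (G := add (add (F ≫ G) (F' ≫ G)) (add (F ≫ G') (F' ≫ G')))
             (tensorμ (C := ihom A C) (F ≫ G) (F ≫ G') (F' ≫ G) (F' ≫ G')) x ≫ (μ G.toFunctor (F.obj x) (F'.obj x) ⊗ₘ
               μ G'.toFunctor (F.obj x) (F'.obj x))) ≫ 𝟙 _ =
             (𝟙 _ ⊗ₘ 𝟙 _) ≫ tensorμ _ _ _ _ ≫ (μ G.toFunctor (F.obj x) (F'.obj x) ⊗ₘ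
               μ G'.toFunctor (F.obj x) (F'.obj x))
           rw [id_tensorHom_id, Category.id_comp, Category.comp_id, app_tensorμ]
           rfl)
     μ_natural_left := fun {G G'} (t : G ⟶ G') (H : B ⟶ C) => cell_ext fun F => cell_ext fun x =>
       (Category.comp_id _).trans (Category.id_comp _).symm
     μ_natural_right := fun {G G'} (H : B ⟶ C) (t : G ⟶ G') => cell_ext fun F => cell_ext fun x =>
       (Category.comp_id _).trans (Category.id_comp _).symm
     associativity := fun G G' G'' => cell_ext fun F =>
       Functor.LaxMonoidal.associativity (F := (pre F C).toFunctor) G G' G''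
     left_unitality := fun G => cell_ext fun F =>
       Functor.LaxMonoidal.left_unitality (F := (pre F C).toFunctor) G
     right_unitality := fun G => cell_ext fun F =>
       Functor.LaxMonoidal.right_unitality (F := (pre F C).toFunctor) G
     braided := fun G G' => cell_ext fun F =>
       Functor.LaxBraided.braided (F := (pre F C).toFunctor) G G' }⟩

/-- The strict evaluation arrow `ev_a : [A, B] ⟶ B`. -/
def ev {A : SPC.{u}} (a : A) (B : SPC.{u}) : ihom A B ⟶ B :=
  ⟨{ obj := fun F => F.obj a
     map := fun {F F'} t => app t a
     map_id := fun _ => rfl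
     map_comp := fun _ _ => rfl },
   { ε := 𝟙 _
     μ := fun _ _ => 𝟙 _
     μ_natural_left := fun {F F'} (t : F ⟶ F') (H : A ⟶ B) => by
       change (app t a ▷ H.obj a) ≫ 𝟙 _ = 𝟙 _ ≫ (app t a ⊗ₘ 𝟙 (H.obj a))
       rw [Category.comp_id, Category.id_comp, tensorHom_id]
     μ_natural_right := fun {F F'} (H : A ⟶ B) (t : F ⟶ F') => by
       change (H.obj a ◁ app t a) ≫ 𝟙 _ = 𝟙 _ ≫ (𝟙 (H.obj a) ⊗ₘ app t a)
       rw [Category.comp_id, Category.id_comp, id_tensorHom]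
     associativity := fun (F F' F'' : A ⟶ B) => by
       change 𝟙 (F.obj a ⊗ F'.obj a) ▷ F''.obj a ≫ 𝟙 _ ≫ (α_ _ _ _).hom =
         (α_ _ _ _).hom ≫ F.obj a ◁ 𝟙 (F'.obj a ⊗ F''.obj a) ≫ 𝟙 _
       simp
     left_unitality := fun (F : A ⟶ B) => by
       change (λ_ (F.obj a)).hom = 𝟙 (𝟙_ B) ▷ F.obj a ≫ 𝟙 _ ≫ (λ_ _).hom
       simp
     right_unitality := fun (F : A ⟶ B) => by
       change (ρ_ (F.obj a)).hom = F.obj a ◁ 𝟙 (𝟙_ B) ≫ 𝟙 _ ≫ (ρ_ _).hom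
       simp
     braided := fun (F F' : A ⟶ B) =>
       (Category.id_comp _).trans (Category.comp_id _).symm }⟩

/-- The value at `a` of a 1-cell `F : A ⟶ [B, C]`, as a 1-cell. -/
abbrev val (F : A ⟶ ihom B C) (a : A) : B ⟶ C := F.obj a

/-- The value at an arrow of a 1-cell `F : A ⟶ [B, C]`, as a 2-cell. -/
abbrev valMap (F : A ⟶ ihom B C) {a a' : A} (f : a ⟶ a') : val F a ⟶ val F a' := F.map f

/-- The structure arrow of a 1-cell `F : A ⟶ [B, C]`, as a 2-cell. -/
abbrev valμ (F : A ⟶ ihom B C) (a a' : A) : add (val F a) (val F a') ⟶ val F (a ⊗ a') :=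
  μ F.toFunctor a a'

theorem app_unit {F G : A ⟶ B} (t : F ⟶ G) :
    ε F.toFunctor ≫ app t (𝟙_ A) = ε G.toFunctor :=
  t.hom.isMonoidal.unit

/-- The structure arrow `F(x)(b) ⊗ F(y)(b) ⟶ F(x ⊗ y)(b)` of a 1-cell `F : A ⟶ [B, C]`. -/
def appμ (F : A ⟶ ihom B C) (x y : A) (b : B) :
    (val F x).obj b ⊗ (val F y).obj b ⟶ (val F (x ⊗ y)).obj b :=
  app (valμ F x y) b

theorem appμ_natural (F : A ⟶ ihom B C) (x y : A) {b b' : B} (g : b ⟶ b') :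
    ((val F x).map g ⊗ₘ (val F y).map g) ≫ appμ F x y b' =
      appμ F x y b ≫ (val F (x ⊗ y)).map g :=
  app_naturality (valμ F x y) g

theorem appμ_unit (F : A ⟶ ihom B C) (x y : A) :
    ((λ_ (𝟙_ C)).inv ≫ (ε (val F x).toFunctor ⊗ₘ ε (val F y).toFunctor)) ≫ appμ F x y (𝟙_ B) =
      ε (val F (x ⊗ y)).toFunctor :=
  app_unit (valμ F x y)

theorem appμ_tensor (F : A ⟶ ihom B C) (x y : A) (b b' : B) :
    (tensorμ _ _ _ _ ≫ (μ (val F x).toFunctor b b' ⊗ₘ μ (val F y).toFunctor b b')) ≫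
        appμ F x y (b ⊗ b') =
      (appμ F x y b ⊗ₘ appμ F x y b') ≫ μ (val F (x ⊗ y)).toFunctor b b' :=
  app_tensor (valμ F x y) b _

/-- The 1-cell `B ⟶ [A, C]`, `b ↦ (a ↦ F(a)(b))`, dual to `F : A ⟶ [B, C]`. -/
def dualize (F : A ⟶ ihom B C) : B ⟶ ihom A C :=
  ⟨{ obj := fun b => F ≫ ev b C
     map := fun {b b'} g => cell (F := F ≫ ev b C) (G := F ≫ ev b' C)
       (fun a => (val F a).map g)
       (fun f => (app_naturality (valMap F f) g).symm)
       (fun x y => by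
         change (𝟙 _ ≫ appμ F x y b) ≫ (val F (x ⊗ y)).map g =
           ((val F x).map g ⊗ₘ (val F y).map g) ≫ 𝟙 _ ≫ appμ F x y b'
         rw [Category.id_comp, Category.id_comp, appμ_natural])
     map_id := fun b => cell_ext fun a => (val F a).map_id b
     map_comp := fun g h => cell_ext fun a => (val F a).map_comp g h },
   { ε := cell (F := zero A C) (G := F ≫ ev (𝟙_ B) C) (fun a => ε (val F a).toFunctor)
       (fun f => (Category.id_comp _).trans (app_unit (valMap F f)).symm)
       (fun x y => by
         change (λ_ (𝟙_ C)).hom ≫ ε (val F (x ⊗ y)).toFunctor =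
           (ε (val F x).toFunctor ⊗ₘ ε (val F y).toFunctor) ≫ 𝟙 _ ≫ appμ F x y (𝟙_ B)
         rw [Category.id_comp, ← appμ_unit, Category.assoc, Iso.hom_inv_id_assoc])
     μ := fun b b' => cell (F := add (F ≫ ev b C) (F ≫ ev b' C)) (G := F ≫ ev (b ⊗ b') C)
       (fun a => μ (val F a).toFunctor b b')
       (fun f => (app_tensor (valMap F f) b b').symm)
       (fun x y => by
         change (tensorμ _ _ _ _ ≫ ((𝟙 _ ≫ appμ F x y b) ⊗ₘ (𝟙 _ ≫ appμ F x y b'))) ≫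
             μ (val F (x ⊗ y)).toFunctor b b' =
           (μ (val F x).toFunctor b b' ⊗ₘ μ (val F y).toFunctor b b') ≫
             𝟙 _ ≫ appμ F x y (b ⊗ b')
         rw [Category.id_comp, Category.id_comp, Category.id_comp, Category.assoc,
           ← appμ_tensor, ← Category.assoc, ← Category.assoc, tensorμ_tensorμ,
           Category.id_comp])
     μ_natural_left := fun {b b'} g c => cell_ext fun a => by
       change ((val F a).map g ⊗ₘ 𝟙 ((val F a).obj c)) ≫ _ = _ ≫ (val F a).map (g ▷ c)
       rw [tensorHom_id]
       exact Functor.LaxMonoidal.μ_natural_left (val F a).toFunctor g c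
     μ_natural_right := fun {b b'} c g => cell_ext fun a => by
       change (𝟙 ((val F a).obj c) ⊗ₘ (val F a).map g) ≫ _ = _ ≫ (val F a).map (c ◁ g)
       rw [id_tensorHom]
       exact Functor.LaxMonoidal.μ_natural_right (val F a).toFunctor c g
     associativity := fun b c d => cell_ext fun a => by
       change (μ (val F a).toFunctor b c ⊗ₘ 𝟙 ((val F a).obj d)) ≫
           μ (val F a).toFunctor (b ⊗ c) d ≫ (val F a).map (α_ b c d).hom =
         (α_ _ _ _).hom ≫ (𝟙 ((val F a).obj b) ⊗ₘ μ (val F a).toFunctor c d) ≫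
           μ (val F a).toFunctor b (c ⊗ d)
       rw [tensorHom_id, id_tensorHom, Functor.LaxMonoidal.associativity]
     left_unitality := fun b => cell_ext fun a => by
       change (λ_ ((val F a).obj b)).hom = (ε (val F a).toFunctor ⊗ₘ 𝟙 ((val F a).obj b)) ≫
         μ (val F a).toFunctor _ _ ≫ (val F a).map (λ_ b).hom
       rw [tensorHom_id, ← Functor.LaxMonoidal.left_unitality]
     right_unitality := fun b => cell_ext fun a => by
       change (ρ_ ((val F a).obj b)).hom = (𝟙 ((val F a).obj b) ⊗ₘ ε (val F a).toFunctor) ≫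
         μ (val F a).toFunctor _ _ ≫ (val F a).map (ρ_ b).hom
       rw [id_tensorHom, ← Functor.LaxMonoidal.right_unitality]
     braided := fun b b' => cell_ext fun a =>
       Functor.LaxBraided.braided (F := (val F a).toFunctor) b b' }⟩

end HomTwo

section Tensor
variable {A B C D : SPC.{u}}

/-- The generating arrows of the tensor product, between words in the pairs `(a, b)`. -/
inductive TEdge (A B : SPC.{u}) :
    Word (A.carrier × B.carrier) → Word (A.carrier × B.carrier) → Type u
  | left (a : A.carrier) {b b' : B.carrier} (g : b ⟶ b') : TEdge A B (.of (a, b)) (.of (a, b'))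
  | right {a a' : A.carrier} (f : a ⟶ a') (b : B.carrier) : TEdge A B (.of (a, b)) (.of (a', b))
  | γ (a a' : A.carrier) (b : B.carrier) :
      TEdge A B (.tensor (.of (a, b)) (.of (a', b))) (.of (a ⊗ a', b))
  | δ (a : A.carrier) (b b' : B.carrier) :
      TEdge A B (.tensor (.of (a, b)) (.of (a, b'))) (.of (a, b ⊗ b'))

namespace TEdge
/-- `a ⊗ g` as a formal arrow. -/
abbrev l (a : A.carrier) {b b' : B.carrier} (g : b ⟶ b') :
    Arrow (TEdge A B) (.of (a, b)) (.of (a, b')) := .gen (.left a g)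
/-- `f ⊗ b` as a formal arrow. -/
abbrev r {a a' : A.carrier} (f : a ⟶ a') (b : B.carrier) :
    Arrow (TEdge A B) (.of (a, b)) (.of (a', b)) := .gen (.right f b)
/-- `γ` as a formal arrow. -/
abbrev c (a a' : A.carrier) (b : B.carrier) :
    Arrow (TEdge A B) (.tensor (.of (a, b)) (.of (a', b))) (.of (a ⊗ a', b)) := .gen (.γ a a' b)
/-- `δ` as a formal arrow. -/
abbrev d (a : A.carrier) (b b' : B.carrier) :
    Arrow (TEdge A B) (.tensor (.of (a, b)) (.of (a, b'))) (.of (a, b ⊗ b')) := .gen (.δ a b b')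
end TEdge

section
open TEdge

/-- The defining relations of the tensor product: functoriality of `a ⊗ -` and `- ⊗ b`,
their exchange, naturality of `γ` and `δ` in each of their three variables, compatibility of `δ`
and of `γ` with associativity and symmetry, and compatibility of `γ` with `δ`. -/
inductive TRel (A B : SPC.{u}) : ∀ {X Y : Word (A.carrier × B.carrier)},
    Arrow (TEdge A B) X Y → Arrow (TEdge A B) X Y → Prop
  | left_comp (a : A.carrier) {b b' b'' : B.carrier} (f : b ⟶ b') (g : b' ⟶ b'') :
      TRel A B (l a (f ≫ g)) ((l a f).comp (l a g))
  | right_comp {a a' a'' : A.carrier} (f : a ⟶ a') (g : a' ⟶ a'') (b : B.carrier) :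
      TRel A B (r (f ≫ g) b) ((r f b).comp (r g b))
  | left_id (a : A.carrier) (b : B.carrier) : TRel A B (l a (𝟙 b)) (.id _)
  | right_id (a : A.carrier) (b : B.carrier) : TRel A B (r (𝟙 a) b) (.id _)
  | exchange {a a' : A.carrier} (f : a ⟶ a') {b b' : B.carrier} (g : b ⟶ b') :
      TRel A B ((r f b).comp (l a' g)) ((l a g).comp (r f b'))
  | γ_natural₁ {a₁ a₂ : A.carrier} (f : a₁ ⟶ a₂) (a' : A.carrier) (b : B.carrier) :
      TRel A B (((r f b).whiskerRight _).comp (c a₂ a' b)) ((c a₁ a' b).comp (r (f ▷ a') b))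
  | γ_natural₂ (a : A.carrier) {a₁ a₂ : A.carrier} (f : a₁ ⟶ a₂) (b : B.carrier) :
      TRel A B (((r f b).whiskerLeft _).comp (c a a₂ b)) ((c a a₁ b).comp (r (a ◁ f) b))
  | γ_natural₃ (a a' : A.carrier) {b b' : B.carrier} (g : b ⟶ b') :
      TRel A B (((l a g).tensor (l a' g)).comp (c a a' b')) ((c a a' b).comp (l (a ⊗ a') g))
  | δ_natural₁ {a a' : A.carrier} (f : a ⟶ a') (b b' : B.carrier) :
      TRel A B (((r f b).tensor (r f b')).comp (d a' b b')) ((d a b b').comp (r f (b ⊗ b')))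
  | δ_natural₂ (a : A.carrier) {b₁ b₂ : B.carrier} (g : b₁ ⟶ b₂) (b' : B.carrier) :
      TRel A B (((l a g).whiskerRight _).comp (d a b₂ b')) ((d a b₁ b').comp (l a (g ▷ b')))
  | δ_natural₃ (a : A.carrier) (b : B.carrier) {b₁ b₂ : B.carrier} (g : b₁ ⟶ b₂) :
      TRel A B (((l a g).whiskerLeft _).comp (d a b b₂)) ((d a b b₁).comp (l a (b ◁ g)))
  | δ_assoc (a : A.carrier) (b b' b'' : B.carrier) :
      TRel A B
        (((d a b b').whiskerRight _).comp ((d a (b ⊗ b') b'').comp (l a (α_ b b' b'').hom)))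
        ((Arrow.assoc _ _ _).comp (((d a b' b'').whiskerLeft _).comp (d a b (b' ⊗ b''))))
  | δ_braid (a : A.carrier) (b b' : B.carrier) :
      TRel A B ((d a b b').comp (l a (β_ b b').hom)) ((Arrow.braid _ _).comp (d a b' b))
  | γ_assoc (a a' a'' : A.carrier) (b : B.carrier) :
      TRel A B
        (((c a a' b).whiskerRight _).comp ((c (a ⊗ a') a'' b).comp (r (α_ a a' a'').hom b)))
        ((Arrow.assoc _ _ _).comp (((c a' a'' b).whiskerLeft _).comp (c a (a' ⊗ a'') b)))
  | γ_braid (a a' : A.carrier) (b : B.carrier) :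
      TRel A B ((c a a' b).comp (r (β_ a a').hom b)) ((Arrow.braid _ _).comp (c a' a b))
  | γ_δ (a a' : A.carrier) (b b' : B.carrier) :
      TRel A B (((d a b b').tensor (d a' b b')).comp (c a a' (b ⊗ b')))
        ((Arrow.interchange _ _ _ _).comp
          (((c a a' b).tensor (c a a' b')).comp (d (a ⊗ a') b b')))

end

/-- The tensor product `A ⊗ B`. -/
def tensor (A B : SPC.{u}) : SPC.{u} := presented (TRel A B)

/-- The generating object `a ⊗ b`. -/
def tmk (a : A) (b : B) : tensor A B := ⟨.of (a, b)⟩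

/-- The class in `A ⊗ B` of a formal arrow. -/
abbrev tcls {X Y : Word (A.carrier × B.carrier)} (f : Arrow (TEdge A B) X Y) :
    (show tensor A B from ⟨X⟩) ⟶ (show tensor A B from ⟨Y⟩) := Presented.cls f

theorem tcls_sound {X Y : Word (A.carrier × B.carrier)} {f g : Arrow (TEdge A B) X Y}
    (h : TRel A B f g) : tcls f = tcls g := Presented.cls_sound (.of h)

/-- The arrow `a ⊗ g`. -/
def tl (a : A) {b b' : B} (g : b ⟶ b') : tmk a b ⟶ tmk a b' := tcls (.gen (.left a g))

/-- The arrow `f ⊗ b`. -/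
def tr {a a' : A} (f : a ⟶ a') (b : B) : tmk a b ⟶ tmk a' b := tcls (.gen (.right f b))

/-- The arrow `γ : (a ⊗ b) ⊗ (a' ⊗ b) ⟶ (a ⊗ a') ⊗ b`. -/
def tγ (a a' : A) (b : B) : tmk a b ⊗ tmk a' b ⟶ tmk (a ⊗ a') b := tcls (.gen (.γ a a' b))

/-- The arrow `δ : (a ⊗ b) ⊗ (a ⊗ b') ⟶ a ⊗ (b ⊗ b')`. -/
def tδ (a : A) (b b' : B) : tmk a b ⊗ tmk a b' ⟶ tmk a (b ⊗ b') := tcls (.gen (.δ a b b'))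

/-- The 1-cell `a ⊗ - : B ⟶ A ⊗ B`. -/
def ηObj (B : SPC.{u}) (a : A) : B ⟶ tensor A B :=
  mkHom
    { obj := fun b => tmk a b
      map := fun g => tl a g
      map_id := fun b => tcls_sound (TRel.left_id a b)
      map_comp := fun f g => tcls_sound (TRel.left_comp a f g) }
    (fun b b' => tδ a b b')
    (fun g b' => tcls_sound (TRel.δ_natural₂ a g b'))
    (fun b g => tcls_sound (TRel.δ_natural₃ a b g))
    (fun b b' b'' => tcls_sound (TRel.δ_assoc a b b' b''))
    (fun b b' => tcls_sound (TRel.δ_braid a b b'))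

/-- The 2-cell `f ⊗ -`. -/
def ηMap (B : SPC.{u}) {a a' : A} (f : a ⟶ a') : ηObj B a ⟶ ηObj B a' :=
  cell (F := ηObj B a) (G := ηObj B a') (fun b => tr f b)
    (fun g => (tcls_sound (TRel.exchange f g)).symm)
    (fun b b' => (tcls_sound (TRel.δ_natural₁ f b b')).symm)

theorem tγ_tδ (a a' : A) (b b' : B) :
    (tδ a b b' ⊗ₘ tδ a' b b') ≫ tγ a a' (b ⊗ b') =
      tensorμ (tmk a b) (tmk a b') (tmk a' b) (tmk a' b') ≫
        (tγ a a' b ⊗ₘ tγ a a' b') ≫ tδ (a ⊗ a') b b' :=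
  tcls_sound (TRel.γ_δ a a' b b')

/-- The 2-cell `γ_{a,a',-}`. -/
def ημ (B : SPC.{u}) (a a' : A) : add (ηObj B a) (ηObj B a') ⟶ ηObj B (a ⊗ a') :=
  cell (F := add (ηObj B a) (ηObj B a')) (G := ηObj B (a ⊗ a')) (fun b => tγ a a' b)
    (fun g => tcls_sound (TRel.γ_natural₃ a a' g))
    (fun b b' => by
      change (tensorμ (tmk a b) (tmk a' b) (tmk a b') (tmk a' b') ≫
        (tδ a b b' ⊗ₘ tδ a' b b')) ≫ tγ a a' (b ⊗ b') =
          (tγ a a' b ⊗ₘ tγ a a' b') ≫ tδ (a ⊗ a') b b'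
      rw [Category.assoc, tγ_tδ, ← Category.assoc, tensorμ_tensorμ, Category.id_comp])

/-- The universal 1-cell `η : A ⟶ [B, A ⊗ B]`, with `η(a)(b) = a ⊗ b`. -/
def η (A B : SPC.{u}) : A ⟶ ihom B (tensor A B) :=
  mkHom (B := ihom B (tensor A B))
    { obj := fun a => ηObj B a
      map := fun f => ηMap B f
      map_id := fun a => cell_ext fun b => tcls_sound (TRel.right_id a b)
      map_comp := fun f g => cell_ext fun b => tcls_sound (TRel.right_comp f g b) }
    (fun a a' => ημ B a a')
    (fun f a' => cell_ext fun b => by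
      change (tr f b ⊗ₘ 𝟙 (tmk _ b)) ≫ tγ _ a' b = _
      rw [tensorHom_id]
      exact tcls_sound (TRel.γ_natural₁ f a' b))
    (fun a f => cell_ext fun b => by
      change (𝟙 (tmk a b) ⊗ₘ tr f b) ≫ tγ a _ b = _
      rw [id_tensorHom]
      exact tcls_sound (TRel.γ_natural₂ a f b))
    (fun a a' a'' => cell_ext fun b => by
      change (tγ a a' b ⊗ₘ 𝟙 (tmk a'' b)) ≫ tγ (a ⊗ a') a'' b ≫ tr (α_ a a' a'').hom b =
        (α_ _ _ _).hom ≫ (𝟙 (tmk a b) ⊗ₘ tγ a' a'' b) ≫ tγ a (a' ⊗ a'') b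
      rw [id_tensorHom, tensorHom_id]
      exact tcls_sound (TRel.γ_assoc a a' a'' b))
    (fun a a' => cell_ext fun b => tcls_sound (TRel.γ_braid a a' b))

/-- Interpretation of the generating arrows in the target of a 1-cell `F : A ⟶ [B, C]`. -/
def enEdge (F : A ⟶ ihom B C) : ∀ {X Y : Word (A.carrier × B.carrier)}, TEdge A B X Y →
    (wordMap (C := C) (fun p => (val F p.1).obj p.2) X ⟶
      wordMap (C := C) (fun p => (val F p.1).obj p.2) Y)
  | _, _, .left a g => (val F a).map g
  | _, _, .right f b => app (valMap F f) b
  | _, _, .γ a a' b => appμ F a a' b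
  | _, _, .δ a b b' => μ (val F a).toFunctor b b'

theorem enEdge_rel (F : A ⟶ ihom B C) {X Y : Word (A.carrier × B.carrier)}
    {f g : Arrow (TEdge A B) X Y} (h : TRel A B f g) :
    arrowMap (C := C) (fun p => (val F p.1).obj p.2) (enEdge F) f =
      arrowMap (C := C) (fun p => (val F p.1).obj p.2) (enEdge F) g := by
  cases h with
  | left_comp a f g => exact (val F a).map_comp f g
  | right_comp f g b => exact congrArg (fun t => app t b) (F.map_comp f g)
  | left_id a b => exact (val F a).map_id b
  | right_id a b => exact congrArg (fun t => app t b) (F.map_id a)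
  | exchange f g => exact (app_naturality (valMap F f) g).symm
  | γ_natural₁ f a' b =>
      have h : (app (valMap F f) b ⊗ₘ 𝟙 _) ≫ appμ F _ a' b =
          appμ F _ a' b ≫ app (valMap F (f ▷ a')) b :=
        congrArg (fun t => app t b) (Functor.LaxMonoidal.μ_natural_left F.toFunctor f a')
      rw [tensorHom_id] at h
      exact h
  | γ_natural₂ a f b =>
      have h : (𝟙 _ ⊗ₘ app (valMap F f) b) ≫ appμ F a _ b =
          appμ F a _ b ≫ app (valMap F (a ◁ f)) b :=
        congrArg (fun t => app t b) (Functor.LaxMonoidal.μ_natural_right F.toFunctor a f)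
      rw [id_tensorHom] at h
      exact h
  | γ_natural₃ a a' g =>
      have h := appμ_natural F a a' g
      rw [MonoidalCategory.tensorHom_def] at h
      exact h
  | δ_natural₁ f b b' =>
      have h := app_tensor (valMap F f) b b'
      rw [MonoidalCategory.tensorHom_def] at h
      exact h.symm
  | δ_natural₂ a g b' => exact Functor.LaxMonoidal.μ_natural_left (val F a).toFunctor g b'
  | δ_natural₃ a b g => exact Functor.LaxMonoidal.μ_natural_right (val F a).toFunctor b g
  | δ_assoc a b b' b'' =>
      exact Functor.LaxMonoidal.associativity (F := (val F a).toFunctor) b b' b''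
  | δ_braid a b b' => exact Functor.LaxBraided.braided (F := (val F a).toFunctor) b b'
  | γ_assoc a a' a'' b =>
      have h : (appμ F a a' b ⊗ₘ 𝟙 _) ≫ appμ F (a ⊗ a') a'' b ≫
            app (valMap F (α_ a a' a'').hom) b =
          (α_ _ _ _).hom ≫ (𝟙 _ ⊗ₘ appμ F a' a'' b) ≫ appμ F a (a' ⊗ a'') b :=
        congrArg (fun t => app t b)
          (Functor.LaxMonoidal.associativity (F := F.toFunctor) a a' a'')
      rw [id_tensorHom, tensorHom_id] at h
      exact h
  | γ_braid a a' b =>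
      exact congrArg (fun t => app t b) (Functor.LaxBraided.braided (F := F.toFunctor) a a')
  | γ_δ a a' b b' =>
      have h := appμ_tensor F a a' b b'
      rw [← cancel_epi (tensorμ _ _ _ _), Category.assoc, ← Category.assoc (tensorμ _ _ _ _),
        tensorμ_tensorμ, Category.id_comp] at h
      rw [MonoidalCategory.tensorHom_def, MonoidalCategory.tensorHom_def (appμ F a a' b),
        tensorμ, ← IsIso.Iso.inv_hom, ← IsIso.Iso.inv_hom] at h
      exact h

/-- The strict 1-cell `En(F) : A ⊗ B ⟶ C` corresponding to `F : A ⟶ [B, C]`; it sends `a ⊗ b` to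
`F(a)(b)`. -/
def En (F : A ⟶ ihom B C) : tensor A B ⟶ C :=
  lift (TRel A B) (fun p => (val F p.1).obj p.2) (enEdge F) (enEdge_rel F)

/-- The 1-cell `Rn : [A ⊗ B, C] ⟶ [A, [B, C]]`, `G ↦ [1, G] ∘ η`. -/
def Rn (A B C : SPC.{u}) : ihom (tensor A B) C ⟶ ihom A (ihom B C) :=
  postHom B (tensor A B) C ≫ pre (η A B) (ihom B C)

/-- The strict 1-cell `F ⊗ G : A ⊗ B ⟶ C ⊗ D`, `a ⊗ b ↦ F(a) ⊗ G(b)`. -/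
def tensorMap (F : A ⟶ C) (G : B ⟶ D) : tensor A B ⟶ tensor C D :=
  En (F ≫ η C D ≫ pre G (tensor C D))

/-- The canonical strict 1-cell `(A ⊗ B) ⊗ C ⟶ A ⊗ (B ⊗ C)`, `(a ⊗ b) ⊗ c ↦ a ⊗ (b ⊗ c)`. -/
def assocHom (A B C : SPC.{u}) : tensor (tensor A B) C ⟶ tensor A (tensor B C) :=
  En (En (η A (tensor B C) ≫ Rn B C (tensor A (tensor B C))))

/-- The canonical 1-cell `A ⟶ A ⊗ I`, `a ↦ a ⊗ ⋆`. -/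
def rightHom (A : SPC.{u}) : A ⟶ tensor A I := η A I ≫ ev star (tensor A I)

/-- The canonical 1-cell `A ⟶ I ⊗ A`, `a ↦ ⋆ ⊗ a`. -/
def leftHom (A : SPC.{u}) : A ⟶ tensor I A := dualize (η I A) ≫ ev star (tensor I A)

/-- The strict 1-cell `L_A : I ⊗ A ⟶ A` corresponding to `v : I ⟶ [A, A]`. -/
def L (A : SPC.{u}) : tensor I A ⟶ A := En (v A)

end Tensor

section TwoRing

/-- A 2-cell is an identity. -/
def IsIdentity {A B : SPC.{u}} {F G : A ⟶ B} (t : F ⟶ G) : Prop :=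
  ∃ h : F = G, t = eqToHom h

/-- The data of a 2-ring, in terms of the internal hom. The multiplication `A ⟶ [A, A]` sends
`g` to the 1-cell `f ↦ g f`, the object `1` is the value of the unit at `⋆`. -/
structure TwoRingData (A : SPC.{u}) where
  mul : A ⟶ ihom A A
  unit : I ⟶ A
  unit_isStrict : IsStrict unit
  /-- The trilinear transformation `h (g f) ⟶ (h g) f`. -/
  assoc : mul ≫ postHom A A A ≫ pre mul (ihom A A) ⟶ mul ≫ post A mul
  /-- The linear transformation `f ⟶ f 1`. -/
  right : 𝟙 A ⟶ mul ≫ pre unit A ≫ ev star A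
  /-- The linear transformation `f ⟶ 1 f`. -/
  left : 𝟙 A ⟶ dualize mul ≫ pre unit A ≫ ev star A

namespace TwoRingData
variable {A : SPC.{u}} (R : TwoRingData A)

/-- The product `g f` of two objects. -/
def prod (g f : A) : A := (val R.mul g).obj f

/-- The unit object. -/
def one : A := R.unit.obj star

/-- The arrow `g t : g f ⟶ g f'` for `t : f ⟶ f'`. -/
def prodLeft (g : A) {f f' : A} (t : f ⟶ f') : R.prod g f ⟶ R.prod g f' := (val R.mul g).map t

/-- The arrow `t f : g f ⟶ g' f` for `t : g ⟶ g'`. -/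
def prodRight {g g' : A} (t : g ⟶ g') (f : A) : R.prod g f ⟶ R.prod g' f :=
  app (valMap R.mul t) f

/-- The component of the associativity transformation. -/
def assocApp (h g f : A) : R.prod h (R.prod g f) ⟶ R.prod (R.prod h g) f :=
  app (F := val R.mul g ≫ val R.mul h) (G := val R.mul (R.prod h g))
    (app (F := R.mul ≫ post A (val R.mul h)) (G := val R.mul h ≫ R.mul) (app R.assoc h) g) f

/-- The component of the right unit transformation. -/
def rightApp (f : A) : f ⟶ R.prod f R.one := app R.right f

/-- The component of the left unit transformation. -/
def leftApp (f : A) : f ⟶ R.prod R.one f := app R.left f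

end TwoRingData

/-- A 2-ring (one-object category enriched over symmetric Picard categories), in terms of the
internal hom. -/
structure TwoRing (A : SPC.{u}) extends TwoRingData A where
  /-- The pentagon from `k (h (g f))` to `((k h) g) f`. -/
  pentagon : ∀ k h g f : A,
    toTwoRingData.assocApp k h (toTwoRingData.prod g f) ≫
        toTwoRingData.assocApp (toTwoRingData.prod k h) g f =
      toTwoRingData.prodLeft k (toTwoRingData.assocApp h g f) ≫
        toTwoRingData.assocApp k (toTwoRingData.prod h g) f ≫
          toTwoRingData.prodRight (toTwoRingData.assocApp k h g) f
  /-- The triangle from `g f` to `(g 1) f`. -/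
  triangle : ∀ g f : A,
    toTwoRingData.prodLeft g (toTwoRingData.leftApp f) ≫
        toTwoRingData.assocApp g toTwoRingData.one f =
      toTwoRingData.prodRight (toTwoRingData.rightApp g) f

/-- A 2-ring is strict if its multiplication `A ⟶ [A, A]` is a strict arrow and its three
2-cells are identities. -/
structure TwoRing.IsStrict {A : SPC.{u}} (R : TwoRing A) : Prop where
  mul : SPC.IsStrict R.mul
  assoc : IsIdentity R.assoc
  right : IsIdentity R.right
  left : IsIdentity R.left

/-- The data of a 2-ring, in terms of the tensor product. -/
structure TensorTwoRingData (A : SPC.{u}) where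
  mul : tensor A A ⟶ A
  mul_isStrict : IsStrict mul
  unit : I ⟶ A
  unit_isStrict : IsStrict unit
  assoc : assocHom A A A ≫ tensorMap (𝟙 A) mul ≫ mul ⟶ tensorMap mul (𝟙 A) ≫ mul
  right : 𝟙 A ⟶ rightHom A ≫ tensorMap (𝟙 A) unit ≫ mul
  left : 𝟙 A ⟶ leftHom A ≫ tensorMap unit (𝟙 A) ≫ mul

namespace TensorTwoRingData
variable {A : SPC.{u}} (R : TensorTwoRingData A)

/-- The product `g f` of two objects. -/
def prod (g f : A) : A := R.mul.obj (tmk g f)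

/-- The unit object. -/
def one : A := R.unit.obj star

/-- The arrow `g t : g f ⟶ g f'` for `t : f ⟶ f'`. -/
def prodLeft (g : A) {f f' : A} (t : f ⟶ f') : R.prod g f ⟶ R.prod g f' := R.mul.map (tl g t)

/-- The arrow `t f : g f ⟶ g' f` for `t : g ⟶ g'`. -/
def prodRight {g g' : A} (t : g ⟶ g') (f : A) : R.prod g f ⟶ R.prod g' f := R.mul.map (tr t f)

/-- The component of the associativity 2-cell at `(h ⊗ g) ⊗ f`. -/
def assocApp (h g f : A) : R.prod h (R.prod g f) ⟶ R.prod (R.prod h g) f :=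
  app R.assoc (tmk (tmk h g) f)

/-- The component of the right unit 2-cell. -/
def rightApp (f : A) : f ⟶ R.prod f R.one := app R.right f

/-- The component of the left unit 2-cell. -/
def leftApp (f : A) : f ⟶ R.prod R.one f := app R.left f

end TensorTwoRingData

/-- A 2-ring, in terms of the tensor product. The coherence conditions are equalities of 2-cells
between strict arrows out of `((A ⊗ A) ⊗ A) ⊗ A` and `A ⊗ A`; they are stated on the generating
objects `((k ⊗ h) ⊗ g) ⊗ f` and `g ⊗ f`, whose components determine such 2-cells. -/
structure TensorTwoRing (A : SPC.{u}) extends TensorTwoRingData A where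
  pentagon : ∀ k h g f : A,
    toTensorTwoRingData.assocApp k h (toTensorTwoRingData.prod g f) ≫
        toTensorTwoRingData.assocApp (toTensorTwoRingData.prod k h) g f =
      toTensorTwoRingData.prodLeft k (toTensorTwoRingData.assocApp h g f) ≫
        toTensorTwoRingData.assocApp k (toTensorTwoRingData.prod h g) f ≫
          toTensorTwoRingData.prodRight (toTensorTwoRingData.assocApp k h g) f
  triangle : ∀ g f : A,
    toTensorTwoRingData.prodLeft g (toTensorTwoRingData.leftApp f) ≫
        toTensorTwoRingData.assocApp g toTensorTwoRingData.one f =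
      toTensorTwoRingData.prodRight (toTensorTwoRingData.rightApp g) f

/-- A 2-ring given through the tensor product is strict if the 1-cell `A ⟶ [A, A]`
corresponding to its multiplication is a strict arrow and its three 2-cells are identities. -/
structure TensorTwoRing.IsStrict {A : SPC.{u}} (R : TensorTwoRing A) : Prop where
  mul : SPC.IsStrict ((Rn A A A).obj R.mul : A ⟶ ihom A A)
  assoc : IsIdentity R.assoc
  right : IsIdentity R.right
  left : IsIdentity R.left

end TwoRing

end SPC

end

/-! All the 2-cells wanted are identities, so the content is a handful of equalities of 1-cells:
associativity and the two unit laws for `v I` (`v_assoc`, `v_right`, `v_left`) and for `L I`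
(`L_assoc`, `L_right`, `L_left`). The pentagon and the triangle then cost nothing: every arrow in
them is an `eqToHom`, and two parallel `eqToHom`s agree (`IsId.unique`).

Most of these equalities rest on freeness. Strict 1-cells out of a presented symmetric Picard
category are equal once they agree on generators (`IsStrict.presented_ext`); out of `I` this means
agreeing at `star` (`IsStrict.unit_ext`), and out of a tensor product it means having the same
transpose under `Rn` (`IsStrict.tensor_ext`). To use this, the 1-cells involved must be strict: `En
F`, `pre F C`, `ev a B` and `postHom A B C` always are, and `post A G` is when `G` is. The last case
is the delicate one, since duals in `ihom A B` are composites with `inv`; it needs that a strict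
1-cell commutes with `inv` (`dualHom_comp`).

In the hom form both sides of associativity take `star` to `v I`, because `v I` takes `star` to the
identity. The right unit law is also an evaluation at `star`; the left one holds because evaluating
a dual 1-cell at `star` gives back the value of the original there.

The tensor form is reduced to the hom form with `Rn(En(F)) = F` (`η_comp_post_En`), which gives
`Rn(L) = v`. Associativity is transposed twice, leaving two strict 1-cells out of `I`; at `star`
they are `Rn(L)` and `v`. The unit laws become those of the hom form, or the value of `v` at `star`.
-/

noncomputable section

namespace SPC

/-! ### Arrows that are identities up to an equality of their ends -/

section IdArrow
universe w₁ w₂ w₃ w₄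
variable {C : Type w₁} [Category.{w₂} C] {D : Type w₃} [Category.{w₄} D]

/-- An arrow is an identity, up to an equality of its ends. -/
def IsId {x y : C} (f : x ⟶ y) : Prop := ∃ h : x = y, f = eqToHom h

theorem isId_eqToHom {x y : C} (h : x = y) : IsId (eqToHom h) := ⟨h, rfl⟩

theorem isId_id (x : C) : IsId (𝟙 x) := ⟨rfl, rfl⟩

theorem IsId.comp {x y z : C} {f : x ⟶ y} {g : y ⟶ z} (hf : IsId f) (hg : IsId g) :
    IsId (f ≫ g) := by
  obtain ⟨rfl, rfl⟩ := hf
  obtain ⟨rfl, rfl⟩ := hg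
  exact ⟨rfl, by simp⟩

theorem IsId.map (F : C ⥤ D) {x y : C} {f : x ⟶ y} (hf : IsId f) : IsId (F.map f) := by
  obtain ⟨rfl, rfl⟩ := hf
  exact ⟨rfl, by simp⟩

theorem IsId.tensor [MonoidalCategory C] {x y z w : C} {f : x ⟶ y} {g : z ⟶ w}
    (hf : IsId f) (hg : IsId g) : IsId (f ⊗ₘ g) := by
  obtain ⟨rfl, rfl⟩ := hf
  obtain ⟨rfl, rfl⟩ := hg
  exact ⟨rfl, by simp⟩

/-- Equalities of objects are proof-irrelevant. This is the whole coherence argument for strict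
structures: a diagram made of such arrows commutes as soon as its ends match. -/
theorem IsId.unique {x y : C} {f g : x ⟶ y} (hf : IsId f) (hg : IsId g) : f = g := by
  obtain ⟨rfl, rfl⟩ := hf
  obtain ⟨_, rfl⟩ := hg
  rfl

theorem IsId.eq_id {x : C} {f : x ⟶ x} (hf : IsId f) : f = 𝟙 x := hf.unique (isId_id x)

end IdArrow

/-! ### Extensionality for 1-cells and 2-cells -/

section Ext
variable {A B C : SPC.{u}}

/-- No condition on the unit constraints is needed: objects of a Picard category can be cancelled,
so the tensor constraint determines the unit constraint. -/
theorem hom_ext_of_functor_eq {F G : A ⟶ B} (h : F.toFunctor = G.toFunctor)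
    (hμ : HEq (μ F.toFunctor) (μ G.toFunctor)) : F = G := by
  refine laxBraidedFunctor_ext h ?_ hμ
  obtain ⟨F, iF⟩ := F
  obtain ⟨G, iG⟩ := G
  dsimp only at h
  subst h
  -- The identity transformation respects the two tensor constraints, hence also the two unit
  -- constraints, which is their equality.
  have h1 := unit_of_tensor (F := (⟨F, iF⟩ : LaxBraidedFunctor A B))
    (G := (⟨F, iG⟩ : LaxBraidedFunctor A B)) (𝟙 F) (fun x y => by
      have h2 := congrFun (congrFun (eq_of_heq hμ) x) y
      dsimp only at h2 ⊢
      simp [h2])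
  exact heq_of_eq ((Category.comp_id _).symm.trans h1)

/-- 1-cells are determined by their functors and tensor constraints. -/
theorem hom_ext {F G : A ⟶ B} (hobj : ∀ x, F.obj x = G.obj x)
    (hmap : ∀ {x y : A} (f : x ⟶ y),
      F.map f ≫ eqToHom (hobj y) = eqToHom (hobj x) ≫ G.map f)
    (hμ : ∀ x y : A, μ F.toFunctor x y ≫ eqToHom (hobj _) =
      (eqToHom (hobj x) ⊗ₘ eqToHom (hobj y)) ≫ μ G.toFunctor x y) : F = G := by
  have h : F.toFunctor = G.toFunctor :=
    CategoryTheory.Functor.ext hobj (fun x y f => by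
      rw [← reassoc_of% (hmap f)]; simp)
  refine hom_ext_of_functor_eq h ?_
  obtain ⟨F, iF⟩ := F
  obtain ⟨G, iG⟩ := G
  dsimp only at h
  subst h
  apply heq_of_eq
  funext x y
  have h1 := hμ x y
  simpa using h1

theorem IsId.app {F G : A ⟶ B} {t : F ⟶ G} (h : IsId t) (x : A) : IsId (app t x) := by
  obtain ⟨rfl, rfl⟩ := h
  exact ⟨rfl, rfl⟩

theorem app_eqToHom {F G : A ⟶ B} (h : F = G) (x : A) :
    app (eqToHom h) x = eqToHom (congrArg (fun K : A ⟶ B => K.obj x) h) := by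
  subst h
  rfl

/-- A 2-cell is an identity if its components are. -/
theorem isId_of_app {F G : A ⟶ B} {t : F ⟶ G} (h : ∀ x, IsId (SPC.app t x)) : IsId t := by
  -- Since the components are `eqToHom`s, naturality and monoidality of `t` are exactly the
  -- hypotheses of `hom_ext`.
  have e : F = G := by
    choose p hp using h
    refine hom_ext p (fun {x y} f => ?_) (fun x y => ?_)
    · rw [← hp, ← hp]; exact app_naturality t f
    · rw [← hp, ← hp, ← hp]; exact app_tensor t x y
  subst e
  exact ⟨rfl, cell_ext fun x => (h x).eq_id⟩

/-- A device for proving equalities of 1-cells: build a 2-cell by ordinary diagram chasing, then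
observe that its components are identities. -/
theorem eq_of_isId {F G : A ⟶ B} (t : F ⟶ G) (h : ∀ x, IsId (SPC.app t x)) : F = G :=
  (isId_of_app h).choose

theorem isId_cell {F G : A ⟶ ihom B C} {t : F ⟶ G}
    (h : ∀ x y, IsId (SPC.app (F := val F x) (G := val G x) (SPC.app t x) y)) : IsId t :=
  isId_of_app fun x => isId_of_app (h x)

end Ext

/-! ### Strict 1-cells, and the pointwise nature of duals in the internal hom -/

section Strict
variable {A B C D : SPC.{u}}

/-- Strictness in terms of a comparison of the chosen duals. -/
theorem IsStrict.of_comparison {F : A ⟶ B} (hε : IsId (ε F.toFunctor))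
    (hμ : ∀ x y, IsId (μ F.toFunctor x y))
    (d : ∀ x : A, B.dual (F.obj x) ⟶ F.obj (A.dual x)) (hd : ∀ x, IsId (d x))
    (h : ∀ x, B.j (F.obj x) ≫ d x ▷ F.obj x ≫ μ F.toFunctor (A.dual x) x =
      ε F.toFunctor ≫ F.map (A.j x)) : IsStrict F where
  obj_unit := hε.choose.symm
  obj_tensor x y := (hμ x y).choose.symm
  obj_dual x := (hd x).choose.symm
  unit_eq := hε.choose_spec
  tensor_eq x y := (hμ x y).choose_spec
  map_j x := by
    -- A commutative square with two opposite identity sides can be solved for a third side by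
    -- conjugating the fourth; stated for free objects so that the equalities can be substituted.
    have e : ∀ {u v w w' : B} (m : u ⟶ v) (hm : IsId m) (k : v ⟶ w) (l : u ⟶ w') (n : w' ⟶ w)
        (hn : IsId n) (_ : l ≫ n = m ≫ k), k = eqToHom hm.choose.symm ≫ l ≫ eqToHom hn.choose := by
      intro u v w w' m hm k l n hn h
      obtain ⟨rfl, rfl⟩ := hm
      obtain ⟨rfl, rfl⟩ := hn
      simpa using h.symm
    refine e _ hε _ _ (d x ▷ F.obj x ≫ μ F.toFunctor (A.dual x) x) ?_ (h x)
    refine IsId.comp ?_ (hμ _ _)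
    rw [← tensorHom_id]
    exact (hd x).tensor (isId_id _)

namespace IsStrict
variable {F : A ⟶ B} (hF : IsStrict F)
include hF

theorem isId_ε : IsId (ε F.toFunctor) := ⟨_, hF.unit_eq⟩

theorem isId_μ (x y : A) : IsId (μ F.toFunctor x y) := ⟨_, hF.tensor_eq x y⟩

/-- Converse to `IsStrict.of_comparison`. The `eqToHom`s of `map_j` are gathered into one arrow
between duals, the constraints of `F` taking up the rest, which gives a diagram suited to chasing.
-/
theorem comparison (x : A) :
    B.j (F.obj x) ≫ eqToHom (hF.obj_dual x).symm ▷ F.obj x ≫ μ F.toFunctor (A.dual x) x =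
      ε F.toFunctor ≫ F.map (A.j x) := by
  have e : ∀ {a b : B} (h : a = b) (c : B),
      eqToHom h ▷ c = eqToHom (congrArg (fun t => t ⊗ c) h) := by
    rintro a _ rfl c
    simp
  rw [hF.map_j, hF.tensor_eq, hF.unit_eq, e]
  simp

end IsStrict

theorem isStrict_id (A : SPC.{u}) : IsStrict (𝟙 A) :=
  .of_comparison (isId_id _) (fun _ _ => isId_id _) (fun _ => 𝟙 _) (fun _ => isId_id _) (fun x => by
    change A.j x ≫ 𝟙 (A.dual x) ▷ x ≫ 𝟙 _ = 𝟙 _ ≫ A.j x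
    simp)

theorem IsStrict.comp {F : A ⟶ B} {G : B ⟶ C} (hF : IsStrict F) (hG : IsStrict G) :
    IsStrict (F ≫ G) := by
  refine .of_comparison (hG.isId_ε.comp (hF.isId_ε.map G.toFunctor))
    (fun x y => (hG.isId_μ _ _).comp ((hF.isId_μ x y).map G.toFunctor))
    (fun x => eqToHom (hG.obj_dual (F.obj x)).symm ≫ G.map (eqToHom (hF.obj_dual x).symm))
    (fun x => (isId_eqToHom _).comp ((isId_eqToHom _).map G.toFunctor)) (fun x => ?_)
  change C.j (G.obj (F.obj x)) ≫
    (eqToHom (hG.obj_dual (F.obj x)).symm ≫ G.map (eqToHom (hF.obj_dual x).symm)) ▷ G.obj (F.obj x) ≫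
      μ G.toFunctor (F.obj (A.dual x)) (F.obj x) ≫ G.map (μ F.toFunctor (A.dual x) x) =
    (ε G.toFunctor ≫ G.map (ε F.toFunctor)) ≫ G.map (F.map (A.j x))
  rw [comp_whiskerRight, Category.assoc, Functor.LaxMonoidal.μ_natural_left_assoc,
    reassoc_of% (hG.comparison (F.obj x)), Category.assoc, ← G.map_comp, ← G.map_comp, ← G.map_comp,
    hF.comparison]

/-- Strict 1-cells commute with `inv`. -/
theorem dualHom_comp {G : A ⟶ B} (hG : IsStrict G) : G ≫ dualHom B = dualHom A ≫ G := by
  have hk := hG.comparison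
  have hkd : ∀ x, IsId (eqToHom (hG.obj_dual x).symm) := fun x => isId_eqToHom _
  -- Only two facts about the comparison of duals are kept: it is compatible with `j`, and it is an
  -- identity. The first makes it a 2-cell, and the second turns that 2-cell into an equality.
  generalize hK : (fun x => eqToHom (hG.obj_dual x).symm) = k at *
  replace hk : ∀ x, B.j (G.obj x) ≫ k x ▷ G.obj x ≫ μ G.toFunctor (A.dual x) x =
      ε G.toFunctor ≫ G.map (A.j x) := by subst hK; exact hk
  replace hkd : ∀ x, IsId (k x) := by subst hK; exact hkd
  clear hK
  refine eq_of_isId (cell (F := G ≫ dualHom B) (G := dualHom A ≫ G) k ?_ ?_) hkd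
  · intro x y f
    change dualMap (G.map f) ≫ k y = k x ≫ G.map (dualMap f)
    -- An arrow out of a dual is determined by what it does to `j`; on both sides this is the image
    -- under `G` of `A.j y`, up to the constraints.
    apply tensor_cancel (B.j (G.obj x)) (G.map f)
    rw [← cancel_mono (μ G.toFunctor (A.dual y) y)]
    have h1 : ((dualMap (G.map f) ≫ k y) ⊗ₘ G.map f) =
        (dualMap (G.map f) ⊗ₘ G.map f) ≫ k y ▷ G.obj y := by
      rw [← tensorHom_id, tensorHom_comp_tensorHom, Category.comp_id]
    have h2 : ((k x ≫ G.map (dualMap f)) ⊗ₘ G.map f) =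
        k x ▷ G.obj x ≫ (G.map (dualMap f) ⊗ₘ G.map f) := by
      rw [← tensorHom_id, tensorHom_comp_tensorHom, Category.id_comp]
    rw [h1, h2]
    simp only [Category.assoc]
    rw [j_dualMap_assoc, hk, Functor.LaxMonoidal.μ_natural, reassoc_of% (hk x), ← G.map_comp,
      j_dualMap]
  · intro x y
    change (dualμ (G.obj x) (G.obj y) ≫ dualMap (μ G.toFunctor x y)) ≫ k (x ⊗ y) =
      (k x ⊗ₘ k y) ≫ μ G.toFunctor (A.dual x) (A.dual y) ≫ G.map (dualμ x y)
    -- The same cancellation for a tensor product of two duals, with `jj` in the role of `j`.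
    apply tensor_cancel (jj (G.obj x) (G.obj y)) (μ G.toFunctor x y)
    rw [← cancel_mono (μ G.toFunctor (A.dual (x ⊗ y)) (x ⊗ y))]
    have h1 : (((dualμ (G.obj x) (G.obj y) ≫ dualMap (μ G.toFunctor x y)) ≫ k (x ⊗ y)) ⊗ₘ
        μ G.toFunctor x y) = dualμ (G.obj x) (G.obj y) ▷ _ ≫
          (dualMap (μ G.toFunctor x y) ⊗ₘ μ G.toFunctor x y) ≫ k (x ⊗ y) ▷ _ := by
      simp only [← tensorHom_id, tensorHom_comp_tensorHom, Category.comp_id, Category.id_comp,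
        Category.assoc]
    have h2 : (((k x ⊗ₘ k y) ≫ μ G.toFunctor (A.dual x) (A.dual y) ≫ G.map (dualμ x y)) ⊗ₘ
        μ G.toFunctor x y) = ((k x ⊗ₘ k y) ⊗ₘ (𝟙 _ ⊗ₘ 𝟙 _)) ≫
          (μ G.toFunctor (A.dual x) (A.dual y) ⊗ₘ μ G.toFunctor x y) ≫
            G.map (dualμ x y) ▷ _ := by
      simp only [← tensorHom_id, tensorHom_comp_tensorHom, Category.comp_id, Category.id_comp,
        id_tensorHom_id]
    rw [h1, h2]
    simp only [Category.assoc]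
    rw [jj_dualμ_assoc, j_dualMap_assoc, hk, Functor.LaxMonoidal.μ_natural_left, jj]
    simp only [Category.assoc]
    rw [← tensorμ_natural_assoc, reassoc_of% (tensorμ_comp_μ_tensorHom_μ_comp_μ G.toFunctor),
      tensorHom_comp_tensorHom_assoc, tensorHom_comp_tensorHom_assoc]
    simp only [tensorHom_id, Category.assoc, hk]
    rw [← tensorHom_comp_tensorHom, Category.assoc, Functor.LaxMonoidal.μ_natural_assoc]
    -- The two uses of `hk` leave one `ε` per tensor factor; unitality merges them into a single
    -- one, after which the rest is the image under `G` of `jj_dualμ`.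
    have h3 : (λ_ (𝟙_ B)).inv ≫ (ε G.toFunctor ⊗ₘ ε G.toFunctor) ≫ μ G.toFunctor _ _ =
        ε G.toFunctor ≫ G.map (λ_ (𝟙_ A)).inv := by
      rw [Iso.inv_comp_eq, MonoidalCategory.tensorHom_def', Category.assoc,
        ← leftUnitor_naturality_assoc, Functor.LaxMonoidal.left_unitality]
      simp [← G.map_comp]
    rw [reassoc_of% h3, ← jj_dualμ]
    simp only [← G.map_comp, jj, Category.assoc]

/-- In `ihom A B` the arrow `dualMap t` is obtained by cancellation, so its components are not
visible by definition. They satisfy the equation that characterizes `dualMap (app t x)`, namely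
`j_dualMap` evaluated at `x`. -/
theorem app_dualMap {F G : A ⟶ B} (t : F ⟶ G) (x : A) :
    app (F := F ≫ dualHom B) (G := G ≫ dualHom B) (dualMap (A := ihom A B) t) x =
      dualMap (app t x) :=
  dualMap_unique _ _
    (congrArg (fun s => app (F := zero A B) (G := add (G ≫ dualHom B) G) s x)
      (j_dualMap (A := ihom A B) t))

theorem app_jj (F G : A ⟶ B) (x : A) :
    app (F := zero A B) (G := add (add (F ≫ dualHom B) (G ≫ dualHom B)) (add F G))
      (jj (A := ihom A B) F G) x = jj (F.obj x) (G.obj x) := by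
  have h := app_tensorμ (F ≫ dualHom B) F (G ≫ dualHom B) G x
  exact congrArg (fun s => (λ_ (𝟙_ B)).inv ≫ (B.j (F.obj x) ⊗ₘ B.j (G.obj x)) ≫ s) h

theorem dualμ_unique {a b : A} (m : A.dual a ⊗ A.dual b ⟶ A.dual (a ⊗ b))
    (h : jj a b ≫ (m ⊗ₘ 𝟙 (a ⊗ b)) = A.j (a ⊗ b)) : m = dualμ a b := by
  refine tensor_cancel (jj a b) (𝟙 (a ⊗ b)) (h.trans ?_)
  rw [tensorHom_id, jj_dualμ]

/-- Same reason as for `app_dualMap`: evaluate the defining equation `jj_dualμ` at `x` and use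
uniqueness, `jj` itself being pointwise. -/
theorem app_dualμ (F G : A ⟶ B) (x : A) :
    app (F := add (F ≫ dualHom B) (G ≫ dualHom B)) (G := add F G ≫ dualHom B)
      (dualμ (A := ihom A B) F G) x = dualμ (F.obj x) (G.obj x) := by
  have h := congrArg (fun s => app (F := zero A B) (G := add (add F G ≫ dualHom B) (add F G)) s x)
    (jj_dualμ (A := ihom A B) F G)
  exact dualμ_unique _ ((congrArg (fun s => s ≫ (app (F := add (F ≫ dualHom B) (G ≫ dualHom B))
    (G := add F G ≫ dualHom B) (dualμ (A := ihom A B) F G) x ⊗ₘ 𝟙 (F.obj x ⊗ G.obj x)))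
      (app_jj F G x).symm).trans h)

end Strict

/-! ### Strictness and strict functoriality of the internal hom -/

section Post
variable {A B C D : SPC.{u}}

theorem isStrict_ev (a : A) (B : SPC.{u}) : IsStrict (ev a B) :=
  .of_comparison (isId_id _) (fun _ _ => isId_id _) (fun (F : A ⟶ B) => 𝟙 (B.dual (F.obj a)))
    (fun _ => isId_id _) (fun (F : A ⟶ B) => by
      change B.j (F.obj a) ≫ 𝟙 (B.dual (F.obj a)) ▷ F.obj a ≫ 𝟙 _ = 𝟙 _ ≫ B.j (F.obj a)
      simp)

/-- Precomposition reindexes a pointwise structure, so its constraints have identity components, and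
the two candidates for the dual of `F ≫ G` differ by the associativity of composition. No condition
on `F` is needed. -/
theorem isStrict_pre (F : A ⟶ B) (C : SPC.{u}) : IsStrict (pre F C) := by
  refine .of_comparison (isId_of_app (F := zero A C) (G := F ≫ zero B C) (fun _ => isId_id _))
    (fun (G G' : B ⟶ C) => isId_of_app (F := add (F ≫ G) (F ≫ G')) (G := F ≫ add G G')
      (fun _ => isId_id _))
    (fun (G : B ⟶ C) => eqToHom (Category.assoc F G (dualHom C))) (fun _ => isId_eqToHom _)
    (fun (G : B ⟶ C) => cell_ext (F := zero A C) (G := F ≫ add (G ≫ dualHom C) G) fun x => ?_)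
  change C.j (G.obj (F.obj x)) ≫ (app (eqToHom (Category.assoc F G (dualHom C))) x ⊗ₘ 𝟙 _) ≫ 𝟙 _ =
    𝟙 _ ≫ C.j (G.obj (F.obj x))
  rw [app_eqToHom]
  -- The category law behind this `eqToHom` holds definitionally on objects, so its component is an
  -- identity arrow by definition.
  change C.j (G.obj (F.obj x)) ≫ (𝟙 (C.dual (G.obj (F.obj x))) ⊗ₘ 𝟙 (G.obj (F.obj x))) ≫ 𝟙 _ =
    𝟙 _ ≫ C.j (G.obj (F.obj x))
  simp

/-- Preservation of duals asks that `inv` may be applied before or after `G`, which is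
`dualHom_comp`; the other conditions are those of `G` at each object. -/
theorem isStrict_post (A : SPC.{u}) {G : B ⟶ C} (hG : IsStrict G) : IsStrict (post A G) := by
  have e (F : A ⟶ B) : (F ≫ G) ≫ dualHom C = (F ≫ dualHom B) ≫ G := by
    rw [Category.assoc, Category.assoc, dualHom_comp hG]
  refine .of_comparison (isId_of_app (F := zero A C) (G := zero A B ≫ G) (fun _ => hG.isId_ε))
    (fun (F F' : A ⟶ B) => isId_of_app (F := add (F ≫ G) (F' ≫ G)) (G := add F F' ≫ G)
      (fun _ => hG.isId_μ _ _))
    (fun (F : A ⟶ B) => eqToHom (e F)) (fun _ => isId_eqToHom _)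
    (fun (F : A ⟶ B) => cell_ext (F := zero A C) (G := add (F ≫ dualHom B) F ≫ G) fun x => ?_)
  change C.j (G.obj (F.obj x)) ≫ (app (eqToHom (e F)) x ⊗ₘ 𝟙 (G.obj (F.obj x))) ≫
      μ G.toFunctor (B.dual (F.obj x)) (F.obj x) = ε G.toFunctor ≫ G.map (B.j (F.obj x))
  rw [app_eqToHom]
  change C.j (G.obj (F.obj x)) ≫ (eqToHom (hG.obj_dual (F.obj x)).symm ⊗ₘ 𝟙 _) ≫ _ = _
  rw [tensorHom_id]
  exact hG.comparison (F.obj x)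

/-- The dual of `post A G` is formed with `inv` of `ihom A C`, whereas `post A (G ≫ dualHom C)` uses
`inv` of `C` pointwise. That these agree, on arrows and on tensor constraints, is `app_dualMap` and
`app_dualμ`; no strictness of `G` enters. -/
theorem isStrict_postHom (A B C : SPC.{u}) : IsStrict (postHom A B C) := by
  refine .of_comparison
    (isId_cell (F := zero (ihom A B) (ihom A C)) (G := post A (zero B C))
      (fun _ _ => isId_id _))
    (fun (G G' : B ⟶ C) => isId_cell (F := add (post A G) (post A G')) (G := post A (add G G'))
      (fun _ _ => isId_id _))
    (fun (G : B ⟶ C) => cell (F := post A G ≫ dualHom (ihom A C)) (G := post A (G ≫ dualHom C))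
      (fun (F : A ⟶ B) => eqToHom (Category.assoc F G (dualHom C)))
      (fun {F F' : A ⟶ B} (s : F ⟶ F') => cell_ext (F := (F ≫ G) ≫ dualHom C) (G := F' ≫ G ≫ dualHom C) fun x => ?_)
      (fun (F F' : A ⟶ B) => cell_ext
        (F := add ((F ≫ G) ≫ dualHom C) ((F' ≫ G) ≫ dualHom C))
        (G := add F F' ≫ G ≫ dualHom C) fun x => ?_))
    (fun (G : B ⟶ C) => isId_of_app (F := post A G ≫ dualHom (ihom A C))
      (G := post A (G ≫ dualHom C)) fun (F : A ⟶ B) =>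
        isId_eqToHom (Category.assoc F G (dualHom C)))
    (fun (G : B ⟶ C) => cell_ext (F := zero (ihom A B) (ihom A C))
      (G := post A (add (G ≫ dualHom C) G)) fun (F : A ⟶ B) =>
        cell_ext (F := zero A C) (G := F ≫ add (G ≫ dualHom C) G) fun x => ?_)
  · change app (F := (F ≫ G) ≫ dualHom C) (G := (F' ≫ G) ≫ dualHom C)
        (dualMap (A := ihom A C) (whiskerRight s G)) x ≫
          app (eqToHom (Category.assoc F' G (dualHom C))) x =
      app (eqToHom (Category.assoc F G (dualHom C))) x ≫ dualMap (G.map (app s x))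
    rw [app_eqToHom, app_eqToHom, app_dualMap (whiskerRight s G) x]
    exact (Category.comp_id _).trans (Category.id_comp _).symm
  -- The tensor constraint of `post A G ≫ dualHom (ihom A C)` is a `dualμ` followed by a `dualMap`
  -- in `ihom A C`, and each factor is evaluated separately.
  · have h₁ := app_dualμ (F ≫ G) (F' ≫ G) x
    have h₂ := app_dualMap (μ (post A G).toFunctor F F' : add (F ≫ G) (F' ≫ G) ⟶ add F F' ≫ G) x
    refine (congrArg (fun s => s ≫ app (eqToHom (Category.assoc (add F F') G (dualHom C))) x)
      (congrArg₂ (fun s t => s ≫ t) h₁ h₂)).trans ?_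
    change _ = (app (eqToHom (Category.assoc F G (dualHom C))) x ⊗ₘ
      app (eqToHom (Category.assoc F' G (dualHom C))) x) ≫
        dualμ (G.obj (F.obj x)) (G.obj (F'.obj x)) ≫
          dualMap (μ G.toFunctor (F.obj x) (F'.obj x))
    rw [app_eqToHom, app_eqToHom, app_eqToHom]
    refine (Category.comp_id _).trans ?_
    change _ = (𝟙 (C.dual (G.obj (F.obj x))) ⊗ₘ 𝟙 (C.dual (G.obj (F'.obj x)))) ≫ _
    rw [id_tensorHom_id]
    exact (Category.id_comp _).symm
  · change C.j (G.obj (F.obj x)) ≫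
        (app (eqToHom (Category.assoc F G (dualHom C))) x ⊗ₘ 𝟙 _) ≫ 𝟙 _ =
          𝟙 _ ≫ C.j (G.obj (F.obj x))
    rw [app_eqToHom]
    change C.j (G.obj (F.obj x)) ≫ (𝟙 (C.dual (G.obj (F.obj x))) ⊗ₘ 𝟙 (G.obj (F.obj x))) ≫ 𝟙 _ = _
    simp

/-- This and the next three lemmas are the strict bifunctoriality of the internal hom that is used
below. On objects each is a law of the category of 1-cells; on arrows and constraints the components
agree up to identities. -/
theorem post_id (A B : SPC.{u}) : post A (𝟙 B) = 𝟙 (ihom A B) := by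
  refine hom_ext (fun (F : A ⟶ B) => Category.comp_id F)
    (fun {F F' : A ⟶ B} (f : F ⟶ F') => cell_ext (F := F ≫ 𝟙 B) (G := F') fun x => ?_)
    (fun (F F' : A ⟶ B) => cell_ext (F := add (F ≫ 𝟙 B) (F' ≫ 𝟙 B)) (G := add F F') fun x => ?_)
  · change app (whiskerRight f (𝟙 B)) x ≫ app (eqToHom (Category.comp_id F')) x =
      app (eqToHom (Category.comp_id F)) x ≫ app f x
    rw [app_eqToHom, app_eqToHom]
    exact (Category.comp_id _).trans (Category.id_comp _).symm
  · change 𝟙 _ ≫ app (eqToHom (Category.comp_id (add F F'))) x =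
      (app (eqToHom (Category.comp_id F)) x ⊗ₘ app (eqToHom (Category.comp_id F')) x) ≫ 𝟙 _
    rw [app_eqToHom, app_eqToHom, app_eqToHom]
    change 𝟙 _ ≫ 𝟙 _ = (𝟙 (F.obj x) ⊗ₘ 𝟙 (F'.obj x)) ≫ 𝟙 _
    simp

theorem pre_id (A C : SPC.{u}) : pre (𝟙 A) C = 𝟙 (ihom A C) := by
  refine hom_ext (fun (F : A ⟶ C) => Category.id_comp F)
    (fun {F F' : A ⟶ C} (f : F ⟶ F') => cell_ext (F := 𝟙 A ≫ F) (G := F') fun x => ?_)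
    (fun (F F' : A ⟶ C) => cell_ext (F := add (𝟙 A ≫ F) (𝟙 A ≫ F')) (G := add F F') fun x => ?_)
  · change app f x ≫ app (eqToHom (Category.id_comp F')) x =
      app (eqToHom (Category.id_comp F)) x ≫ app f x
    rw [app_eqToHom, app_eqToHom]
    exact (Category.comp_id _).trans (Category.id_comp _).symm
  · change 𝟙 _ ≫ app (eqToHom (Category.id_comp (add F F'))) x =
      (app (eqToHom (Category.id_comp F)) x ⊗ₘ app (eqToHom (Category.id_comp F')) x) ≫ 𝟙 _
    rw [app_eqToHom, app_eqToHom, app_eqToHom]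
    change 𝟙 _ ≫ 𝟙 _ = (𝟙 (F.obj x) ⊗ₘ 𝟙 (F'.obj x)) ≫ 𝟙 _
    simp

theorem post_comp (A : SPC.{u}) (G : B ⟶ C) (H : C ⟶ D) :
    post A (G ≫ H) = post A G ≫ post A H := by
  refine hom_ext (fun (F : A ⟶ B) => (Category.assoc F G H).symm)
    (fun {F F' : A ⟶ B} (f : F ⟶ F') => cell_ext (F := F ≫ G ≫ H) (G := (F' ≫ G) ≫ H) fun x => ?_)
    (fun (F F' : A ⟶ B) => cell_ext (F := add (F ≫ G ≫ H) (F' ≫ G ≫ H))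
      (G := (add F F' ≫ G) ≫ H) fun x => ?_)
  · change H.map (G.map (app f x)) ≫ app (eqToHom (Category.assoc F' G H).symm) x =
      app (eqToHom (Category.assoc F G H).symm) x ≫ H.map (G.map (app f x))
    rw [app_eqToHom, app_eqToHom]
    exact (Category.comp_id _).trans (Category.id_comp _).symm
  · change μ (G ≫ H).toFunctor (F.obj x) (F'.obj x) ≫
        app (eqToHom (Category.assoc (add F F') G H).symm) x =
      (app (eqToHom (Category.assoc F G H).symm) x ⊗ₘ
        app (eqToHom (Category.assoc F' G H).symm) x) ≫ μ (G ≫ H).toFunctor (F.obj x) (F'.obj x)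
    rw [app_eqToHom, app_eqToHom, app_eqToHom]
    refine (Category.comp_id _).trans ?_
    change _ = (𝟙 (H.obj (G.obj (F.obj x))) ⊗ₘ 𝟙 (H.obj (G.obj (F'.obj x)))) ≫ _
    simp

theorem pre_post (F : A ⟶ B) (G : C ⟶ D) : pre F C ≫ post A G = post B G ≫ pre F D := by
  refine hom_ext (fun (K : B ⟶ C) => Category.assoc F K G)
    (fun {K K' : B ⟶ C} (f : K ⟶ K') => cell_ext (F := (F ≫ K) ≫ G) (G := F ≫ K' ≫ G) fun x => ?_)
    (fun (K K' : B ⟶ C) => cell_ext (F := add ((F ≫ K) ≫ G) ((F ≫ K') ≫ G))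
      (G := F ≫ add K K' ≫ G) fun x => ?_)
  · change G.map (app f (F.obj x)) ≫ app (eqToHom (Category.assoc F K' G)) x =
      app (eqToHom (Category.assoc F K G)) x ≫ G.map (app f (F.obj x))
    rw [app_eqToHom, app_eqToHom]
    exact (Category.comp_id _).trans (Category.id_comp _).symm
  · change (μ G.toFunctor (K.obj (F.obj x)) (K'.obj (F.obj x)) ≫ G.map (𝟙 _)) ≫
        app (eqToHom (Category.assoc F (add K K') G)) x =
      (app (eqToHom (Category.assoc F K G)) x ⊗ₘ
        app (eqToHom (Category.assoc F K' G)) x) ≫ 𝟙 _ ≫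
          μ G.toFunctor (K.obj (F.obj x)) (K'.obj (F.obj x))
    rw [app_eqToHom, app_eqToHom, app_eqToHom]
    refine (Category.comp_id _).trans ?_
    change _ = (𝟙 (G.obj (K.obj (F.obj x))) ⊗ₘ 𝟙 (G.obj (K'.obj (F.obj x)))) ≫ _
    simp

/-- Naturality of evaluation. It brings a 1-cell that follows `η ≫ ev star` next to `η`, where the
formulas for transposes apply. -/
theorem ev_comp (a : A) (G : B ⟶ C) : ev a B ≫ G = post A G ≫ ev a C := by
  refine hom_ext (fun _ => rfl) (fun {F F'} (f : F ⟶ F') => ?_) (fun (F F' : A ⟶ B) => ?_)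
  · exact (Category.comp_id _).trans (Category.id_comp _).symm
  · change (μ G.toFunctor (F.obj a) (F'.obj a) ≫ G.map (𝟙 _)) ≫ 𝟙 _ =
      (𝟙 (G.obj (F.obj a)) ⊗ₘ 𝟙 (G.obj (F'.obj a))) ≫ 𝟙 _ ≫ μ G.toFunctor (F.obj a) (F'.obj a)
    simp

/-- Dualizing exchanges the two arguments, so fixing the second argument of the dual recovers a
value of `F`. The left unit laws are settled this way, without asking whether `dualize F` is strict.
-/
theorem dualize_comp_ev (F : A ⟶ ihom B C) (a : A) : dualize F ≫ ev a C = val F a := by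
  refine hom_ext (fun _ => rfl) (fun f => ?_) (fun x y => ?_)
  · exact (Category.comp_id _).trans (Category.id_comp _).symm
  · change (𝟙 _ ≫ μ (val F a).toFunctor x y) ≫ 𝟙 _ =
      (𝟙 ((val F a).obj x) ⊗ₘ 𝟙 ((val F a).obj y)) ≫ μ (val F a).toFunctor x y
    simp

end Post

/-! ### Arrows on which a comparison of two 1-cells is natural -/

theorem j_eqToHom {C : SPC.{u}} {a b : C} (h : a = b) :
    C.j a ≫ (eqToHom (congrArg C.dual h) ⊗ₘ eqToHom h) = C.j b := by
  subst h
  simp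

section Compare
variable {A C : SPC.{u}} {F G : A ⟶ C} (t : ∀ x : A, F.obj x ⟶ G.obj x)

/-- The arrows on which the family `t` is natural are closed under the groupoid operations and, when
`t` respects the constraints, under whiskering; they then contain the structural arrows too. These
lemmas are the cases of the induction over formal arrows in `IsStrict.presented_ext`. -/
theorem compare_id (x : A) : F.map (𝟙 x) ≫ t x = t x ≫ G.map (𝟙 x) := by
  rw [F.map_id, G.map_id, Category.id_comp, Category.comp_id]

theorem compare_comp {x y z : A} (f : x ⟶ y) (g : y ⟶ z) (hf : F.map f ≫ t y = t x ≫ G.map f)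
    (hg : F.map g ≫ t z = t y ≫ G.map g) : F.map (f ≫ g) ≫ t z = t x ≫ G.map (f ≫ g) := by
  rw [F.map_comp, G.map_comp, Category.assoc, hg, reassoc_of% hf]

theorem compare_inv {x y : A} (f : x ⟶ y) (hf : F.map f ≫ t y = t x ≫ G.map f) :
    F.map (inv f) ≫ t x = t y ≫ G.map (inv f) := by
  rw [← cancel_epi (F.map f), ← F.map_comp_assoc, reassoc_of% hf, ← G.map_comp]
  simp

variable (tensor : ∀ x y : A, μ F.toFunctor x y ≫ t (x ⊗ y) = (t x ⊗ₘ t y) ≫ μ G.toFunctor x y)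
include tensor

/-- The constraint of `F` is invertible, so naturality may be tested after composing with it, where
`F.map (x ◁ f)` becomes a whiskering by `F.obj x`. The structural arrows below are treated in the
same way. -/
theorem compare_whiskerLeft (x : A) {y z : A} (f : y ⟶ z) (h : F.map f ≫ t z = t y ≫ G.map f) :
    F.map (x ◁ f) ≫ t (x ⊗ z) = t (x ⊗ y) ≫ G.map (x ◁ f) := by
  rw [← cancel_epi (μ F.toFunctor x y), ← Functor.LaxMonoidal.μ_natural_right_assoc, tensor,
    reassoc_of% (tensor x y), ← Functor.LaxMonoidal.μ_natural_right, ← id_tensorHom,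
    ← id_tensorHom, tensorHom_comp_tensorHom_assoc, tensorHom_comp_tensorHom_assoc, h,
    Category.id_comp, Category.comp_id]

theorem compare_whiskerRight {y z : A} (f : y ⟶ z) (x : A) (h : F.map f ≫ t z = t y ≫ G.map f) :
    F.map (f ▷ x) ≫ t (z ⊗ x) = t (y ⊗ x) ≫ G.map (f ▷ x) := by
  rw [← cancel_epi (μ F.toFunctor y x), ← Functor.LaxMonoidal.μ_natural_left_assoc, tensor,
    reassoc_of% (tensor y x), ← Functor.LaxMonoidal.μ_natural_left, ← tensorHom_id,
    ← tensorHom_id, tensorHom_comp_tensorHom_assoc, tensorHom_comp_tensorHom_assoc, h,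
    Category.id_comp, Category.comp_id]

theorem compare_associator (x y z : A) : F.map (α_ x y z).hom ≫ t (x ⊗ (y ⊗ z)) =
    t ((x ⊗ y) ⊗ z) ≫ G.map (α_ x y z).hom := by
  have h1 : μ F.toFunctor x y ▷ F.obj z ≫ (t (x ⊗ y) ⊗ₘ t z) =
      ((t x ⊗ₘ t y) ⊗ₘ t z) ≫ μ G.toFunctor x y ▷ G.obj z := by
    rw [← tensorHom_id, ← tensorHom_id, tensorHom_comp_tensorHom, tensorHom_comp_tensorHom,
      tensor, Category.id_comp, Category.comp_id]
  have h2 : F.obj x ◁ μ F.toFunctor y z ≫ (t x ⊗ₘ t (y ⊗ z)) =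
      (t x ⊗ₘ (t y ⊗ₘ t z)) ≫ G.obj x ◁ μ G.toFunctor y z := by
    rw [← id_tensorHom, ← id_tensorHom, tensorHom_comp_tensorHom, tensorHom_comp_tensorHom,
      tensor, Category.id_comp, Category.comp_id]
  rw [← cancel_epi (μ F.toFunctor (x ⊗ y) z), ← cancel_epi (μ F.toFunctor x y ▷ F.obj z),
    Functor.LaxMonoidal.associativity_assoc, tensor, reassoc_of% h2,
    reassoc_of% (tensor (x ⊗ y) z), reassoc_of% h1, Functor.LaxMonoidal.associativity,
    MonoidalCategory.associator_naturality_assoc]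

theorem compare_braiding (x y : A) :
    F.map (β_ x y).hom ≫ t (y ⊗ x) = t (x ⊗ y) ≫ G.map (β_ x y).hom := by
  rw [← cancel_epi (μ F.toFunctor x y), Functor.LaxBraided.braided_assoc, tensor,
    reassoc_of% (tensor x y), Functor.LaxBraided.braided,
    BraidedCategory.braiding_naturality_assoc]

variable (unit : ε F.toFunctor ≫ t (𝟙_ A) = ε G.toFunctor)
include unit

theorem compare_leftUnitor (x : A) :
    F.map (λ_ x).hom ≫ t x = t (𝟙_ A ⊗ x) ≫ G.map (λ_ x).hom := by
  have h1 : ε F.toFunctor ▷ F.obj x ≫ (t (𝟙_ A) ⊗ₘ t x) =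
      𝟙_ C ◁ t x ≫ ε G.toFunctor ▷ G.obj x := by
    rw [← tensorHom_id, ← tensorHom_id, ← id_tensorHom, tensorHom_comp_tensorHom,
      tensorHom_comp_tensorHom, unit, Category.id_comp, Category.comp_id, Category.id_comp]
  rw [← cancel_epi (μ F.toFunctor (𝟙_ A) x), ← cancel_epi (ε F.toFunctor ▷ F.obj x),
    ← Functor.LaxMonoidal.left_unitality_assoc, reassoc_of% (tensor (𝟙_ A) x), reassoc_of% h1,
    ← Functor.LaxMonoidal.left_unitality, leftUnitor_naturality]

theorem compare_rightUnitor (x : A) :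
    F.map (ρ_ x).hom ≫ t x = t (x ⊗ 𝟙_ A) ≫ G.map (ρ_ x).hom := by
  rw [← braiding_leftUnitor]
  exact compare_comp t _ _ (compare_braiding t tensor _ _) (compare_leftUnitor t tensor unit x)

/-- A 1-cell need not preserve the chosen `j`, so this is the one case that requires strictness of
`F` and `G` and identity components of `t`, beyond compatibility with the constraints. -/
theorem compare_j (hF : IsStrict F) (hG : IsStrict G) (hid : ∀ x, IsId (t x)) (x : A) :
    F.map (A.j x) ≫ t (A.dual x ⊗ x) = t (𝟙_ A) ≫ G.map (A.j x) := by
  have h1 : eqToHom (hF.obj_dual x).symm ▷ F.obj x ≫ (t (A.dual x) ⊗ₘ t x) =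
      (eqToHom (congrArg C.dual (hid x).choose) ⊗ₘ eqToHom (hid x).choose) ≫
        eqToHom (hG.obj_dual x).symm ▷ G.obj x := by
    rw [← tensorHom_id, ← tensorHom_id, tensorHom_comp_tensorHom, tensorHom_comp_tensorHom,
      Category.id_comp, Category.comp_id]
    congr 1
    · exact ((isId_eqToHom _).comp (hid _)).unique ((isId_eqToHom _).comp (isId_eqToHom _))
    · exact (hid x).unique (isId_eqToHom _)
  rw [← cancel_epi (ε F.toFunctor), ← reassoc_of% (hF.comparison x), tensor, reassoc_of% h1,
    reassoc_of% (j_eqToHom (hid x).choose), reassoc_of% unit, hG.comparison]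

end Compare

/-! ### Uniqueness of strict 1-cells out of a presentation -/

section Presentation
variable {C : SPC.{u}} {V : Type u} {E : Word V → Word V → Type u}
  {R : ∀ {X Y : Word V}, Arrow E X Y → Arrow E X Y → Prop}

theorem IsStrict.obj_eq {F G : presented R ⟶ C} (hF : IsStrict F) (hG : IsStrict G)
    (hobj : ∀ v, F.obj (⟨.of v⟩ : Presented R) = G.obj (⟨.of v⟩ : Presented R)) (X : Word V) :
    F.obj (⟨X⟩ : Presented R) = G.obj (⟨X⟩ : Presented R) := by
  induction X with
  | of v => exact hobj v
  | unit => exact hF.obj_unit.trans hG.obj_unit.symm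
  | dual X ih =>
      exact (hF.obj_dual (⟨X⟩ : Presented R)).trans
        ((congrArg C.dual ih).trans (hG.obj_dual (⟨X⟩ : Presented R)).symm)
  | tensor X Y ih ih' =>
      exact (hF.obj_tensor (⟨X⟩ : Presented R) (⟨Y⟩ : Presented R)).trans
        ((congrArg₂ (fun a b => a ⊗ b) ih ih').trans
          (hG.obj_tensor (⟨X⟩ : Presented R) (⟨Y⟩ : Presented R)).symm)

/-- Strict 1-cells out of a presented symmetric Picard category are equal if they agree on the
generators. -/
theorem IsStrict.presented_ext {F G : presented R ⟶ C} (hF : IsStrict F) (hG : IsStrict G)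
    (hobj : ∀ v, F.obj (⟨.of v⟩ : Presented R) = G.obj (⟨.of v⟩ : Presented R))
    (hgen : ∀ {X Y : Word V} (e : E X Y)
      (hX : F.obj (⟨X⟩ : Presented R) = G.obj (⟨X⟩ : Presented R))
      (hY : F.obj (⟨Y⟩ : Presented R) = G.obj (⟨Y⟩ : Presented R)),
      F.map (Presented.cls (R := R) (.gen e)) ≫ eqToHom hY =
        eqToHom hX ≫ G.map (Presented.cls (R := R) (.gen e))) : F = G := by
  have hX := hF.obj_eq hG hobj
  -- The family is made opaque, so that it is handled only through its compatibilities and `hid`.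
  obtain ⟨t, ht⟩ : ∃ t : ∀ X : presented R, F.obj X ⟶ G.obj X, ∀ X, t X = eqToHom (hX X.word) :=
    ⟨_, fun _ => rfl⟩
  have hid : ∀ X, IsId (t X) := fun X => ⟨_, ht X⟩
  -- Strictness makes every arrow in this square an identity, so the square commutes by
  -- `IsId.unique`.
  have tensor : ∀ X Y : presented R, μ F.toFunctor X Y ≫ t (X ⊗ Y) =
      (t X ⊗ₘ t Y) ≫ μ G.toFunctor X Y := fun X Y =>
    ((hF.isId_μ X Y).comp (hid _)).unique (((hid X).tensor (hid Y)).comp (hG.isId_μ X Y))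
  have unit : ε F.toFunctor ≫ t (𝟙_ (presented R)) = ε G.toFunctor :=
    (hF.isId_ε.comp (hid _)).unique hG.isId_ε
  have nat : ∀ {X Y : Word V} (f : Arrow E X Y), F.map (Presented.cls (R := R) f) ≫ t ⟨Y⟩ =
      t ⟨X⟩ ≫ G.map (Presented.cls (R := R) f) := by
    intro X Y f
    induction f with
    | @gen X Y e =>
        exact (congrArg (fun s => F.map (Presented.cls (R := R) (.gen e)) ≫ s) (ht ⟨Y⟩)).trans
          ((hgen e (hX X) (hX Y)).trans
            (congrArg (fun s => s ≫ G.map (Presented.cls (R := R) (.gen e))) (ht ⟨X⟩)).symm)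
    | id X => exact compare_id (A := presented R) (F := F) (G := G) t (⟨X⟩ : Presented R)
    | comp f g ihf ihg => exact compare_comp (A := presented R) (F := F) (G := G) t _ _ ihf ihg
    | inv f ih =>
        have e : Presented.cls (R := R) f.inv = inv (Presented.cls (R := R) f) :=
          IsIso.eq_inv_of_hom_inv_id (Presented.cls_sound (Rel.comp_inv f))
        rw [e]
        exact compare_inv (A := presented R) (F := F) (G := G) t _ ih
    | whiskerLeft X f ih => exact compare_whiskerLeft (A := presented R) (F := F) (G := G) t tensor (⟨X⟩ : Presented R) _ ih
    | whiskerRight f X ih => exact compare_whiskerRight (A := presented R) (F := F) (G := G) t tensor _ (⟨X⟩ : Presented R) ih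
    | assoc X Y Z =>
        exact compare_associator (A := presented R) (F := F) (G := G) t tensor (⟨X⟩ : Presented R) (⟨Y⟩ : Presented R)
          (⟨Z⟩ : Presented R)
    | left X => exact compare_leftUnitor (A := presented R) (F := F) (G := G) t tensor unit (⟨X⟩ : Presented R)
    | right X => exact compare_rightUnitor (A := presented R) (F := F) (G := G) t tensor unit (⟨X⟩ : Presented R)
    | braid X Y => exact compare_braiding (A := presented R) (F := F) (G := G) t tensor (⟨X⟩ : Presented R) (⟨Y⟩ : Presented R)
    | j X => exact compare_j (A := presented R) t tensor unit hF hG hid (⟨X⟩ : Presented R)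
  exact eq_of_isId (cell (F := F) (G := G) t (by rintro _ _ ⟨f⟩; exact nat f) tensor) hid

end Presentation

/-! ### Transposition between the tensor product and the internal hom -/

section Tensor
variable {A B C D : SPC.{u}}

theorem isStrict_point (a : A) : IsStrict (point a) := 
  lift_isStrict NoRel (fun _ => a) (fun e => e.elim) (fun h => h.elim)

theorem isStrict_v (A : SPC.{u}) : IsStrict (v A) := isStrict_point (A := ihom A A) (𝟙 A)

theorem isStrict_En (F : A ⟶ ihom B C) : IsStrict (En F) :=
  lift_isStrict (TRel A B) _ (enEdge F) (enEdge_rel F)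

/-- Strict 1-cells out of the unit are equal if they agree on the generator. -/
theorem IsStrict.unit_ext {F G : I ⟶ C} (hF : IsStrict F) (hG : IsStrict G)
    (h : F.obj star = G.obj star) : F = G :=
  IsStrict.presented_ext hF hG (fun _ => h) (fun e => e.elim)

/-- The 1-cell `Rn(En(F))` is `F`. -/
theorem η_comp_post_En (F : A ⟶ ihom B C) : η A B ≫ post B (En F) = F := by
  -- The tensor constraint of `En F` is an identity and `En F` sends `δ` to the constraint of `val F
  -- a`, so the composite has that constraint; the unit constraints need not be compared.
  have e : ∀ a, ηObj B a ≫ En F = val F a := fun a => by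
    refine hom_ext (fun _ => rfl) (fun f => ?_) (fun x y => ?_)
    · exact (Category.comp_id _).trans (Category.id_comp _).symm
    · change (𝟙 _ ≫ μ (val F a).toFunctor x y) ≫ 𝟙 _ =
        (𝟙 ((val F a).obj x) ⊗ₘ 𝟙 ((val F a).obj y)) ≫ μ (val F a).toFunctor x y
      simp
  refine hom_ext (fun a => e a)
    (fun {a a'} f => cell_ext (F := ηObj B a ≫ En F) (G := val F a') fun b => ?_)
    (fun a a' => cell_ext (F := add (ηObj B a ≫ En F) (ηObj B a' ≫ En F))
      (G := val F (a ⊗ a')) fun b => ?_)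
  · change app (valMap F f) b ≫ app (eqToHom (e a')) b =
      app (eqToHom (e a)) b ≫ app (valMap F f) b
    rw [app_eqToHom, app_eqToHom]
    exact (Category.comp_id _).trans (Category.id_comp _).symm
  · change (𝟙 _ ≫ appμ F a a' b) ≫ app (eqToHom (e (a ⊗ a'))) b =
      (app (eqToHom (e a)) b ⊗ₘ app (eqToHom (e a')) b) ≫ appμ F a a' b
    rw [app_eqToHom, app_eqToHom, app_eqToHom]
    change (𝟙 _ ≫ appμ F a a' b) ≫ 𝟙 _ =
      (𝟙 ((val F a).obj b) ⊗ₘ 𝟙 ((val F a').obj b)) ≫ appμ F a a' b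
    simp

/-- Strict 1-cells out of a tensor product are equal if their images under `Rn` are. -/
theorem IsStrict.tensor_ext {F G : tensor A B ⟶ C} (hF : IsStrict F) (hG : IsStrict G)
    (h : η A B ≫ post B F = η A B ≫ post B G) : F = G := by
  have e : ∀ a, ηObj B a ≫ F = ηObj B a ≫ G := fun a =>
    congrArg (fun K : A ⟶ ihom B C => val K a) h
  have hobj : ∀ a b, F.obj (tmk a b) = G.obj (tmk a b) := fun a b =>
    congrArg (fun K : B ⟶ C => K.obj b) (e a)
  have happ : ∀ a, (app (eqToHom h) a : ηObj B a ≫ F ⟶ ηObj B a ≫ G) = eqToHom (e a) :=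
    fun a => app_eqToHom h a
  have happ' : ∀ a b, app (F := ηObj B a ≫ F) (G := ηObj B a ≫ G) (eqToHom (e a)) b =
      eqToHom (hobj a b) := fun a b => app_eqToHom (e a) b
  -- The transposes see `γ` and `δ` only preceded by the constraints of `F` and `G`; these are
  -- identities by strictness and can be cancelled.
  have hμ : ∀ {X Y Z : tensor A B} (f : X ⊗ Y ⟶ Z) (pX : F.obj X = G.obj X)
      (pY : F.obj Y = G.obj Y) (pXY : F.obj (X ⊗ Y) = G.obj (X ⊗ Y)) (pZ : F.obj Z = G.obj Z)
      (_ : (μ F.toFunctor X Y ≫ F.map f) ≫ eqToHom pZ =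
        (eqToHom pX ⊗ₘ eqToHom pY) ≫ μ G.toFunctor X Y ≫ G.map f),
      F.map f ≫ eqToHom pZ = eqToHom pXY ≫ G.map f := by
    intro X Y Z f pX pY pXY pZ hf
    have h1 : (eqToHom pX ⊗ₘ eqToHom pY) ≫ μ G.toFunctor X Y = μ F.toFunctor X Y ≫ eqToHom pXY :=
      (((isId_eqToHom _).tensor (isId_eqToHom _)).comp (hG.isId_μ X Y)).unique
        ((hF.isId_μ X Y).comp (isId_eqToHom _))
    rw [← cancel_epi (μ F.toFunctor X Y), ← reassoc_of% h1, ← hf, Category.assoc]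
  refine IsStrict.presented_ext hF hG (fun p => hobj p.1 p.2) (fun {X Y} s hX hY => ?_)
  -- Each kind of generating arrow is one part of the equality of transposes: `a ⊗ g` and `δ` are
  -- the arrow part and tensor constraint of the 1-cell at `a`, while `f ⊗ b` and `γ` are those of
  -- the transpose itself, taken at `b`.
  cases s with
  | @left a b b' g =>
      have h1 := app_naturality (eqToHom (e a)) g
      rw [happ', happ'] at h1
      exact h1
  | @right a a' f b =>
      have h1 := congrArg (fun s : (ηObj B a ≫ F ⟶ ηObj B a' ≫ G) => app s b)
        (app_naturality (eqToHom h) f)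
      rw [happ, happ] at h1
      change F.map (tr f b) ≫ app (eqToHom (e a')) b =
        app (eqToHom (e a)) b ≫ G.map (tr f b) at h1
      rw [happ', happ'] at h1
      exact h1
  | γ a a' b =>
      have h1 := congrArg (fun s : (add (ηObj B a ≫ F) (ηObj B a' ≫ F) ⟶ ηObj B (a ⊗ a') ≫ G) =>
        app s b) (app_tensor (eqToHom h) a a')
      rw [happ, happ, happ] at h1
      change (μ F.toFunctor (tmk a b) (tmk a' b) ≫ F.map (tγ a a' b)) ≫
          app (eqToHom (e (a ⊗ a'))) b =
        (app (eqToHom (e a)) b ⊗ₘ app (eqToHom (e a')) b) ≫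
          μ G.toFunctor (tmk a b) (tmk a' b) ≫ G.map (tγ a a' b) at h1
      rw [happ', happ', happ'] at h1
      exact hμ (tγ a a' b) (hobj a b) (hobj a' b) hX hY h1
  | δ a b b' =>
      have h1 := app_tensor (eqToHom (e a)) b b'
      rw [happ', happ', happ'] at h1
      exact hμ (tδ a b b') (hobj a b) (hobj a b') hX hY h1

end Tensor

/-! ### Associativity and unit laws for `v` and `L` -/

section Unit
variable {A B C D : SPC.{u}}

/-- This is `post_comp` made natural in the first factor, and it is what makes `Rn` natural in its
target. -/
theorem postHom_post (A B : SPC.{u}) (H : C ⟶ D) :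
    postHom A B C ≫ post (ihom A B) (post A H) = post B H ≫ postHom A B D := by
  refine hom_ext (fun (K : B ⟶ C) => (post_comp A K H).symm)
    (fun {K K' : B ⟶ C} (f : K ⟶ K') =>
      cell_ext (F := post A K ≫ post A H) (G := post A (K' ≫ H)) fun (F : A ⟶ B) =>
        cell_ext (F := (F ≫ K) ≫ H) (G := F ≫ K' ≫ H) fun x => ?_)
    (fun (K K' : B ⟶ C) =>
      cell_ext (F := add (post A K ≫ post A H) (post A K' ≫ post A H))
        (G := post A (add K K' ≫ H)) fun (F : A ⟶ B) =>
          cell_ext (F := add ((F ≫ K) ≫ H) ((F ≫ K') ≫ H)) (G := F ≫ add K K' ≫ H) fun x => ?_)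
  · change H.map (app f (F.obj x)) ≫ app (F := (F ≫ K') ≫ H) (G := F ≫ K' ≫ H)
        (app (eqToHom (post_comp A K' H).symm) F) x =
      app (F := (F ≫ K) ≫ H) (G := F ≫ K ≫ H)
        (app (eqToHom (post_comp A K H).symm) F) x ≫ H.map (app f (F.obj x))
    -- An identity 2-cell has identity components; applied twice, because the components of this one
    -- are again 2-cells.
    have h (K : B ⟶ C) : app (F := (F ≫ K) ≫ H) (G := F ≫ K ≫ H)
        (app (eqToHom (post_comp A K H).symm) F) x = 𝟙 (H.obj (K.obj (F.obj x))) :=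
      (((isId_eqToHom (post_comp A K H).symm).app F).app x).eq_id
    exact (congrArg (fun s => H.map (app f (F.obj x)) ≫ s) (h K')).trans
      ((Category.comp_id _).trans ((Category.id_comp _).symm.trans
        (congrArg (fun s => s ≫ H.map (app f (F.obj x))) (h K)).symm))
  · have h (K : B ⟶ C) : app (F := (F ≫ K) ≫ H) (G := F ≫ K ≫ H)
        (app (eqToHom (post_comp A K H).symm) F) x = 𝟙 (H.obj (K.obj (F.obj x))) :=
      (((isId_eqToHom (post_comp A K H).symm).app F).app x).eq_id
    change (μ H.toFunctor (K.obj (F.obj x)) (K'.obj (F.obj x)) ≫ H.map (𝟙 _)) ≫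
        app (F := (F ≫ add K K') ≫ H) (G := F ≫ add K K' ≫ H)
          (app (eqToHom (post_comp A (add K K') H).symm) F) x =
      (app (F := (F ≫ K) ≫ H) (G := F ≫ K ≫ H) (app (eqToHom (post_comp A K H).symm) F) x ⊗ₘ
        app (F := (F ≫ K') ≫ H) (G := F ≫ K' ≫ H) (app (eqToHom (post_comp A K' H).symm) F) x) ≫
          𝟙 _ ≫ μ H.toFunctor (K.obj (F.obj x)) (K'.obj (F.obj x))
    rw [h, h, h]
    change (_ ≫ H.map (𝟙 _)) ≫ 𝟙 (H.obj (K.obj (F.obj x) ⊗ K'.obj (F.obj x))) =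
      (𝟙 (H.obj (K.obj (F.obj x))) ⊗ₘ 𝟙 (H.obj (K'.obj (F.obj x)))) ≫
        𝟙 (H.obj (K.obj (F.obj x)) ⊗ H.obj (K'.obj (F.obj x))) ≫ _
    simp

theorem isStrict_Rn (A B C : SPC.{u}) : IsStrict (Rn A B C) :=
  (isStrict_postHom _ _ _).comp (isStrict_pre _ _)

/-- Naturality of transposition in the target. It is needed because `assocHom` is defined through
`Rn`, and a 1-cell that follows it has to be carried past `Rn`. -/
theorem Rn_post (A B : SPC.{u}) (H : C ⟶ D) :
    Rn A B C ≫ post A (post B H) = post (tensor A B) H ≫ Rn A B D := by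
  rw [Rn, Rn, Category.assoc, pre_post, ← Category.assoc, postHom_post, Category.assoc]

theorem η_comp_post_En_comp (F : A ⟶ ihom B C) (G : C ⟶ D) :
    η A B ≫ post B (En F ≫ G) = F ≫ post B G := by
  rw [post_comp, ← Category.assoc, η_comp_post_En]

/-- Naturality of transposition in the two factors of the tensor product: `tensorMap F G` turns into
composition with `F` on one side and `pre G C` on the other. -/
theorem η_comp_post_tensorMap_comp {A' B' : SPC.{u}} (F : A ⟶ A') (G : B ⟶ B')
    (H : tensor A' B' ⟶ C) :
    η A B ≫ post B (tensorMap F G ≫ H) = F ≫ (η A' B' ≫ post B' H) ≫ pre G C := by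
  rw [tensorMap, η_comp_post_En_comp]
  simp only [Category.assoc, pre_post]

theorem η_comp_post_L (A : SPC.{u}) : η I A ≫ post A (L A) = v A := η_comp_post_En (v A)

/-- Both sides are strict, so only `star` matters. As `v I` sends it to the identity, each side
becomes `v I` composed with an identity. -/
theorem v_assoc : v I ≫ postHom I I I ≫ pre (v I) (ihom I I) = v I.{u} ≫ post I (v I) := by
  refine IsStrict.unit_ext ((isStrict_v I).comp ((isStrict_postHom I I I).comp (isStrict_pre _ _)))
    ((isStrict_v I).comp (isStrict_post I (isStrict_v I))) ?_
  change v I ≫ post I (𝟙 I) = 𝟙 I ≫ v I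
  rw [post_id, Category.comp_id, Category.id_comp]

theorem v_right : 𝟙 I.{u} = v I ≫ pre (𝟙 I) I ≫ ev star I :=
  IsStrict.unit_ext (isStrict_id I)
    ((isStrict_v I).comp ((isStrict_pre _ _).comp (isStrict_ev _ _))) rfl

/-- The right-hand side is the value of `v I` at `star`, which is the identity by definition, so
freeness of `I` is not needed here. -/
theorem v_left : 𝟙 I.{u} = dualize (v I) ≫ pre (𝟙 I) I ≫ ev star I := by
  rw [pre_id, Category.id_comp, dualize_comp_ev]
  rfl

theorem isStrict_L (A : SPC.{u}) : IsStrict (L A) := isStrict_En (v A)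

theorem isStrict_tensorMap {A' B' : SPC.{u}} (F : A ⟶ A') (G : B ⟶ B') :
    IsStrict (tensorMap F G) := isStrict_En _

theorem isStrict_assocHom (A B C : SPC.{u}) : IsStrict (assocHom A B C) := isStrict_En _

/-- Two transpositions remove the two tensor products from the source, leaving strict 1-cells `I ⟶
ihom I (ihom I I)` to be compared at `star`. -/
theorem L_assoc : assocHom I I I ≫ tensorMap (𝟙 I) (L I) ≫ L I =
    tensorMap (L I) (𝟙 I) ≫ L I.{u} := by
  have hL := isStrict_L I.{u}
  have hK := (isStrict_tensorMap (𝟙 I.{u}) (L I)).comp hL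
  refine IsStrict.tensor_ext ((isStrict_assocHom I I I).comp hK)
    ((isStrict_tensorMap _ _).comp hL) ?_
  rw [assocHom, η_comp_post_En_comp, η_comp_post_tensorMap_comp, η_comp_post_L, pre_id,
    Category.comp_id]
  -- After the first transposition the right side is `L I ≫ v I`. The inner `En` in `assocHom` keeps
  -- the left side strict, so a second transposition is possible.
  refine IsStrict.tensor_ext ((isStrict_En _).comp (isStrict_post I hK))
    (hL.comp (isStrict_v I)) ?_
  rw [η_comp_post_En_comp, Category.assoc, Rn_post, ← Category.assoc, η_comp_post_tensorMap_comp,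
    η_comp_post_L, Category.id_comp, L, η_comp_post_En_comp, ← L]
  -- What remains is `(v I ≫ pre (L I) I) ≫ Rn I I I` against `v I ≫ post I (v I)`. At `star` the
  -- left is the transpose of `L I` and the right is `v I`.
  refine IsStrict.unit_ext (((isStrict_v I).comp (isStrict_pre _ _)).comp (isStrict_Rn I I I))
    ((isStrict_v I).comp (isStrict_post I (isStrict_v I))) ?_
  change η I I ≫ post I (L I ≫ 𝟙 I) = 𝟙 I ≫ v I
  rw [Category.comp_id, Category.id_comp, η_comp_post_L]

/-- Moving `ev star` to the end exposes the transpose of `L I`, which is `v I`, and what is left is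
the right unit law of the hom form. -/
theorem L_right : 𝟙 I.{u} = rightHom I ≫ tensorMap (𝟙 I) (𝟙 I) ≫ L I := by
  rw [rightHom, Category.assoc, ev_comp, ← Category.assoc, η_comp_post_tensorMap_comp,
    η_comp_post_L, Category.id_comp, Category.assoc]
  exact v_right

/-- By `dualize_comp_ev`, `leftHom I` is the value of `η I I` at `star`. The right-hand side is
therefore the value at `star` of a transpose equal to `v I`. -/
theorem L_left : 𝟙 I.{u} = leftHom I ≫ tensorMap (𝟙 I) (𝟙 I) ≫ L I := by
  have h := η_comp_post_tensorMap_comp (𝟙 I.{u}) (𝟙 I) (L I)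
  rw [η_comp_post_L, pre_id, Category.comp_id, Category.id_comp] at h
  rw [leftHom, dualize_comp_ev]
  exact (congrArg (fun K : I ⟶ ihom I I => val K star) h).symm

end Unit

/-! ### The two strict 2-ring structures on the unit -/

section TwoRing
variable {A : SPC.{u}}

theorem TwoRingData.isId_assocApp {R : TwoRingData A} (h : IsIdentity R.assoc) (k g f : A) :
    IsId (R.assocApp k g f) :=
  IsId.app (F := val R.mul g ≫ val R.mul k) (G := val R.mul (R.prod k g))
    (IsId.app (F := R.mul ≫ post A (val R.mul k)) (G := val R.mul k ≫ R.mul) (IsId.app h k) g) f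

theorem TwoRingData.isId_prodLeft (R : TwoRingData A) (g : A) {f f' : A} {t : f ⟶ f'}
    (h : IsId t) : IsId (R.prodLeft g t) := h.map (val R.mul g).toFunctor

theorem TwoRingData.isId_prodRight (R : TwoRingData A) {g g' : A} {t : g ⟶ g'} (h : IsId t)
    (f : A) : IsId (R.prodRight t f) :=
  IsId.app (F := val R.mul g) (G := val R.mul g') (h.map R.mul.toFunctor) f

/-- Identity 2-cells are coherent. -/
def TwoRingData.toTwoRing (R : TwoRingData A) (ha : IsIdentity R.assoc) (hr : IsIdentity R.right)
    (hl : IsIdentity R.left) : TwoRing A where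
  toTwoRingData := R
  pentagon k h g f := ((isId_assocApp ha k h _).comp (isId_assocApp ha _ g f)).unique
    ((R.isId_prodLeft k (isId_assocApp ha h g f)).comp ((isId_assocApp ha k _ f).comp
      (R.isId_prodRight (isId_assocApp ha k h g) f)))
  triangle g f := ((R.isId_prodLeft g (IsId.app hl f)).comp (isId_assocApp ha g _ f)).unique
    (R.isId_prodRight (IsId.app hr g) f)

theorem TensorTwoRingData.isId_assocApp {R : TensorTwoRingData A} (h : IsIdentity R.assoc)
    (k g f : A) : IsId (R.assocApp k g f) := IsId.app h (tmk (tmk k g) f)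

theorem TensorTwoRingData.isId_prodLeft (R : TensorTwoRingData A) (g : A) {f f' : A}
    {t : f ⟶ f'} (h : IsId t) : IsId (R.prodLeft g t) :=
  (h.map (ηObj A g).toFunctor).map R.mul.toFunctor

/-- The arrow `t ⊗ f` is the component at `f` of the image of `t` under `η A A`, and functors and
components preserve identities. -/
theorem TensorTwoRingData.isId_prodRight (R : TensorTwoRingData A) {g g' : A} {t : g ⟶ g'}
    (h : IsId t) (f : A) : IsId (R.prodRight t f) :=
  (IsId.app (F := ηObj A g) (G := ηObj A g') (h.map (η A A).toFunctor) f).map R.mul.toFunctor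

/-- Identity 2-cells are coherent. -/
def TensorTwoRingData.toTensorTwoRing (R : TensorTwoRingData A) (ha : IsIdentity R.assoc)
    (hr : IsIdentity R.right) (hl : IsIdentity R.left) : TensorTwoRing A where
  toTensorTwoRingData := R
  pentagon k h g f := ((isId_assocApp ha k h _).comp (isId_assocApp ha _ g f)).unique
    ((R.isId_prodLeft k (isId_assocApp ha h g f)).comp ((isId_assocApp ha k _ f).comp
      (R.isId_prodRight (isId_assocApp ha k h g) f)))
  triangle g f := ((R.isId_prodLeft g (IsId.app hl f)).comp (isId_assocApp ha g _ f)).unique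
    (R.isId_prodRight (IsId.app hr g) f)

/-- The strict 2-ring structure on the unit, in terms of the internal hom. -/
def unitTwoRing : TwoRing I.{u} :=
  TwoRingData.toTwoRing
    { mul := v I
      unit := 𝟙 I
      unit_isStrict := isStrict_id I
      assoc := eqToHom v_assoc
      right := eqToHom v_right
      left := eqToHom v_left }
    ⟨v_assoc, rfl⟩ ⟨v_right, rfl⟩ ⟨v_left, rfl⟩

/-- The strict 2-ring structure on the unit, in terms of the tensor product. -/
def unitTensorTwoRing : TensorTwoRing I.{u} :=
  TensorTwoRingData.toTensorTwoRing
    { mul := L I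
      mul_isStrict := isStrict_L I
      unit := 𝟙 I
      unit_isStrict := isStrict_id I
      assoc := eqToHom L_assoc
      right := eqToHom L_right
      left := eqToHom L_left }
    ⟨L_assoc, rfl⟩ ⟨L_right, rfl⟩ ⟨L_left, rfl⟩

theorem Rn_obj_L (A : SPC.{u}) : (Rn I A A).obj (L A) = v A := η_comp_post_L A

end TwoRing

end SPC

end

theorem mainTheorem5 :
    (∃ R : SPC.TwoRing SPC.I.{u}, R.IsStrict ∧ R.mul = SPC.v SPC.I ∧ R.unit = 𝟙 SPC.I) ∧
    (∃ T : SPC.TensorTwoRing SPC.I.{u}, T.IsStrict ∧ T.mul = SPC.L SPC.I ∧ T.unit = 𝟙 SPC.I) ∧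
    (SPC.Rn SPC.I SPC.I SPC.I.{u}).obj (SPC.L SPC.I) = SPC.v SPC.I := by
  refine ⟨⟨SPC.unitTwoRing, ⟨SPC.isStrict_v SPC.I, ⟨SPC.v_assoc, rfl⟩, ⟨SPC.v_right, rfl⟩,
    ⟨SPC.v_left, rfl⟩⟩, rfl, rfl⟩, ⟨SPC.unitTensorTwoRing, ⟨?_, ⟨SPC.L_assoc, rfl⟩,
      ⟨SPC.L_right, rfl⟩, ⟨SPC.L_left, rfl⟩⟩, rfl, rfl⟩, SPC.Rn_obj_L SPC.I⟩
  -- Strictness of the multiplication in the tensor form concerns its transpose, which is `v I`.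
  change SPC.IsStrict ((SPC.Rn SPC.I SPC.I SPC.I).obj (SPC.L SPC.I) : SPC.I ⟶ SPC.ihom SPC.I SPC.I)
  rw [SPC.Rn_obj_L]
  exact SPC.isStrict_v SPC.I
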